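/- Setting. Let $\mathcal S,\mathcal A$ be finite nonempty sets, $P^*(\cdot|s,a)\in\Delta(\mathcal S)$, $R:\mathcal S\times\mathcal A\to[0,1]$, $\gamma\in[0,1)$, $\lambda,\sigma,\kappa>0$. Let $f:\mathbb R\to\mathbb R\cup\{+\infty\}$ be convex with $f(1)=0$, $f=+\infty$ on $(-\infty,0)$, finite and differentiable on $(0,\infty)$, with conjugate $f^*(y)=\sup_x\{xy-f(x)\}$. Put $$J(\eta,V;s')=-\lambda f^*\Big(\frac{\eta-V(s')}{\lambda}\Big)+\eta,\qquad J^{(s,a)}(\eta,V)=\sum_{s'}P^*(s'|s,a)\,J(\eta,V;s').$$ Let $Q^*_{\rm rob,p}$ be the fixed point of the robust Bellman operator $\mathcal T Q(s,a)=R(s,a)+\gamma\sup_{\eta\in\mathbb R}J^{(s,a)}(\eta,\max_{a'}Q(\cdot,a'))$ (it exists and is unique). Assumptions. Let $\mathcal V=[0,(1-\gamma)^{-1}]^{\mathcal S}$ and let $\Theta\subset\mathbb R$ be a compact interval. For all $V\in\mathcal V$ and all $(s,a)$: $J^{(s,a)}(\cdot,V)$ attains its maximum over $\mathbb R$ at a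 point $\eta^*_V(s,a)\in\Theta$; $J^{(s,a)}(\cdot,V)$ is $\frac1{\lambda\sigma}$-smooth on $\Theta$; and (local strong concavity) $\partial_\eta J^{(s,a)}(\eta,V)\,(\eta-\eta^*_V(s,a))\le-\kappa(\eta-\eta^*_V(s,a))^2$ for all $\eta\in\Theta$. Moreover $|J(\eta,V;s')|\le C_M$ for all $\eta\in\Theta$, $V\in\mathcal V$, $s'\in\mathcal S$, where $C_M\ge(1-\gamma)^{-1}$. Let $\pi$ be a behavior policy, $P^\pi(s',a'|s,a)=P^*(s'|s,a)\pi(a'|s')$, and assume that $P^\pi$ has a stationary distribution $d_\pi$ with $\sup_{(s,a)}d_{TV}((P^\pi)^t(\cdot|(s,a)),d_\pi)\le M\rho^t$ for all $t\ge0$, where $M>0$, $\rho\in(0,1)$, and that $d_{\min}=\min d_\pi>0$; let $d_{\max}=\max d_\pi$. Algorithm. Along a single trajectory $s_0\sim\mu_0$ (arbitrary), $a_t\sim\pi(\cdot|s_t)$, $s_{t+1}\sim P^*(\cdot|s_t,a_t)$ with rewards $r_t\in[0,1]$ of conditional mean $R(s_t,a_t)$, start from $Q_0\equiv(1-\gamma)^{-1}$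 and any $\eta_0\in\Theta^{\mathcal S\times\mathcal A}$, and put $V_t=\Pi_{[0,(1-\gamma)^{-1}]}(\max_aQ_t(\cdot,a))$, $$Q_{t+1}(s_t,a_t)=(1-\beta_t)Q_t(s_t,a_t)+\beta_t\big(r_t+\gamma J(\eta_t(s_t,a_t),V_t;s_{t+1})\big),$$ $$\eta_{t+1}(s_t,a_t)=\Pi_\Theta\big(\eta_t(s_t,a_t)+\alpha_t\,\partial_\eta J(\eta_t(s_t,a_t),V_t;s_{t+1})\big),$$ all other entries being unchanged, with $$\alpha_t=\frac1{\kappa d_{\min}(t+p_\alpha)^{2/3}},\quad \beta_t=\frac1{(1-\gamma)d_{\min}(t+p^\dagger)},\quad p_\alpha=\Big\lceil\Big(\frac{d_{\max}}{d_{\min}}\Big)^{3/2}\Big\rceil,\quad p^\dagger=\Big\lceil\frac{d_{\max}}{(1-\gamma)d_{\min}}\Big\rceil .$$ Conclusion. $\mathbb E\|Q_t-Q^*_{\rm rob,p}\|_\infty\le\widetilde{\mathcal O}\Big(\frac{\Phi_1}{\sigma\lambda d_{\min}(1-\gamma)^2(t+1)^{1/3}}\Big)$ up to terms of lower order in $t$,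 in the following sense: there are an absolute constant $C>0$ and a constant $K\ge0$ that depends only on $\gamma,\lambda,\sigma,\kappa,M,\rho,\mathrm{diam}(\Theta),C_M,d_{\min},d_{\max}$ such that, for every $t\ge0$, $$\mathbb E\|Q_t-Q^*_{\rm rob,p}\|_\infty\le C\,\frac{\Phi_1}{\sigma\lambda d_{\min}(1-\gamma)^2(t+1)^{1/3}}+\frac{K}{(t+1)^{1/2}},$$ where, with $D=\mathrm{diam}(\Theta)$, $C_g=\frac{D+(1-\gamma)^{-1}}{\lambda\sigma}$ and $\ell=\sqrt{\ln(2|\mathcal S||\mathcal A|)}$, $$\Phi_1=\frac{3DM(\kappa D+2C_g+2d_{\min}\ell)}{\kappa d_{\min}^2(1-\rho)}+\frac{6C_g(2\kappa d_{\min}D\,\ell+2C_g)}{\kappa^2d_{\min}^2}+\frac{12C_M^2}{d_{\min}^2(1-\gamma)^2}.$$ -/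

import Mathlib

open MeasureTheory ProbabilityTheory
open scoped BigOperators

noncomputable section

namespace RobustQ

/-- The class of extended-real functions generating an `f`-divergence: `f` is convex (its epigraph
is convex), `f 1 = 0`, `f = +∞` on the negative half-line, `f` is finite and differentiable on the
positive half-line.  The value at `0` may be finite or `+∞`. -/
structure IsDivergenceFn (f : ℝ → EReal) : Prop where
  convex_epigraph : Convex ℝ {p : ℝ × ℝ | f p.1 ≤ (p.2 : EReal)}
  map_one : f 1 = 0
  eq_top_of_neg : ∀ x : ℝ, x < 0 → f x = ⊤
  ne_top_of_pos : ∀ x : ℝ, 0 < x → f x ≠ ⊤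
  ne_bot_of_pos : ∀ x : ℝ, 0 < x → f x ≠ ⊥
  differentiableOn : DifferentiableOn ℝ (fun x => (f x).toReal) (Set.Ioi 0)

/-- The convex conjugate `f^*(y) = sup_x (x y - f x)`, with values in the extended reals. -/
def conj (f : ℝ → EReal) (y : ℝ) : EReal :=
  ⨆ x : ℝ, (((x * y : ℝ) : EReal) - f x)

/-- The sampled dual objective `J(η, V; s') = -lam f^*((η - V(s')) / lam) + η`, as a function of
`η` and of the number `v = V(s')`. -/
def sampleJ (f : ℝ → EReal) (lam η v : ℝ) : EReal :=
  (η : EReal) - (lam : EReal) * conj f ((η - v) / lam)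

section Finite

variable {S A : Type*} [Fintype S] [Fintype A]

/-- The dual objective
`J^{(s,a)}(η, V) = -lam ∑_{s'} P(s' | s, a) f^*((η - V(s')) / lam) + η`. -/
def dualJ (f : ℝ → EReal) (lam : ℝ) (P : S → A → S → ℝ) (s : S) (a : A) (η : ℝ) (V : S → ℝ) :
    EReal :=
  (η : EReal) - (lam : EReal) * ∑ s' : S, (P s a s' : EReal) * conj f ((η - V s') / lam)

/-- The greedy value function `s ↦ max_a Q(s, a)`. -/
def greedy (Q : S × A → ℝ) (s : S) : ℝ := ⨆ a : A, Q (s, a)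

/-- The penalized robust Bellman operator
`(T Q)(s, a) = R(s, a) + γ sup_η J^{(s,a)}(η, max_{a'} Q(·, a'))`. -/
def robustBellman (f : ℝ → EReal) (lam γ : ℝ) (P : S → A → S → ℝ) (R : S → A → ℝ)
    (Q : S × A → ℝ) (x : S × A) : EReal :=
  (R x.1 x.2 : EReal) + (γ : EReal) * ⨆ η : ℝ, dualJ f lam P x.1 x.2 η (greedy Q)

/-- `Q` is a fixed point of the penalized robust Bellman operator. -/
def IsRobustFixedPoint (f : ℝ → EReal) (lam γ : ℝ) (P : S → A → S → ℝ) (R : S → A → ℝ)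
    (Q : S × A → ℝ) : Prop :=
  ∀ x : S × A, ((Q x : ℝ) : EReal) = robustBellman f lam γ P R Q x

/-- The box `[0, (1 - γ)⁻¹]^S` of value functions. -/
def valueBox (S : Type*) (γ : ℝ) : Set (S → ℝ) :=
  {V | ∀ s, V s ∈ Set.Icc (0 : ℝ) (1 - γ)⁻¹}

/-- `η` maximizes the dual objective `J^{(s,a)}(·, V)` over the whole real line. -/
def IsDualMax (f : ℝ → EReal) (lam : ℝ) (P : S → A → S → ℝ) (s : S) (a : A) (V : S → ℝ)
    (η : ℝ) : Prop :=
  ∀ η' : ℝ, dualJ f lam P s a η' V ≤ dualJ f lam P s a η V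

/-- For every value function in the box, the dual problem attains its supremum in `Θ`. -/
def DualMaxIn (f : ℝ → EReal) (lam γ : ℝ) (P : S → A → S → ℝ) (Θ : Set ℝ) : Prop :=
  ∀ V ∈ valueBox S γ, ∀ s a, ∃ η ∈ Θ, IsDualMax f lam P s a V η

/-- For every value function in the box, `J^{(s,a)}(·, V)` is `1 / (lam σ)`-smooth on `Θ`:
differentiable with `1 / (lam σ)`-Lipschitz derivative (one-sided at the end points of `Θ`). -/
def DualSmoothOn (f : ℝ → EReal) (lam γ σ : ℝ) (P : S → A → S → ℝ) (Θ : Set ℝ) : Prop :=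
  ∀ V ∈ valueBox S γ, ∀ s a,
    DifferentiableOn ℝ (fun η => (dualJ f lam P s a η V).toReal) Θ ∧
    ∀ η ∈ Θ, ∀ η' ∈ Θ,
      |derivWithin (fun η => (dualJ f lam P s a η V).toReal) Θ η
        - derivWithin (fun η => (dualJ f lam P s a η V).toReal) Θ η'| ≤ 1 / (lam * σ) * |η - η'|

/-- Local strong concavity with modulus `κ`: for every value function in the box,
`∇J^{(s,a)}(η, V) (η - η*) ≤ -κ (η - η*)²` on `Θ`, where `η*` maximizes `J^{(s,a)}(·, V)`. -/
def DualStronglyConcaveOn (f : ℝ → EReal) (lam γ κ : ℝ) (P : S → A → S → ℝ) (Θ : Set ℝ) : Prop :=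
  ∀ V ∈ valueBox S γ, ∀ s a, ∀ ηstar ∈ Θ, IsDualMax f lam P s a V ηstar → ∀ η ∈ Θ,
    derivWithin (fun η => (dualJ f lam P s a η V).toReal) Θ η * (η - ηstar)
      ≤ -κ * (η - ηstar) ^ 2

/-- The transition matrix on state-action pairs induced by the behavior policy `π`. -/
def chainMatrix (P : S → A → S → ℝ) (π : S → A → ℝ) : Matrix (S × A) (S × A) ℝ :=
  Matrix.of fun x y => P x.1 x.2 y.1 * π y.1 y.2

open Classical in
/-- Geometric mixing: `d` is a stationary distribution of the chain of state-action pairs, and the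
total variation distance of the `t`-step law from `d` is at most `M ρ^t`, from every start. -/
def GeometricMixing (P : S → A → S → ℝ) (π : S → A → ℝ) (d : S × A → ℝ) (M ρ : ℝ) : Prop :=
  d ∈ stdSimplex ℝ (S × A) ∧ Matrix.vecMul d (chainMatrix P π) = d ∧
    ∀ (t : ℕ) (x : S × A), (1 / 2 : ℝ) * ∑ y : S × A, |(chainMatrix P π ^ t) x y - d y| ≤ M * ρ ^ t

/-- Projection of `max_a Q(·, a)` onto the box `[0, (1 - γ)⁻¹]^S`. -/
def clippedGreedy (γ : ℝ) (Q : S × A → ℝ) (s : S) : ℝ := max 0 (min (1 - γ)⁻¹ (greedy Q s))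

open Classical in
/-- One iteration of the single-trajectory algorithm: at the visited pair `x`, with reward `rw`,
next state `s'` and step sizes `α` (dual variable) and `β` (Q-value), only the entries at `x` of
the pair `(Q, η)` are changed.  The dual variable is projected onto `[lo, hi]`. -/
def step (f : ℝ → EReal) (lam γ lo hi α β : ℝ) (x : S × A) (rw : ℝ) (s' : S)
    (z : (S × A → ℝ) × (S × A → ℝ)) : (S × A → ℝ) × (S × A → ℝ) :=
  (Function.update z.1 x
      ((1 - β) * z.1 x + β * (rw + γ * (sampleJ f lam (z.2 x) (clippedGreedy γ z.1 s')).toReal)),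
    Function.update z.2 x
      (max lo (min hi (z.2 x + α * derivWithin
        (fun η => (sampleJ f lam η (clippedGreedy γ z.1 s')).toReal) (Set.Icc lo hi) (z.2 x)))))

/-- The iterates `(Q_t, η_t)` of the single-trajectory algorithm along a trajectory `st`, `act` with
rewards `rw`, started at `Q_0 = (1 - γ)⁻¹` and `η_0 = η0`. -/
def iterates (f : ℝ → EReal) (lam γ lo hi : ℝ) (α β : ℕ → ℝ) (η0 : S × A → ℝ)
    (st : ℕ → S) (act : ℕ → A) (rw : ℕ → ℝ) : ℕ → (S × A → ℝ) × (S × A → ℝ)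
  | 0 => (fun _ => (1 - γ)⁻¹, η0)
  | t + 1 => step f lam γ lo hi (α t) (β t) (st t, act t) (rw t) (st (t + 1))
      (iterates f lam γ lo hi α β η0 st act rw t)

end Finite

section Trajectory

variable {S A Ω : Type*}

/-- The sigma-algebra generated by `s_0, a_0, …, s_t, a_t` and `r_0, …, r_{t-1}`. -/
abbrev history [MeasurableSpace S] [MeasurableSpace A] (st : ℕ → Ω → S) (act : ℕ → Ω → A)
    (rw : ℕ → Ω → ℝ) (t : ℕ) : MeasurableSpace Ω :=
  (⨆ i : ℕ, ⨆ _ : i ≤ t,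
      (MeasurableSpace.comap (st i) inferInstance ⊔ MeasurableSpace.comap (act i) inferInstance)) ⊔
    ⨆ i : ℕ, ⨆ _ : i < t, MeasurableSpace.comap (rw i) inferInstance

/-- A single trajectory with rewards: `s_0 ∼ μ0`, `a_t ∼ π(· | s_t)`, `s_{t+1} ∼ P(· | s_t, a_t)`,
and rewards `r_t ∈ [0, 1]` of conditional mean `R(s_t, a_t)`. -/
structure IsTrajectory [MeasurableSpace S] [MeasurableSpace A] [MeasurableSpace Ω]
    (μ : Measure Ω) (P : S → A → S → ℝ) (R : S → A → ℝ) (π : S → A → ℝ) (μ0 : S → ℝ)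
    (st : ℕ → Ω → S) (act : ℕ → Ω → A) (rw : ℕ → Ω → ℝ) : Prop where
  measurable_state : ∀ t, Measurable (st t)
  measurable_action : ∀ t, Measurable (act t)
  measurable_reward : ∀ t, Measurable (rw t)
  init : ∀ s a, μ.real {ω | st 0 ω = s ∧ act 0 ω = a} = μ0 s * π s a
  reward_mem : ∀ t, ∀ᵐ ω ∂μ, rw t ω ∈ Set.Icc (0 : ℝ) 1
  reward_mean : ∀ t, μ[rw t | history st act rw t] =ᵐ[μ] fun ω => R (st t ω) (act t ω)
  transition : ∀ t s a,
    μ[Set.indicator {ω | st (t + 1) ω = s ∧ act (t + 1) ω = a} (fun _ => (1 : ℝ)) |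
        history st act rw t]
      =ᵐ[μ] fun ω => P (st t ω) (act t ω) s * π s a

end Trajectory

/-- Step size of the dual variable: `α_t = 1 / (κ dmin (t + p)^{2/3})`, with
`p = ⌈(dmax / dmin)^{3/2}⌉`. -/
def alphaStep (κ dmin dmax : ℝ) (t : ℕ) : ℝ :=
  1 / (κ * dmin * ((t : ℝ) + (⌈(dmax / dmin) ^ (3 / 2 : ℝ)⌉₊ : ℝ)) ^ (2 / 3 : ℝ))

/-- Step size of the Q-values: `β_t = 1 / ((1 - γ) dmin (t + p))`, with
`p = ⌈dmax / ((1 - γ) dmin)⌉`. -/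
def betaStep (γ dmin dmax : ℝ) (t : ℕ) : ℝ :=
  1 / ((1 - γ) * dmin * ((t : ℝ) + (⌈dmax / ((1 - γ) * dmin)⌉₊ : ℝ)))

/-- `C_g = (diam Θ + (1 - γ)⁻¹) / (lam σ)`; here `D = diam Θ`. -/
def gradBound (γ lam σ D : ℝ) : ℝ := (D + (1 - γ)⁻¹) / (lam * σ)

/-- The constant `Φ₁`; here `D = diam Θ`, `CM` bounds the sampled dual objective and
`n = |S| |A|`. -/
def Phi1 (γ lam σ κ M ρ D CM dmin : ℝ) (n : ℕ) : ℝ :=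
  3 * D * M * (κ * D + 2 * gradBound γ lam σ D + 2 * dmin * √(Real.log (2 * n)))
      / (κ * dmin ^ 2 * (1 - ρ))
    + 6 * gradBound γ lam σ D * (2 * κ * dmin * D * √(Real.log (2 * n)) + 2 * gradBound γ lam σ D)
      / (κ ^ 2 * dmin ^ 2)
    + 12 * CM ^ 2 / (dmin ^ 2 * (1 - γ) ^ 2)

end RobustQ

end

/-! The argument gives more than the required rate: the mean error is at most a constant times `(t +
1) ^ (-1 / 2)`. The term with `Phi1` is only needed to be nonnegative, so `C = 1` works and
everything quantitative sits in `K`.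

Dual side. The sampled objective has the form `v + φ(η - v)` for one function `φ`. Constant value
functions turn the assumptions on the averaged objective into assumptions on `φ`: its derivative is
bounded and Lipschitz on all differences `η - v`, and changes sign at `lam * slopeOne f`. Hence the
averaged gradient vanishes at the maximizer even if that is an end point of the region
(`meanGrad_maximizer`), the loss from a suboptimal `η` is quadratic (`meanJ_gap`), and maximizers
are Lipschitz in `V` (`maximizer_lipschitz`). The optimal dual value is nonexpansive in `V`, so the
Bellman operator contracts. All this is condensed in `RegularDual`.

Markov noise. Geometric mixing gives a bounded solution `h` of the Poisson equation
(`exists_poisson`). It replaces the indicator of a visit to `x` by `d x`, up to a martingale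
difference and a telescoping term.

Fast scale. With step size of order `t ^ (-2 / 3)`, strong concavity makes the mean squared distance
of the dual variable from the moving maximizer of order `t ^ (-2 / 3)` (`integral_gap_sq_le`). The
maximizer moves by `O(1 / t)` per step, slowly enough to be followed.

Slow scale. From `Q_t - Qstar` a martingale part is removed, whose second moment is `O(1 / t)`, and
a telescoping part, which is `O(t ^ (-1 / 2))` on every path by summation by parts. The remainder
contracts in sup norm at rate `1 / (t + q)` (`integral_error_le`). Since the dual error enters
quadratically it contributes `t ^ (-2 / 3)`, below the martingale noise, so `t ^ (-1 / 2)` survives.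

Every constant is a polynomial in `qBound B`, where `B` dominates all parameters, including the
number of state-action pairs, which is at most `1 / dmin`. This keeps `K` independent of the spaces.
-/

set_option linter.unusedSectionVars false

noncomputable section

namespace RobustQ

/-! ### Projection onto an interval, and scalar recursions -/

section RealAnalysis

/-- The projection of `x` onto the interval `[lo, hi]`. -/
def clamp (lo hi x : ℝ) : ℝ := max lo (min hi x)

lemma clamp_mem {lo hi : ℝ} (h : lo ≤ hi) (x : ℝ) : clamp lo hi x ∈ Set.Icc lo hi :=
  ⟨le_max_left _ _, max_le h (min_le_left _ _)⟩

lemma clamp_of_mem {lo hi x : ℝ} (hx : x ∈ Set.Icc lo hi) : clamp lo hi x = x := by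
  rw [clamp, min_eq_right hx.2, max_eq_right hx.1]

lemma abs_clamp_sub_clamp_le (lo hi x y : ℝ) : |clamp lo hi x - clamp lo hi y| ≤ |x - y| := by
  refine (abs_max_sub_max_le_max _ _ _ _).trans ?_
  refine max_le (by simp) ?_
  refine (abs_min_sub_min_le_max _ _ _ _).trans ?_
  exact max_le (by simp) le_rfl

lemma measurable_clamp (lo hi : ℝ) : Measurable (clamp lo hi) := by
  unfold clamp; fun_prop

/-- Bernoulli's inequality for negative exponents. -/
lemma rpow_neg_sub_le {s q : ℝ} (hs : 1 ≤ s) (hq0 : 0 ≤ q) (hq1 : q ≤ 1) :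
    s ^ (-q) - (s + 1) ^ (-q) ≤ q * s ^ (-q) / s := by
  have hs0 : 0 < s := by linarith
  have h1 : (s + 1) ^ (-q) = s ^ (-q) * (1 + 1 / s) ^ (-q) := by
    rw [← Real.mul_rpow hs0.le (by positivity)]
    congr 1; field_simp
  have h2 : 1 + (-q) * (1 / s) ≤ (1 + 1 / s) ^ (-q) := by
    have hx : 0 < 1 / s := by positivity
    have h3 := rpow_one_add_le_one_add_mul_self (s := 1 / s) (by linarith) hq0 hq1
    have h4 : 0 < (1 + 1 / s) ^ q := Real.rpow_pos_of_pos (by linarith) _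
    rw [Real.rpow_neg (by linarith), ← one_div, le_div_iff₀ h4]
    have h5 := mul_nonneg hq0 hx.le
    by_cases hc : 1 + (-q) * (1 / s) ≤ 0
    · nlinarith
    · have := mul_le_mul_of_nonneg_left h3 (not_le.1 hc).le
      nlinarith [sq_nonneg (q * (1 / s))]
  have h3 : 0 < s ^ (-q) := Real.rpow_pos_of_pos hs0 _
  rw [h1]
  have := mul_le_mul_of_nonneg_left h2 h3.le
  have e : s ^ (-q) * (1 + (-q) * (1 / s)) = s ^ (-q) - q * s ^ (-q) / s := by ring
  linarith

/-- With `θ = s ^ (-2 / 3)`, the contraction removes `K θ ^ 2` in one step, while the profile `K θ`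
itself drops by at most two thirds of that, because `1 / s ≤ θ`. The remaining third must absorb the
source, hence `3 C ≤ K`. -/
lemma recursion_two_thirds {p C K : ℝ} {w : ℕ → ℝ} (hp : 1 ≤ p) (hK : 3 * C ≤ K) (hK0 : 0 ≤ K)
    (h0 : w 0 ≤ K * p ^ (-(2 / 3) : ℝ))
    (hw : ∀ t : ℕ, w (t + 1) ≤ (1 - ((t : ℝ) + p) ^ (-(2 / 3) : ℝ)) * w t
      + C * (((t : ℝ) + p) ^ (-(2 / 3) : ℝ)) ^ 2) (t : ℕ) :
    w t ≤ K * ((t : ℝ) + p) ^ (-(2 / 3) : ℝ) := by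
  induction t with
  | zero => simpa using h0
  | succ t ih =>
    have hs : 1 ≤ (t : ℝ) + p := by linarith [show (0 : ℝ) ≤ t from t.cast_nonneg]
    push_cast
    rw [show (t : ℝ) + 1 + p = t + p + 1 by ring]
    set s : ℝ := t + p
    have hs0 : 0 < s := by linarith
    set θ : ℝ := s ^ (-(2 / 3) : ℝ)
    have hb := rpow_neg_sub_le (q := 2 / 3) hs (by norm_num) (by norm_num)
    have hθ0 : 0 < θ := Real.rpow_pos_of_pos hs0 _
    have hθ1 : θ ≤ 1 := Real.rpow_le_one_of_one_le_of_nonpos hs (by norm_num)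
    have h1s : 1 / s ≤ θ := by
      rw [one_div, ← Real.rpow_neg_one]
      exact Real.rpow_le_rpow_of_exponent_le hs (by norm_num)
    have h4 : 2 / 3 * θ / s ≤ 2 / 3 * θ * θ := by
      rw [div_eq_mul_one_div]; gcongr
    have h5 := mul_le_mul_of_nonneg_left ih (by linarith : 0 ≤ 1 - θ)
    have h6 := hw t
    have h7 := mul_le_mul_of_nonneg_left (hb.trans h4) hK0
    have h8 : 0 ≤ (K - 3 * C) * θ ^ 2 := mul_nonneg (by linarith) (by positivity)
    nlinarith

/-- The profile `s ^ (-1 / 2)` loses about half of what a contraction at rate `1 / s` removes, so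
the other half is left for the source. -/
lemma recursion_half {p C K : ℝ} {u : ℕ → ℝ} (hp : 1 ≤ p) (hK : 2 * C ≤ K)
    (hK0 : 0 ≤ K) (h0 : u 0 ≤ K * p ^ (-(1 / 2) : ℝ))
    (hu : ∀ t : ℕ, u (t + 1) ≤ (1 - 1 / ((t : ℝ) + p)) * u t
      + C / ((t : ℝ) + p) * ((t : ℝ) + p) ^ (-(1 / 2) : ℝ)) (t : ℕ) :
    u t ≤ K * ((t : ℝ) + p) ^ (-(1 / 2) : ℝ) := by
  induction t with
  | zero => simpa using h0
  | succ t ih =>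
    have hs : 1 ≤ (t : ℝ) + p := by linarith [show (0 : ℝ) ≤ t from t.cast_nonneg]
    have h6 := hu t
    push_cast
    rw [show (t : ℝ) + 1 + p = t + p + 1 by ring]
    set s : ℝ := t + p
    have hs0 : 0 < s := by linarith
    have hb := rpow_neg_sub_le (q := 1 / 2) hs (by norm_num) (by norm_num)
    set θ : ℝ := s ^ (-(1 / 2) : ℝ)
    have hθ0 : 0 < θ := Real.rpow_pos_of_pos hs0 _
    have h1s : 1 / s ≤ 1 := by rw [div_le_one hs0]; exact hs
    have h5 := mul_le_mul_of_nonneg_left ih (by linarith : 0 ≤ 1 - 1 / s)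
    have h7 := mul_le_mul_of_nonneg_left hb hK0
    have h8 : 0 ≤ (K - 2 * C) * (θ / s) := mul_nonneg (by linarith) (by positivity)
    have e1 : (1 - 1 / s) * (K * θ) = K * θ - K * (θ / s) := by ring
    have e2 : C / s * θ = C * (θ / s) := by ring
    have e3 : K * (1 / 2 * θ / s) = K * (θ / s) / 2 := by ring
    nlinarith

/-- The square on the contraction factor is essential: with the first power, `1 / s` would be the
critical profile and a logarithm would appear. Second moments of linear recursions supply the
square. -/
lemma recursion_one {p C K : ℝ} {v : ℕ → ℝ} (hp : 1 ≤ p) (hK : 2 * C ≤ K)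
    (hK0 : 0 ≤ K) (h0 : v 0 ≤ K / p)
    (hv : ∀ t : ℕ, v (t + 1) ≤ (1 - 1 / ((t : ℝ) + p)) ^ 2 * v t
      + C / ((t : ℝ) + p) ^ 2) (t : ℕ) :
    v t ≤ K / ((t : ℝ) + p) := by
  induction t with
  | zero => simpa using h0
  | succ t ih =>
    have hs : 1 ≤ (t : ℝ) + p := by linarith [show (0 : ℝ) ≤ t from t.cast_nonneg]
    have h6 := hv t
    push_cast
    rw [show (t : ℝ) + 1 + p = t + p + 1 by ring]
    set s : ℝ := t + p
    have hs0 : 0 < s := by linarith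
    have h5 := mul_le_mul_of_nonneg_left ih (sq_nonneg (1 - 1 / s))
    have h7 : C / s ^ 2 ≤ K / 2 / s ^ 2 := by gcongr; linarith
    have h8 : (1 - 1 / s) ^ 2 * (K / s) + K / 2 / s ^ 2 ≤ K / (s + 1) := by
      have e : K / (s + 1) - ((1 - 1 / s) ^ 2 * (K / s) + K / 2 / s ^ 2)
          = K * ((s ^ 2 + s - 2) / 2) / (s ^ 3 * (s + 1)) := by field_simp; ring
      have : 0 ≤ K * ((s ^ 2 + s - 2) / 2) / (s ^ 3 * (s + 1)) := by
        apply div_nonneg (mul_nonneg hK0 _) (by positivity)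
        nlinarith
      linarith
    linarith

end RealAnalysis

/-! ### The conjugate touches the diagonal exactly at the slope of `f` at `1` -/

section Conjugate

variable {f : ℝ → EReal}

/-- The slope of `f` at `1`, at which the conjugate touches the diagonal. -/
def slopeOne (f : ℝ → EReal) : ℝ := deriv (fun x => (f x).toReal) 1

lemma IsDivergenceFn.hasDerivAt_one (hf : IsDivergenceFn f) :
    HasDerivAt (fun x => (f x).toReal) (slopeOne f) 1 :=
  ((hf.differentiableOn 1 (by simp)).differentiableAt (Ioi_mem_nhds (by norm_num))).hasDerivAt

lemma IsDivergenceFn.coe_toReal (hf : IsDivergenceFn f) {x : ℝ} (hx : 0 < x) :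
    (((f x).toReal : ℝ) : EReal) = f x :=
  EReal.coe_toReal (hf.ne_top_of_pos x hx) (hf.ne_bot_of_pos x hx)

/-- The tangent inequality at `1`. -/
lemma IsDivergenceFn.tangent_le (hf : IsDivergenceFn f) {x r : ℝ} (h : f x ≤ (r : EReal)) :
    slopeOne f * (x - 1) ≤ r := by
  have hd : HasDerivAt (fun t : ℝ => (f (1 + t * (x - 1))).toReal) (slopeOne f * (x - 1)) 0 := by
    have h1 : HasDerivAt (fun t : ℝ => 1 + t * (x - 1)) (x - 1) 0 := by
      simpa using ((hasDerivAt_id (0 : ℝ)).mul_const (x - 1)).const_add 1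
    have h2 : HasDerivAt (fun x => (f x).toReal) (slopeOne f) (1 + 0 * (x - 1)) := by
      simpa using hf.hasDerivAt_one
    exact h2.comp (0 : ℝ) h1
  have hl := hd.tendsto_slope_zero_right
  -- Convexity along the segment from `1` to `x` bounds each difference quotient by `r`. Interior
  -- points near `1` are positive, so nothing is needed of `f` at `x` beyond the bound `r`.
  refine le_of_tendsto hl ?_
  have hpos : ∀ᶠ t in nhdsWithin (0 : ℝ) (Set.Ioi 0), 0 < 1 + t * (x - 1) := by
    have hc : Continuous fun t : ℝ => 1 + t * (x - 1) := by fun_prop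
    exact nhdsWithin_le_nhds ((hc.tendsto 0).eventually (lt_mem_nhds (by simp)))
  have hlt : ∀ᶠ t in nhdsWithin (0 : ℝ) (Set.Ioi 0), t < 1 :=
    nhdsWithin_le_nhds (gt_mem_nhds one_pos)
  filter_upwards [hpos, hlt, self_mem_nhdsWithin] with t ht ht1 ht0
  have ht0 : 0 < t := ht0
  have hc := hf.convex_epigraph (x := ((1 : ℝ), (0 : ℝ))) (by simp [hf.map_one])
    (y := (x, r)) h (sub_nonneg.2 ht1.le) ht0.le (by ring)
  have e1 : (1 - t) * 1 + t * x = 1 + t * (x - 1) := by ring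
  simp only [Set.mem_ofPred_eq, Prod.fst_add, Prod.smul_fst, smul_eq_mul, Prod.snd_add,
    Prod.smul_snd, e1, mul_zero, zero_add] at hc
  rw [← hf.coe_toReal ht, EReal.coe_le_coe_iff] at hc
  simp only [zero_add, zero_mul, add_zero, hf.map_one, EReal.toReal_zero, sub_zero, smul_eq_mul]
  rw [inv_mul_le_iff₀ ht0]
  exact hc

lemma IsDivergenceFn.le_conj (hf : IsDivergenceFn f) (y : ℝ) : (y : EReal) ≤ conj f y := by
  refine le_trans ?_ (le_iSup _ (1 : ℝ))
  simp [hf.map_one]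

lemma IsDivergenceFn.conj_mono (hf : IsDivergenceFn f) {y y' : ℝ} (h : y ≤ y') :
    conj f y ≤ conj f y' := by
  refine iSup_mono fun x => ?_
  rcases lt_or_ge x 0 with hx | hx
  · simp [hf.eq_top_of_neg x hx]
  · exact EReal.sub_le_sub (EReal.coe_le_coe_iff.2 (mul_le_mul_of_nonneg_left h hx)) le_rfl

lemma IsDivergenceFn.conj_slopeOne (hf : IsDivergenceFn f) :
    conj f (slopeOne f) = (slopeOne f : EReal) := by
  refine le_antisymm (iSup_le fun x => ?_) (hf.le_conj _)
  induction hx : f x with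
  | top => simp
  -- The value `-∞` is excluded by convexity: it would put a point of the epigraph strictly below
  -- the tangent at `1`.
  | bot =>
    have := hf.tangent_le (x := x) (r := slopeOne f * (x - 1) - 1) (by simp [hx])
    linarith
  | coe r =>
    have := hf.tangent_le hx.le
    rw [← EReal.coe_sub, EReal.coe_le_coe_iff]
    linarith

/-- If the conjugate at `y` does not exceed `y`, then the line of slope `y` through `(1, 0)`
supports `f`, and differentiability at `1` leaves only one such slope. This is what makes dual
maximizers for constant value functions unique. -/
lemma IsDivergenceFn.eq_slopeOne (hf : IsDivergenceFn f) {y : ℝ} (h : conj f y ≤ (y : EReal)) :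
    y = slopeOne f := by
  have hmin : IsLocalMin (fun x => (f x).toReal - y * (x - 1)) 1 := by
    filter_upwards [Ioi_mem_nhds (show (0 : ℝ) < 1 by norm_num)] with x hx
    have h1 := (le_iSup (fun x : ℝ => (((x * y : ℝ) : EReal) - f x)) x).trans h
    have h2 : ((x * y : ℝ) : EReal) - f x ≤ (y : EReal) := h1
    rw [← hf.coe_toReal hx, ← EReal.coe_sub, EReal.coe_le_coe_iff] at h2
    simp only [hf.map_one, EReal.toReal_zero]
    linarith
  have hd : HasDerivAt (fun x => (f x).toReal - y * (x - 1)) (slopeOne f - y) 1 := by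
    have h := ((hasDerivAt_id (1 : ℝ)).sub_const 1).const_mul y
    rw [mul_one] at h
    exact hf.hasDerivAt_one.fun_sub h
  linarith [hmin.hasDerivAt_eq_zero hd]

end Conjugate

lemma ereal_coe_sum {ι : Type*} (s : Finset ι) (g : ι → ℝ) :
    ((∑ i ∈ s, g i : ℝ) : EReal) = ∑ i ∈ s, (g i : EReal) := by
  classical
  induction s using Finset.induction_on with
  | empty => simp
  | insert i s hi ih => rw [Finset.sum_insert hi, Finset.sum_insert hi, EReal.coe_add, ih]

/-! ### Regularity of the dual objective, reduced to one function of `η - v` -/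

section Dual

variable {S A : Type*} [Fintype S] [Fintype A]

lemma abs_average_sub_le {p u w : S → ℝ} {c : ℝ} (hp : p ∈ stdSimplex ℝ S)
    (h : ∀ s, |u s - w s| ≤ c) : |∑ s, p s * u s - ∑ s, p s * w s| ≤ c := by
  rw [← Finset.sum_sub_distrib]
  refine (Finset.abs_sum_le_sum_abs _ _).trans ?_
  calc ∑ s, |p s * u s - p s * w s| ≤ ∑ s, p s * c := by
        refine Finset.sum_le_sum fun s _ => ?_
        rw [← mul_sub, abs_mul, abs_of_nonneg (hp.1 s)]
        exact mul_le_mul_of_nonneg_left (h s) (hp.1 s)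
    _ = c := by rw [← Finset.sum_mul, hp.2, one_mul]

lemma dualJ_eq_coe {f : ℝ → EReal} {lam η : ℝ} {P : S → A → S → ℝ} {s : S} {a : A} {V c : S → ℝ}
    (hc : ∀ s', conj f ((η - V s') / lam) = (c s' : EReal)) :
    dualJ f lam P s a η V = ((η - lam * ∑ s', P s a s' * c s' : ℝ) : EReal) := by
  simp only [dualJ, hc, ← EReal.coe_mul, ← ereal_coe_sum, ← EReal.coe_sub]

/-- The standing assumptions on the divergence, the kernel and the dual region `[lo, hi]`. -/
structure DualAssumptions (f : ℝ → EReal) (lam γ σ κ CM lo hi : ℝ) (P : S → A → S → ℝ) :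
    Prop where
  div : IsDivergenceFn f
  gamma_nonneg : 0 ≤ γ
  gamma_lt : γ < 1
  lam_pos : 0 < lam
  sigma_pos : 0 < σ
  kappa_pos : 0 < κ
  kernel : ∀ s a, P s a ∈ stdSimplex ℝ S
  le : lo ≤ hi
  maxIn : DualMaxIn f lam γ P (Set.Icc lo hi)
  smooth : DualSmoothOn f lam γ σ P (Set.Icc lo hi)
  bound : ∀ η ∈ Set.Icc lo hi, ∀ v ∈ Set.Icc (0 : ℝ) (1 - γ)⁻¹,
    ((-CM : ℝ) : EReal) ≤ sampleJ f lam η v ∧ sampleJ f lam η v ≤ (CM : EReal)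
  strong : DualStronglyConcaveOn f lam γ κ P (Set.Icc lo hi)

/-- The function `φ` with `J(η, v) = v + φ(η - v)`. -/
def reducedJ (f : ℝ → EReal) (lam u : ℝ) : ℝ := u - lam * (conj f (u / lam)).toReal

/-- The derivative of `φ` on the range `[lo - (1 - γ)⁻¹, hi]` of `η - v`. -/
def reducedGrad (f : ℝ → EReal) (lam γ lo hi u : ℝ) : ℝ :=
  derivWithin (reducedJ f lam) (Set.Icc (lo - (1 - γ)⁻¹) hi) u

namespace DualAssumptions

variable {f : ℝ → EReal} {lam γ σ κ CM lo hi : ℝ} {P : S → A → S → ℝ}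

lemma vmax_pos (H : DualAssumptions f lam γ σ κ CM lo hi P) : 0 < (1 - γ)⁻¹ :=
  inv_pos.2 (sub_pos.2 H.gamma_lt)

/-- Finiteness comes from the bound on the sampled objective: an infinite conjugate would send it to
`-∞`, below `-CM`. -/
lemma coe_conj (H : DualAssumptions f lam γ σ κ CM lo hi P) {η v : ℝ} (hη : η ∈ Set.Icc lo hi)
    (hv : v ∈ Set.Icc (0 : ℝ) (1 - γ)⁻¹) :
    conj f ((η - v) / lam) = ((conj f ((η - v) / lam)).toReal : EReal) := by
  obtain ⟨h1, h2⟩ := H.bound η hη v hv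
  unfold sampleJ at h1 h2
  induction h : conj f ((η - v) / lam) with
  | top =>
    rw [h, EReal.coe_mul_top_of_pos H.lam_pos, EReal.sub_top] at h1
    exact absurd h1 (by simp)
  | bot =>
    have := H.div.le_conj ((η - v) / lam)
    rw [h] at this
    exact absurd this (by simp)
  | coe r => simp

lemma sampleJ_eq (H : DualAssumptions f lam γ σ κ CM lo hi P) {η v : ℝ} (hη : η ∈ Set.Icc lo hi)
    (hv : v ∈ Set.Icc (0 : ℝ) (1 - γ)⁻¹) :
    sampleJ f lam η v = ((v + reducedJ f lam (η - v) : ℝ) : EReal) := by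
  rw [sampleJ, H.coe_conj hη hv, ← EReal.coe_mul, ← EReal.coe_sub, reducedJ]
  congr 1; ring

lemma sum_kernel (H : DualAssumptions f lam γ σ κ CM lo hi P) (s : S) (a : A) :
    ∑ s', P s a s' = 1 := (H.kernel s a).2

lemma dualJ_eq (H : DualAssumptions f lam γ σ κ CM lo hi P) (s : S) (a : A) {η : ℝ} {V : S → ℝ}
    (hη : η ∈ Set.Icc lo hi) (hV : V ∈ valueBox S γ) :
    dualJ f lam P s a η V
      = ((∑ s', P s a s' * (V s' + reducedJ f lam (η - V s')) : ℝ) : EReal) := by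
  rw [dualJ_eq_coe fun s' => H.coe_conj hη (hV s')]
  congr 1
  have : ∀ s', P s a s' * (V s' + reducedJ f lam (η - V s'))
      = P s a s' * η - lam * (P s a s' * (conj f ((η - V s') / lam)).toReal) := by
    intro s'; rw [reducedJ]; ring
  simp only [this, Finset.sum_sub_distrib, ← Finset.sum_mul, ← Finset.mul_sum, H.sum_kernel,
    one_mul]

lemma const_mem (γ : ℝ) {v : ℝ} (hv : v ∈ Set.Icc (0 : ℝ) (1 - γ)⁻¹) :
    (fun _ : S => v) ∈ valueBox S γ := fun _ => hv

variable [Nonempty S] [Nonempty A]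

lemma dualJ_const (H : DualAssumptions f lam γ σ κ CM lo hi P) (s : S) (a : A) {η v : ℝ}
    (hη : η ∈ Set.Icc lo hi) (hv : v ∈ Set.Icc (0 : ℝ) (1 - γ)⁻¹) :
    dualJ f lam P s a η (fun _ => v) = ((v + reducedJ f lam (η - v) : ℝ) : EReal) := by
  rw [H.dualJ_eq s a hη (const_mem γ hv), ← Finset.sum_mul, H.sum_kernel, one_mul]

/-- For constant value functions the dual maximizer is the translate of `lam * slopeOne f`. -/
lemma isDualMax_const (H : DualAssumptions f lam γ σ κ CM lo hi P) (s : S) (a : A) {v : ℝ}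
    (hv : v ∈ Set.Icc (0 : ℝ) (1 - γ)⁻¹) :
    lam * slopeOne f + v ∈ Set.Icc lo hi ∧
      IsDualMax f lam P s a (fun _ => v) (lam * slopeOne f + v) := by
  obtain ⟨η, hη, hmax⟩ := H.maxIn _ (const_mem γ hv) s a
  -- The explicit candidate attains the value `v`. So the maximizer supplied by the assumption
  -- attains at least `v`, and this puts the conjugate on or below the diagonal, identifying that
  -- maximizer with the candidate.
  have h1 := hmax (lam * slopeOne f + v)
  have hl := H.lam_pos.ne'
  have hc : ∀ s' : S, conj f ((lam * slopeOne f + v - (fun _ : S => v) s') / lam)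
      = (slopeOne f : EReal) := by
    intro _
    rw [show (lam * slopeOne f + v - v) / lam = slopeOne f by field_simp; ring]
    exact H.div.conj_slopeOne
  rw [dualJ_eq_coe hc, ← Finset.sum_mul, H.sum_kernel, H.dualJ_const s a hη hv,
    EReal.coe_le_coe_iff, reducedJ] at h1
  have h2 : (conj f ((η - v) / lam)).toReal ≤ (η - v) / lam := by
    rw [le_div_iff₀ H.lam_pos]; linarith
  have h3 := H.div.eq_slopeOne (y := (η - v) / lam) (by
    rw [H.coe_conj hη hv]; exact EReal.coe_le_coe_iff.2 h2)
  have h4 : η = lam * slopeOne f + v := by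
    rw [← h3]; field_simp; ring
  rw [← h4]
  exact ⟨hη, hmax⟩

/-- The translates for `v = 0` and `v = (1 - γ)⁻¹` both lie in the region. Its length is therefore
at least `(1 - γ)⁻¹`, so the windows `[lo - v, hi - v]` at these two extremes overlap and local
statements can be glued. -/
lemma center_mem (H : DualAssumptions f lam γ σ κ CM lo hi P) :
    lo ≤ lam * slopeOne f ∧ lam * slopeOne f + (1 - γ)⁻¹ ≤ hi := by
  obtain ⟨s⟩ := ‹Nonempty S›
  obtain ⟨a⟩ := ‹Nonempty A›
  have : Nonempty S := ⟨s⟩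
  have : Nonempty A := ⟨a⟩
  have h0 := (H.isDualMax_const s a (v := 0) ⟨le_rfl, H.vmax_pos.le⟩).1
  have h1 := (H.isDualMax_const s a (v := (1 - γ)⁻¹) ⟨H.vmax_pos.le, le_rfl⟩).1
  exact ⟨by simpa using h0.1, h1.2⟩

lemma sub_mem (_H : DualAssumptions f lam γ σ κ CM lo hi P) {η v : ℝ} (hη : η ∈ Set.Icc lo hi)
    (hv : v ∈ Set.Icc (0 : ℝ) (1 - γ)⁻¹) : η - v ∈ Set.Icc (lo - (1 - γ)⁻¹) hi :=
  ⟨by linarith [hη.1, hv.2], by linarith [hη.2, hv.1]⟩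

lemma differentiableWithinAt_add_reducedJ (H : DualAssumptions f lam γ σ κ CM lo hi P) {η v : ℝ}
    (hη : η ∈ Set.Icc lo hi) (hv : v ∈ Set.Icc (0 : ℝ) (1 - γ)⁻¹) :
    DifferentiableWithinAt ℝ (fun η => v + reducedJ f lam (η - v)) (Set.Icc lo hi) η := by
  obtain ⟨s⟩ := ‹Nonempty S›
  obtain ⟨a⟩ := ‹Nonempty A›
  have : Nonempty S := ⟨s⟩
  have : Nonempty A := ⟨a⟩
  refine ((H.smooth _ (const_mem γ hv) s a).1 η hη).congr (fun x hx => ?_) ?_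
  · rw [H.dualJ_const s a hx hv, EReal.toReal_coe]
  · rw [H.dualJ_const s a hη hv, EReal.toReal_coe]

/-- Each constant value function `v` gives differentiability of `φ` on the window `[lo - v, hi -
v]`. It remains to choose `v` so that the window is a neighbourhood of `u` within the whole range.
-/
lemma reducedJ_hasDerivWithinAt (H : DualAssumptions f lam γ σ κ CM lo hi P) {u : ℝ}
    (hu : u ∈ Set.Icc (lo - (1 - γ)⁻¹) hi) :
    HasDerivWithinAt (reducedJ f lam) (reducedGrad f lam γ lo hi u)
      (Set.Icc (lo - (1 - γ)⁻¹) hi) u := by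
  refine DifferentiableWithinAt.hasDerivWithinAt ?_
  obtain ⟨hc1, hc2⟩ := H.center_mem
  have hv0 := H.vmax_pos
  have key : ∀ v ∈ Set.Icc (0 : ℝ) (1 - γ)⁻¹, u + v ∈ Set.Icc lo hi →
      Set.Icc (lo - v) (hi - v) ∈ nhdsWithin u (Set.Icc (lo - (1 - γ)⁻¹) hi) →
      DifferentiableWithinAt ℝ (reducedJ f lam) (Set.Icc (lo - (1 - γ)⁻¹) hi) u := by
    intro v hv huv hn
    have h1 := (H.differentiableWithinAt_add_reducedJ huv hv).sub_const v
    have h2 : DifferentiableWithinAt ℝ (fun w => w + v) (Set.Icc (lo - v) (hi - v)) u := by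
      fun_prop
    have h3 := DifferentiableWithinAt.comp (f := fun w => w + v) u h1 h2 (fun w hw =>
      ⟨by linarith [hw.1], by linarith [hw.2]⟩)
    have h4 : DifferentiableWithinAt ℝ (reducedJ f lam) (Set.Icc (lo - v) (hi - v)) u := by
      refine h3.congr (fun w _ => ?_) ?_ <;> simp
    exact h4.mono_of_mem_nhdsWithin hn
  -- The ideal `v` puts `u` at the midpoint of its window. When this `v` is out of range, the
  -- nearest admissible one is used; its window then shares the relevant end point with the full
  -- range.
  rcases le_total ((lo + hi) / 2 - u) 0 with h | h
  · refine key 0 ⟨le_rfl, hv0.le⟩ ⟨by linarith, by linarith [hu.2]⟩ ?_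
    rw [mem_nhdsWithin]
    exact ⟨Set.Ioi lo, isOpen_Ioi, by simp only [Set.mem_Ioi]; linarith, fun w hw =>
      ⟨by linarith [Set.mem_Ioi.1 hw.1], by linarith [hw.2.2]⟩⟩
  rcases le_total ((lo + hi) / 2 - u) (1 - γ)⁻¹ with h' | h'
  · refine key ((lo + hi) / 2 - u) ⟨h, h'⟩ ⟨by linarith, by linarith⟩ ?_
    refine mem_nhdsWithin_of_mem_nhds (Icc_mem_nhds ?_ ?_) <;> linarith
  · refine key (1 - γ)⁻¹ ⟨hv0.le, le_rfl⟩ ⟨by linarith [hu.1], by linarith⟩ ?_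
    rw [mem_nhdsWithin]
    exact ⟨Set.Iio (hi - (1 - γ)⁻¹), isOpen_Iio, by simp only [Set.mem_Iio]; linarith, fun w hw =>
      ⟨by linarith [hw.2.1], by linarith [Set.mem_Iio.1 hw.1]⟩⟩

lemma hasDerivWithinAt_shift (H : DualAssumptions f lam γ σ κ CM lo hi P) {η v : ℝ}
    (hη : η ∈ Set.Icc lo hi) (hv : v ∈ Set.Icc (0 : ℝ) (1 - γ)⁻¹) :
    HasDerivWithinAt (fun η => v + reducedJ f lam (η - v)) (reducedGrad f lam γ lo hi (η - v))
      (Set.Icc lo hi) η := by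
  have h1 := H.reducedJ_hasDerivWithinAt (H.sub_mem hη hv)
  have h2 : HasDerivWithinAt (fun w => w - v) 1 (Set.Icc lo hi) η :=
    ((hasDerivAt_id η).sub_const v).hasDerivWithinAt
  have h3 := HasDerivWithinAt.comp (h := fun w => w - v) η h1 h2 (fun w hw => H.sub_mem hw hv)
  simpa using h3.const_add v

lemma lo_lt_hi (H : DualAssumptions f lam γ σ κ CM lo hi P) : lo < hi := by
  linarith [H.center_mem.1, H.center_mem.2, H.vmax_pos]

lemma derivWithin_sampleJ (H : DualAssumptions f lam γ σ κ CM lo hi P) {η v : ℝ}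
    (hη : η ∈ Set.Icc lo hi) (hv : v ∈ Set.Icc (0 : ℝ) (1 - γ)⁻¹) :
    derivWithin (fun η => (sampleJ f lam η v).toReal) (Set.Icc lo hi) η
      = reducedGrad f lam γ lo hi (η - v) := by
  refine HasDerivWithinAt.derivWithin ?_ (uniqueDiffOn_Icc H.lo_lt_hi η hη)
  refine (H.hasDerivWithinAt_shift hη hv).congr (fun x hx => ?_) ?_
  · rw [H.sampleJ_eq hx hv, EReal.toReal_coe]
  · rw [H.sampleJ_eq hη hv, EReal.toReal_coe]

lemma hasDerivWithinAt_dualJ (H : DualAssumptions f lam γ σ κ CM lo hi P) (s : S) (a : A)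
    {η : ℝ} {V : S → ℝ} (hη : η ∈ Set.Icc lo hi) (hV : V ∈ valueBox S γ) :
    HasDerivWithinAt (fun η => ∑ s', P s a s' * (V s' + reducedJ f lam (η - V s')))
      (∑ s', P s a s' * reducedGrad f lam γ lo hi (η - V s')) (Set.Icc lo hi) η :=
  HasDerivWithinAt.fun_sum fun s' _ => (H.hasDerivWithinAt_shift hη (hV s')).const_mul _

lemma derivWithin_dualJ (H : DualAssumptions f lam γ σ κ CM lo hi P) (s : S) (a : A)
    {η : ℝ} {V : S → ℝ} (hη : η ∈ Set.Icc lo hi) (hV : V ∈ valueBox S γ) :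
    derivWithin (fun η => (dualJ f lam P s a η V).toReal) (Set.Icc lo hi) η
      = ∑ s', P s a s' * reducedGrad f lam γ lo hi (η - V s') := by
  refine HasDerivWithinAt.derivWithin ?_ (uniqueDiffOn_Icc H.lo_lt_hi η hη)
  refine (H.hasDerivWithinAt_dualJ s a hη hV).congr (fun x hx => ?_) ?_
  · rw [H.dualJ_eq s a hx hV, EReal.toReal_coe]
  · rw [H.dualJ_eq s a hη hV, EReal.toReal_coe]

/-- The two extreme windows cover the range and both contain `lo`. For points in different windows
the estimate passes through `lo`, and no constant is lost since `lo` lies between them. -/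
lemma reducedGrad_lipschitz (H : DualAssumptions f lam γ σ κ CM lo hi P) {u w : ℝ}
    (hu : u ∈ Set.Icc (lo - (1 - γ)⁻¹) hi) (hw : w ∈ Set.Icc (lo - (1 - γ)⁻¹) hi) :
    |reducedGrad f lam γ lo hi u - reducedGrad f lam γ lo hi w| ≤ 1 / (lam * σ) * |u - w| := by
  obtain ⟨s⟩ := ‹Nonempty S›
  obtain ⟨a⟩ := ‹Nonempty A›
  have : Nonempty S := ⟨s⟩
  have : Nonempty A := ⟨a⟩
  obtain ⟨hc1, hc2⟩ := H.center_mem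
  have hv0 := H.vmax_pos
  have loc : ∀ v ∈ Set.Icc (0 : ℝ) (1 - γ)⁻¹, ∀ u w, u + v ∈ Set.Icc lo hi →
      w + v ∈ Set.Icc lo hi →
      |reducedGrad f lam γ lo hi u - reducedGrad f lam γ lo hi w| ≤ 1 / (lam * σ) * |u - w| := by
    intro v hv u w hu hw
    have h := (H.smooth _ (const_mem γ hv) s a).2 _ hu _ hw
    rw [H.derivWithin_dualJ s a hu (const_mem γ hv), H.derivWithin_dualJ s a hw (const_mem γ hv),
      ← Finset.sum_mul, ← Finset.sum_mul, H.sum_kernel] at h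
    simpa using h
  have loc0 := loc 0 ⟨le_rfl, hv0.le⟩
  have loc1 := loc (1 - γ)⁻¹ ⟨hv0.le, le_rfl⟩
  have hL : 0 ≤ 1 / (lam * σ) := by have := H.lam_pos; have := H.sigma_pos; positivity
  have main : ∀ u w, u ∈ Set.Icc (lo - (1 - γ)⁻¹) hi → w ∈ Set.Icc (lo - (1 - γ)⁻¹) hi → u ≤ w →
      |reducedGrad f lam γ lo hi u - reducedGrad f lam γ lo hi w| ≤ 1 / (lam * σ) * |u - w| := by
    intro u w hu hw huw
    rcases le_total lo u with h | h
    · exact loc0 u w ⟨by linarith, by linarith [hu.2]⟩ ⟨by linarith, by linarith [hw.2]⟩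
    rcases le_total w (hi - (1 - γ)⁻¹) with h' | h'
    · exact loc1 u w ⟨by linarith [hu.1], by linarith⟩ ⟨by linarith [hw.1], by linarith⟩
    · have e1 := loc1 u lo ⟨by linarith [hu.1], by linarith⟩ ⟨by linarith, by linarith⟩
      have e2 := loc0 lo w ⟨by linarith, by linarith⟩ ⟨by linarith, by linarith [hw.2]⟩
      have e3 := abs_sub_le (reducedGrad f lam γ lo hi u) (reducedGrad f lam γ lo hi lo)
        (reducedGrad f lam γ lo hi w)
      rw [abs_of_nonpos (by linarith : u - lo ≤ 0)] at e1
      rw [abs_of_nonpos (by linarith : lo - w ≤ 0)] at e2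
      rw [abs_of_nonpos (by linarith : u - w ≤ 0)]
      nlinarith
  rcases le_total u w with h | h
  · exact main u w hu hw h
  · rw [abs_sub_comm, abs_sub_comm u w]; exact main w u hw hu h

/-- The conjugate lies above the diagonal, so `φ ≤ 0`, with equality at this point, which is
interior to the range. -/
lemma reducedGrad_center (H : DualAssumptions f lam γ σ κ CM lo hi P) :
    reducedGrad f lam γ lo hi (lam * slopeOne f) = 0 := by
  obtain ⟨hc1, hc2⟩ := H.center_mem
  have hv0 := H.vmax_pos
  have hn : Set.Icc (lo - (1 - γ)⁻¹) hi ∈ nhds (lam * slopeOne f) :=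
    Icc_mem_nhds (by linarith) (by linarith)
  have hd := (H.reducedJ_hasDerivWithinAt (mem_of_mem_nhds hn)).hasDerivAt hn
  refine IsLocalMax.hasDerivAt_eq_zero ?_ hd
  have e : reducedJ f lam (lam * slopeOne f) = 0 := by
    rw [reducedJ, mul_div_cancel_left₀ _ H.lam_pos.ne', H.div.conj_slopeOne, EReal.toReal_coe,
      sub_self]
  filter_upwards [hn] with u hu
  rw [e, reducedJ]
  have h1 : ∃ v ∈ Set.Icc (0 : ℝ) (1 - γ)⁻¹, u + v ∈ Set.Icc lo hi := by
    rcases le_total lo u with h | h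
    · exact ⟨0, ⟨le_rfl, hv0.le⟩, by linarith, by linarith [hu.2]⟩
    · exact ⟨(1 - γ)⁻¹, ⟨hv0.le, le_rfl⟩, by linarith [hu.1], by linarith⟩
  obtain ⟨v, hv, huv⟩ := h1
  have h2 := H.coe_conj huv hv
  rw [add_sub_cancel_right] at h2
  have h3 := H.div.le_conj (u / lam)
  rw [h2, EReal.coe_le_coe_iff, div_le_iff₀ H.lam_pos] at h3
  linarith

/-- Strong concavity for a constant value function, of which only the sign is kept: `φ` increases to
the left of its centre and decreases to the right. -/
lemma reducedGrad_mul_nonpos (H : DualAssumptions f lam γ σ κ CM lo hi P) {u : ℝ}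
    (hu : u ∈ Set.Icc (lo - (1 - γ)⁻¹) hi) :
    reducedGrad f lam γ lo hi u * (u - lam * slopeOne f) ≤ 0 := by
  obtain ⟨s⟩ := ‹Nonempty S›
  obtain ⟨a⟩ := ‹Nonempty A›
  have : Nonempty S := ⟨s⟩
  have : Nonempty A := ⟨a⟩
  obtain ⟨hc1, hc2⟩ := H.center_mem
  have hv0 := H.vmax_pos
  have h1 : ∃ v ∈ Set.Icc (0 : ℝ) (1 - γ)⁻¹, u + v ∈ Set.Icc lo hi := by
    rcases le_total lo u with h | h
    · exact ⟨0, ⟨le_rfl, hv0.le⟩, by linarith, by linarith [hu.2]⟩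
    · exact ⟨(1 - γ)⁻¹, ⟨hv0.le, le_rfl⟩, by linarith [hu.1], by linarith⟩
  obtain ⟨v, hv, huv⟩ := h1
  obtain ⟨hm, hmax⟩ := H.isDualMax_const s a hv
  have h := H.strong _ (const_mem γ hv) s a _ hm hmax _ huv
  rw [H.derivWithin_dualJ s a huv (const_mem γ hv), ← Finset.sum_mul, H.sum_kernel] at h
  have e : u + v - (lam * slopeOne f + v) = u - lam * slopeOne f := by ring
  rw [e, one_mul, add_sub_cancel_right] at h
  exact h.trans (by have := H.kappa_pos; nlinarith [sq_nonneg (u - lam * slopeOne f)])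

lemma abs_reducedGrad_le (H : DualAssumptions f lam γ σ κ CM lo hi P) {u : ℝ}
    (hu : u ∈ Set.Icc (lo - (1 - γ)⁻¹) hi) :
    |reducedGrad f lam γ lo hi u| ≤ gradBound γ lam σ (hi - lo) := by
  obtain ⟨hc1, hc2⟩ := H.center_mem
  have hv0 := H.vmax_pos
  have h := H.reducedGrad_lipschitz hu (w := lam * slopeOne f) ⟨by linarith, by linarith⟩
  rw [H.reducedGrad_center, sub_zero] at h
  refine h.trans ?_
  have hL : 0 < lam * σ := mul_pos H.lam_pos H.sigma_pos
  rw [gradBound, one_div, inv_mul_eq_div]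
  gcongr
  rw [abs_le]; constructor <;> linarith [hu.1, hu.2]

lemma abs_reducedJ_sub_le (H : DualAssumptions f lam γ σ κ CM lo hi P) {u w : ℝ}
    (hu : u ∈ Set.Icc (lo - (1 - γ)⁻¹) hi) (hw : w ∈ Set.Icc (lo - (1 - γ)⁻¹) hi) :
    |reducedJ f lam u - reducedJ f lam w| ≤ gradBound γ lam σ (hi - lo) * |u - w| :=
  (convex_Icc _ _).norm_image_sub_le_of_norm_hasDerivWithin_le
    (fun _ hx => H.reducedJ_hasDerivWithinAt hx) (fun _ hx => H.abs_reducedGrad_le hx) hw hu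

/-- The mean gradient of the dual objective. -/
def meanGrad (f : ℝ → EReal) (lam γ lo hi : ℝ) (P : S → A → S → ℝ) (x : S × A) (V : S → ℝ)
    (η : ℝ) : ℝ := ∑ s', P x.1 x.2 s' * reducedGrad f lam γ lo hi (η - V s')

/-- The dual objective on the dual region, as a real number. -/
def meanJ (f : ℝ → EReal) (lam : ℝ) (P : S → A → S → ℝ) (x : S × A) (V : S → ℝ)
    (η : ℝ) : ℝ := ∑ s', P x.1 x.2 s' * (V s' + reducedJ f lam (η - V s'))

lemma meanGrad_lipschitz (H : DualAssumptions f lam γ σ κ CM lo hi P) (x : S × A)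
    {V V' : S → ℝ} {η η' : ℝ} (hV : V ∈ valueBox S γ) (hV' : V' ∈ valueBox S γ)
    (hη : η ∈ Set.Icc lo hi) (hη' : η' ∈ Set.Icc lo hi) :
    |meanGrad f lam γ lo hi P x V η - meanGrad f lam γ lo hi P x V' η'|
      ≤ 1 / (lam * σ) * (|η - η'| + ‖V - V'‖) := by
  have hL : 0 < lam * σ := mul_pos H.lam_pos H.sigma_pos
  refine abs_average_sub_le (H.kernel _ _) fun s => ?_
  refine (H.reducedGrad_lipschitz (H.sub_mem hη (hV s)) (H.sub_mem hη' (hV' s))).trans ?_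
  gcongr
  have h1 : |V s - V' s| ≤ ‖V - V'‖ := norm_le_pi_norm (V - V') s
  have e : η - V s - (η' - V' s) = (η - η') - (V s - V' s) := by ring
  rw [e]
  exact (abs_sub _ _).trans (by linarith)

lemma meanGrad_strong (H : DualAssumptions f lam γ σ κ CM lo hi P) (x : S × A)
    {V : S → ℝ} {η ηstar : ℝ} (hV : V ∈ valueBox S γ) (hη : η ∈ Set.Icc lo hi)
    (hs : ηstar ∈ Set.Icc lo hi) (hmax : IsDualMax f lam P x.1 x.2 V ηstar) :
    meanGrad f lam γ lo hi P x V η * (η - ηstar) ≤ -κ * (η - ηstar) ^ 2 := by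
  have h := H.strong V hV x.1 x.2 _ hs hmax _ hη
  rwa [H.derivWithin_dualJ _ _ hη hV] at h

/-- The point is that the maximizer may be an end point of the region, where maximality alone gives
only a one-sided inequality. At `lo` every `lo - V s` lies left of the centre and at `hi` every `hi
- V s` lies right of it, so the mean gradient changes sign and has a zero `ζ`. Strong concavity
evaluated at `ζ` forces `ζ` to be the maximizer. -/
lemma meanGrad_maximizer (H : DualAssumptions f lam γ σ κ CM lo hi P) (x : S × A)
    {V : S → ℝ} {ηstar : ℝ} (hV : V ∈ valueBox S γ)
    (hs : ηstar ∈ Set.Icc lo hi) (hmax : IsDualMax f lam P x.1 x.2 V ηstar) :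
    meanGrad f lam γ lo hi P x V ηstar = 0 := by
  obtain ⟨hc1, hc2⟩ := H.center_mem
  have hcont : ContinuousOn (meanGrad f lam γ lo hi P x V) (Set.Icc lo hi) := by
    have hlip : LipschitzOnWith (1 / (lam * σ)).toNNReal (meanGrad f lam γ lo hi P x V)
        (Set.Icc lo hi) := by
      refine LipschitzOnWith.of_dist_le_mul fun a ha b hb => ?_
      have := H.meanGrad_lipschitz x hV hV ha hb
      rw [sub_self, norm_zero, add_zero] at this
      rw [Real.coe_toNNReal _ (by have := H.lam_pos; have := H.sigma_pos; positivity)]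
      exact this
    exact hlip.continuousOn
  have hlo : 0 ≤ meanGrad f lam γ lo hi P x V lo := by
    refine Finset.sum_nonneg fun s _ => mul_nonneg ((H.kernel _ _).1 s) ?_
    have hu := H.sub_mem (Set.left_mem_Icc.2 H.le) (hV s)
    rcases (show lo - V s ≤ lam * slopeOne f by linarith [(hV s).1]).eq_or_lt with h | h
    · rw [h, H.reducedGrad_center]
    · by_contra hn
      nlinarith [H.reducedGrad_mul_nonpos hu]
  have hhi : meanGrad f lam γ lo hi P x V hi ≤ 0 := by
    refine Finset.sum_nonpos fun s _ => mul_nonpos_of_nonneg_of_nonpos ((H.kernel _ _).1 s) ?_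
    have hu := H.sub_mem (Set.right_mem_Icc.2 H.le) (hV s)
    rcases (show lam * slopeOne f ≤ hi - V s by linarith [(hV s).2]).eq_or_lt with h | h
    · rw [← h, H.reducedGrad_center]
    · by_contra hn
      nlinarith [H.reducedGrad_mul_nonpos hu]
  obtain ⟨ζ, hζ, h0⟩ := intermediate_value_Icc' H.le hcont ⟨hhi, hlo⟩
  have h1 := H.meanGrad_strong x hV hζ hs hmax
  rw [h0, zero_mul] at h1
  have h2 : (ζ - ηstar) ^ 2 = 0 := by
    have := H.kappa_pos
    nlinarith [sq_nonneg (ζ - ηstar)]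
  have h3 : ζ = ηstar := by linarith [pow_eq_zero_iff (two_ne_zero) |>.1 h2]
  rw [← h3, h0]

/-- The gradient vanishes at the maximizer and is Lipschitz, so it is at most `|η - ηstar| / (lam
σ)` on the segment between the two points. This quadratic loss is the reason why the tracking error
is negligible in the recursion for `Q`. -/
lemma meanJ_gap (H : DualAssumptions f lam γ σ κ CM lo hi P) (x : S × A)
    {V : S → ℝ} {η ηstar : ℝ} (hV : V ∈ valueBox S γ) (hη : η ∈ Set.Icc lo hi)
    (hs : ηstar ∈ Set.Icc lo hi) (hmax : IsDualMax f lam P x.1 x.2 V ηstar) :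
    |meanJ f lam P x V η - meanJ f lam P x V ηstar| ≤ 1 / (lam * σ) * (η - ηstar) ^ 2 := by
  have hsub : Set.uIcc ηstar η ⊆ Set.Icc lo hi :=
    Set.ordConnected_Icc.uIcc_subset hs hη
  have hL : 0 < lam * σ := mul_pos H.lam_pos H.sigma_pos
  have h := (convex_uIcc ηstar η).norm_image_sub_le_of_norm_hasDerivWithin_le
    (f := meanJ f lam P x V) (f' := meanGrad f lam γ lo hi P x V)
    (C := 1 / (lam * σ) * |η - ηstar|)
    (fun z hz => (H.hasDerivWithinAt_dualJ x.1 x.2 (hsub hz) hV).mono hsub)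
    (fun z hz => by
      have h1 := H.meanGrad_lipschitz x hV hV (hsub hz) hs
      rw [H.meanGrad_maximizer x hV hs hmax, sub_self, norm_zero, add_zero, sub_zero] at h1
      refine h1.trans ?_
      exact mul_le_mul_of_nonneg_left (Set.abs_sub_left_of_mem_uIcc hz) (by positivity))
    Set.left_mem_uIcc Set.right_mem_uIcc
  rw [Real.norm_eq_abs, Real.norm_eq_abs, mul_assoc, ← abs_mul, ← sq,
    abs_of_nonneg (sq_nonneg (η - ηstar))] at h
  exact h

/-- At the maximizer for `V'`, the gradient for `V` is of size `‖V - V'‖`, while strong concavity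
for `V` makes it at least `κ` times the distance to the maximizer for `V`. -/
lemma maximizer_lipschitz (H : DualAssumptions f lam γ σ κ CM lo hi P) (x : S × A)
    {V V' : S → ℝ} {η η' : ℝ} (hV : V ∈ valueBox S γ) (hV' : V' ∈ valueBox S γ)
    (hη : η ∈ Set.Icc lo hi) (hη' : η' ∈ Set.Icc lo hi)
    (hmax : IsDualMax f lam P x.1 x.2 V η) (hmax' : IsDualMax f lam P x.1 x.2 V' η') :
    |η - η'| ≤ 1 / (lam * σ) / κ * ‖V - V'‖ := by
  have h1 := H.meanGrad_strong x hV hη' hη hmax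
  have h2 := H.meanGrad_lipschitz x hV hV' hη' hη'
  rw [H.meanGrad_maximizer x hV' hη' hmax', sub_zero, sub_self, abs_zero, zero_add] at h2
  have h3 : κ * |η - η'| ^ 2 ≤ 1 / (lam * σ) * ‖V - V'‖ * |η - η'| := by
    have h4 : -(meanGrad f lam γ lo hi P x V η' * (η' - η))
        ≤ |meanGrad f lam γ lo hi P x V η'| * |η - η'| := by
      rw [abs_sub_comm, ← abs_mul]; exact neg_le_abs _
    have h5 := mul_le_mul_of_nonneg_right h2 (abs_nonneg (η - η'))
    rw [sq_abs]
    nlinarith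
  rcases (abs_nonneg (η - η')).eq_or_lt with h | h
  · rw [← h]
    have := H.lam_pos; have := H.sigma_pos; have := H.kappa_pos
    positivity
  · rw [div_mul_eq_mul_div, le_div_iff₀ H.kappa_pos]
    refine le_of_mul_le_mul_right ?_ h
    calc _ = κ * |η - η'| ^ 2 := by ring
      _ ≤ _ := h3

end DualAssumptions

end Dual

/-! ### The greedy value function is nonexpansive -/

section Greedy

variable {S A : Type*} [Fintype S] [Fintype A] [Nonempty A]

lemma le_greedy (Q : S × A → ℝ) (s : S) (a : A) : Q (s, a) ≤ greedy Q s :=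
  le_ciSup (f := fun a => Q (s, a)) (Set.finite_range _).bddAbove a

lemma greedy_le_add {Q Q' : S × A → ℝ} {c : ℝ} (h : ∀ x, Q x ≤ Q' x + c) (s : S) :
    greedy Q s ≤ greedy Q' s + c :=
  ciSup_le fun a => (h (s, a)).trans (add_le_add_left (le_greedy Q' s a) c)

lemma abs_greedy_sub_le (Q Q' : S × A → ℝ) (s : S) : |greedy Q s - greedy Q' s| ≤ ‖Q - Q'‖ := by
  have h : ∀ x, |Q x - Q' x| ≤ ‖Q - Q'‖ := fun x => norm_le_pi_norm (Q - Q') x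
  rw [abs_le]
  constructor
  · have := greedy_le_add (Q := Q') (Q' := Q) (c := ‖Q - Q'‖)
      (fun x => by linarith [(abs_le.1 (h x)).1]) s
    linarith
  · have := greedy_le_add (Q := Q) (Q' := Q') (c := ‖Q - Q'‖)
      (fun x => by linarith [(abs_le.1 (h x)).2]) s
    linarith

lemma clippedGreedy_eq_clamp (γ : ℝ) (Q : S × A → ℝ) (s : S) :
    clippedGreedy γ Q s = clamp 0 (1 - γ)⁻¹ (greedy Q s) := rfl

lemma clippedGreedy_mem {γ : ℝ} (hγ : γ < 1) (Q : S × A → ℝ) :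
    clippedGreedy γ Q ∈ valueBox S γ :=
  fun _ => clamp_mem (inv_nonneg.2 (sub_nonneg.2 hγ.le)) _

lemma norm_clippedGreedy_sub_le (γ : ℝ) (Q Q' : S × A → ℝ) :
    ‖clippedGreedy γ Q - clippedGreedy γ Q'‖ ≤ ‖Q - Q'‖ :=
  (pi_norm_le_iff_of_nonneg (norm_nonneg _)).2 fun s =>
    (abs_clamp_sub_clamp_le _ _ _ _).trans (abs_greedy_sub_le Q Q' s)

end Greedy

/-! ### The optimal dual value, the Bellman fixed point and the regularity package -/

section Bellman

variable {S A : Type*} [Fintype S] [Fintype A]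

namespace DualAssumptions

variable {f : ℝ → EReal} {lam γ σ κ CM lo hi : ℝ} {P : S → A → S → ℝ}

lemma sum_coe_mul_coe (H : DualAssumptions f lam γ σ κ CM lo hi P) (s : S) (a : A) (c : ℝ) :
    ∑ s', (P s a s' : EReal) * (c : EReal) = (c : EReal) := by
  simp only [← EReal.coe_mul, ← ereal_coe_sum, ← Finset.sum_mul, H.sum_kernel, one_mul]

lemma sum_conj_mono (H : DualAssumptions f lam γ σ κ CM lo hi P) (s : S) (a : A)
    {u w : S → EReal} (h : ∀ s', u s' ≤ w s') :
    (lam : EReal) * ∑ s', (P s a s' : EReal) * u s'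
      ≤ (lam : EReal) * ∑ s', (P s a s' : EReal) * w s' := by
  refine mul_le_mul_of_nonneg_left (Finset.sum_le_sum fun s' _ => ?_)
    (EReal.coe_nonneg.2 H.lam_pos.le)
  exact mul_le_mul_of_nonneg_left (h s') (EReal.coe_nonneg.2 ((H.kernel s a).1 s'))

lemma dualJ_le (H : DualAssumptions f lam γ σ κ CM lo hi P) (s : S) (a : A) (η : ℝ)
    {V : S → ℝ} {b : ℝ} (hV : ∀ s', V s' ≤ b) : dualJ f lam P s a η V ≤ (b : EReal) := by
  have h := H.sum_conj_mono s a (u := fun _ => (((η - b) / lam : ℝ) : EReal))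
    (w := fun s' => conj f ((η - V s') / lam)) (fun s' =>
      (EReal.coe_le_coe_iff.2 (div_le_div_of_nonneg_right (by linarith [hV s']) H.lam_pos.le)).trans
        (H.div.le_conj _))
  rw [H.sum_coe_mul_coe, ← EReal.coe_mul, mul_div_cancel₀ _ H.lam_pos.ne'] at h
  calc dualJ f lam P s a η V ≤ (η : EReal) - ((η - b : ℝ) : EReal) := EReal.sub_le_sub le_rfl h
    _ = (b : EReal) := by rw [← EReal.coe_sub]; congr 1; ring

/-- The test point is the maximizer for the constant function `b`; monotonicity of the conjugate
compares `V` with that constant. -/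
lemma le_iSup_dualJ (H : DualAssumptions f lam γ σ κ CM lo hi P) (s : S) (a : A)
    {V : S → ℝ} {b : ℝ} (hV : ∀ s', b ≤ V s') : (b : EReal) ≤ ⨆ η : ℝ, dualJ f lam P s a η V := by
  refine le_trans ?_ (le_iSup _ (lam * slopeOne f + b))
  have h := H.sum_conj_mono s a (u := fun s' => conj f ((lam * slopeOne f + b - V s') / lam))
    (w := fun _ => (slopeOne f : EReal)) (fun s' => by
      rw [← H.div.conj_slopeOne]
      refine H.div.conj_mono ?_
      rw [div_le_iff₀ H.lam_pos]
      linarith [hV s'])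
  rw [H.sum_coe_mul_coe, ← EReal.coe_mul] at h
  calc (b : EReal) = ((lam * slopeOne f + b : ℝ) : EReal) - ((lam * slopeOne f : ℝ) : EReal) := by
        rw [← EReal.coe_sub]; congr 1; ring
    _ ≤ _ := EReal.sub_le_sub le_rfl h

/-- Adding `c` to the value function is the same as translating `η` by `c`, so monotonicity of the
conjugate is enough. No restriction to the box is needed. -/
lemma iSup_dualJ_le_add (H : DualAssumptions f lam γ σ κ CM lo hi P) (s : S) (a : A)
    {V V' : S → ℝ} {c : ℝ} (hV : ∀ s', V s' ≤ V' s' + c) :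
    ⨆ η : ℝ, dualJ f lam P s a η V ≤ (c : EReal) + ⨆ η : ℝ, dualJ f lam P s a η V' := by
  refine iSup_le fun η => ?_
  have h := H.sum_conj_mono s a (u := fun s' => conj f ((η - c - V' s') / lam))
    (w := fun s' => conj f ((η - V s') / lam)) (fun s' => by
      refine H.div.conj_mono (div_le_div_of_nonneg_right ?_ H.lam_pos.le)
      linarith [hV s'])
  calc dualJ f lam P s a η V
      ≤ (η : EReal) - (lam : EReal) * ∑ s', (P s a s' : EReal) * conj f ((η - c - V' s') / lam) :=
        EReal.sub_le_sub le_rfl h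
    _ = (c : EReal) + dualJ f lam P s a (η - c) V' := by
        have e : (η : EReal) = (c : EReal) + ((η - c : ℝ) : EReal) := by
          rw [← EReal.coe_add]; congr 1; ring
        rw [dualJ, e, sub_eq_add_neg, add_assoc, ← sub_eq_add_neg]
    _ ≤ _ := add_le_add le_rfl (le_iSup (fun η => dualJ f lam P s a η V') _)

/-- The optimal dual value, as a real number. -/
def optJ (f : ℝ → EReal) (lam : ℝ) (P : S → A → S → ℝ) (x : S × A) (V : S → ℝ) : ℝ :=
  (⨆ η : ℝ, dualJ f lam P x.1 x.2 η V).toReal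

lemma coe_optJ (H : DualAssumptions f lam γ σ κ CM lo hi P) (x : S × A) (V : S → ℝ) :
    (optJ f lam P x V : EReal) = ⨆ η : ℝ, dualJ f lam P x.1 x.2 η V := by
  have hb : ∀ s, |V s| ≤ ‖V‖ := fun s => norm_le_pi_norm V s
  refine EReal.coe_toReal (fun h => ?_) (fun h => ?_)
  · have := iSup_le fun η => H.dualJ_le x.1 x.2 η (b := ‖V‖) fun s => (abs_le.1 (hb s)).2
    rw [h] at this
    exact absurd this (by simp)
  · have := H.le_iSup_dualJ x.1 x.2 (b := -‖V‖) fun s => (abs_le.1 (hb s)).1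
    rw [h] at this
    exact absurd this (by rw [le_bot_iff]; exact EReal.coe_ne_bot _)

lemma optJ_le (H : DualAssumptions f lam γ σ κ CM lo hi P) (x : S × A) {V : S → ℝ} {b : ℝ}
    (hV : ∀ s', V s' ≤ b) : optJ f lam P x V ≤ b := by
  rw [← EReal.coe_le_coe_iff, H.coe_optJ]
  exact iSup_le fun η => H.dualJ_le x.1 x.2 η hV

lemma le_optJ (H : DualAssumptions f lam γ σ κ CM lo hi P) (x : S × A) {V : S → ℝ} {b : ℝ}
    (hV : ∀ s', b ≤ V s') : b ≤ optJ f lam P x V := by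
  rw [← EReal.coe_le_coe_iff, H.coe_optJ]
  exact H.le_iSup_dualJ x.1 x.2 hV

lemma abs_optJ_sub_le (H : DualAssumptions f lam γ σ κ CM lo hi P) (x : S × A) (V V' : S → ℝ) :
    |optJ f lam P x V - optJ f lam P x V'| ≤ ‖V - V'‖ := by
  have hb : ∀ s, |V s - V' s| ≤ ‖V - V'‖ := fun s => norm_le_pi_norm (V - V') s
  have h1 := H.iSup_dualJ_le_add x.1 x.2 (V := V) (V' := V') (c := ‖V - V'‖)
    (fun s => by linarith [(abs_le.1 (hb s)).2])
  have h2 := H.iSup_dualJ_le_add x.1 x.2 (V := V') (V' := V) (c := ‖V - V'‖)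
    (fun s => by linarith [(abs_le.1 (hb s)).1])
  rw [← H.coe_optJ, ← H.coe_optJ, ← EReal.coe_add, EReal.coe_le_coe_iff] at h1 h2
  rw [abs_le]; constructor <;> linarith

lemma optJ_eq (H : DualAssumptions f lam γ σ κ CM lo hi P) (x : S × A) {V : S → ℝ} {η : ℝ}
    (hV : V ∈ valueBox S γ) (hη : η ∈ Set.Icc lo hi) (hmax : IsDualMax f lam P x.1 x.2 V η) :
    optJ f lam P x V = meanJ f lam P x V η := by
  rw [← EReal.coe_eq_coe_iff, H.coe_optJ, meanJ, ← H.dualJ_eq x.1 x.2 hη hV]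
  exact le_antisymm (iSup_le hmax) (le_iSup (fun η => dualJ f lam P x.1 x.2 η V) η)

lemma isRobustFixedPoint_iff (H : DualAssumptions f lam γ σ κ CM lo hi P) (R : S → A → ℝ)
    (Q : S × A → ℝ) : IsRobustFixedPoint f lam γ P R Q ↔
      (fun x => R x.1 x.2 + γ * optJ f lam P x (greedy Q)) = Q := by
  rw [funext_iff]
  refine forall_congr' fun x => ?_
  rw [robustBellman, ← H.coe_optJ, ← EReal.coe_mul, ← EReal.coe_add, EReal.coe_eq_coe_iff, eq_comm]

variable [Nonempty S] [Nonempty A]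

/-- Banach's theorem on all of `S × A → ℝ`: the optimal dual value is nonexpansive for arbitrary
value functions, so uniqueness holds among all real `Q`. -/
lemma exists_fixedPoint (H : DualAssumptions f lam γ σ κ CM lo hi P) (R : S → A → ℝ) :
    ∃ Qstar : S × A → ℝ, IsRobustFixedPoint f lam γ P R Qstar ∧
      ∀ Q', IsRobustFixedPoint f lam γ P R Q' → Q' = Qstar := by
  let T : (S × A → ℝ) → (S × A → ℝ) := fun Q x => R x.1 x.2 + γ * optJ f lam P x (greedy Q)
  have hT : ContractingWith γ.toNNReal T := by
    refine ⟨by rw [← NNReal.coe_lt_coe, Real.coe_toNNReal _ H.gamma_nonneg]; exact H.gamma_lt,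
      LipschitzWith.of_dist_le_mul fun Q Q' => ?_⟩
    rw [Real.coe_toNNReal _ H.gamma_nonneg, dist_eq_norm, dist_eq_norm]
    refine (pi_norm_le_iff_of_nonneg (mul_nonneg H.gamma_nonneg (norm_nonneg _))).2 fun x => ?_
    have e : (T Q - T Q') x
        = γ * (optJ f lam P x (greedy Q) - optJ f lam P x (greedy Q')) := by
      simp only [T, Pi.sub_apply]; ring
    rw [e, norm_mul, Real.norm_of_nonneg H.gamma_nonneg]
    refine mul_le_mul_of_nonneg_left ((H.abs_optJ_sub_le x _ _).trans ?_) H.gamma_nonneg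
    exact (pi_norm_le_iff_of_nonneg (norm_nonneg _)).2 fun s => abs_greedy_sub_le Q Q' s
  refine ⟨ContractingWith.fixedPoint T hT, (H.isRobustFixedPoint_iff R _).2
    hT.fixedPoint_isFixedPt, fun Q' hQ' => ?_⟩
  exact hT.fixedPoint_unique ((H.isRobustFixedPoint_iff R _).1 hQ')

/-- The optimal dual value lies between the bounds of the value function. The Bellman equation at a
minimizing pair and at a maximizing pair of `Q` then gives the two inequalities. -/
lemma fixedPoint_mem (H : DualAssumptions f lam γ σ κ CM lo hi P) {R : S → A → ℝ}
    (hR : ∀ s a, R s a ∈ Set.Icc (0 : ℝ) 1) {Q : S × A → ℝ}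
    (hQ : IsRobustFixedPoint f lam γ P R Q) (x : S × A) : Q x ∈ Set.Icc (0 : ℝ) (1 - γ)⁻¹ := by
  have hQ' := congrFun ((H.isRobustFixedPoint_iff R Q).1 hQ)
  have h1γ : 0 < 1 - γ := sub_pos.2 H.gamma_lt
  obtain ⟨y, hy⟩ := Finite.exists_min Q
  obtain ⟨z, hz⟩ := Finite.exists_max Q
  obtain ⟨a0⟩ := ‹Nonempty A›
  have : Nonempty A := ⟨a0⟩
  constructor
  · have h1 : Q y ≤ optJ f lam P y (greedy Q) :=
      H.le_optJ y fun s => (hy (s, a0)).trans (le_greedy Q s a0)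
    have h2 := hQ' y
    have h3 := (hR y.1 y.2).1
    have h4 := mul_le_mul_of_nonneg_left h1 H.gamma_nonneg
    refine le_trans ?_ (hy x)
    by_contra hc
    nlinarith
  · have h1 : optJ f lam P z (greedy Q) ≤ Q z := H.optJ_le z fun s => ciSup_le fun a => hz (s, a)
    have h2 := hQ' z
    have h3 := (hR z.1 z.2).2
    have h4 := mul_le_mul_of_nonneg_left h1 H.gamma_nonneg
    refine (hz x).trans ?_
    rw [← one_div, le_div_iff₀ h1γ]
    linarith

end DualAssumptions

/-- A sampled dual objective `j` with gradient `g` and maximizers `ηs`, all of whose bounds and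
Lipschitz constants are at most `B`, together with the fixed point `Qstar` of the Bellman
operator. -/
structure RegularDual (γ κ B lo hi : ℝ) (P : S → A → S → ℝ) (R : S → A → ℝ) (j g : ℝ → ℝ → ℝ)
    (ηs : S × A → (S → ℝ) → ℝ) (Qstar : S × A → ℝ) : Prop where
  kernel : ∀ s a, P s a ∈ stdSimplex ℝ S
  reward : ∀ s a, R s a ∈ Set.Icc (0 : ℝ) 1
  gamma_nonneg : 0 ≤ γ
  gamma_lt : γ < 1
  kappa_pos : 0 < κ
  one_le : 1 ≤ B
  vmax_le : (1 - γ)⁻¹ ≤ B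
  le : lo ≤ hi
  diam_le : hi - lo ≤ B
  j_bound : ∀ η v, |j η v| ≤ B
  g_bound : ∀ η v, |g η v| ≤ B
  j_lip : ∀ η v η' v', |j η v - j η' v'| ≤ B * (|η - η'| + |v - v'|)
  g_lip : ∀ η v η' v', |g η v - g η' v'| ≤ B * (|η - η'| + |v - v'|)
  max_mem : ∀ x, ∀ V ∈ valueBox S γ, ηs x V ∈ Set.Icc lo hi
  max_lip : ∀ x, ∀ V ∈ valueBox S γ, ∀ V' ∈ valueBox S γ, |ηs x V - ηs x V'| ≤ B * ‖V - V'‖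
  strong : ∀ x, ∀ V ∈ valueBox S γ, ∀ η ∈ Set.Icc lo hi,
    (∑ s', P x.1 x.2 s' * g η (V s')) * (η - ηs x V) ≤ -κ * (η - ηs x V) ^ 2
  qstar_mem : ∀ x, Qstar x ∈ Set.Icc (0 : ℝ) (1 - γ)⁻¹
  bellman : ∀ x (Q : S × A → ℝ), ∀ η ∈ Set.Icc lo hi,
    |R x.1 x.2 + γ * ∑ s', P x.1 x.2 s' * j η (clippedGreedy γ Q s') - Qstar x|
      ≤ γ * (B * (η - ηs x (clippedGreedy γ Q)) ^ 2 + ‖Q - Qstar‖)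

lemma RegularDual.mono {γ κ B B' lo hi : ℝ} {P : S → A → S → ℝ} {R : S → A → ℝ}
    {j g : ℝ → ℝ → ℝ} {ηs : S × A → (S → ℝ) → ℝ} {Qstar : S × A → ℝ}
    (H : RegularDual γ κ B lo hi P R j g ηs Qstar) (h : B ≤ B') :
    RegularDual γ κ B' lo hi P R j g ηs Qstar :=
  { H with
    one_le := H.one_le.trans h
    vmax_le := H.vmax_le.trans h
    diam_le := H.diam_le.trans h
    j_bound := fun η v => (H.j_bound η v).trans h
    g_bound := fun η v => (H.g_bound η v).trans h
    j_lip := fun η v η' v' => (H.j_lip η v η' v').trans (by gcongr)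
    g_lip := fun η v η' v' => (H.g_lip η v η' v').trans (by gcongr)
    max_lip := fun x V hV V' hV' => (H.max_lip x V hV V' hV').trans (by gcongr)
    bellman := fun x Q η hη => (H.bellman x Q η hη).trans
      (mul_le_mul_of_nonneg_left (by gcongr) H.gamma_nonneg) }

/-- A common bound for all the constants of the dual problem. -/
def dualConst (lam γ σ κ CM D : ℝ) : ℝ :=
  1 + CM + gradBound γ lam σ D + 1 / (lam * σ) + 1 / (lam * σ) / κ + (1 - γ)⁻¹ + D

/-- The sampled dual objective, extended constantly outside of the region. -/
def extJ (f : ℝ → EReal) (lam γ lo hi η v : ℝ) : ℝ :=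
  clamp 0 (1 - γ)⁻¹ v + reducedJ f lam (clamp lo hi η - clamp 0 (1 - γ)⁻¹ v)

/-- The sampled dual gradient, extended constantly outside of the region. -/
def extGrad (f : ℝ → EReal) (lam γ lo hi η v : ℝ) : ℝ :=
  reducedGrad f lam γ lo hi (clamp lo hi η - clamp 0 (1 - γ)⁻¹ v)

/-- Clamping both arguments makes the bounds and Lipschitz estimates global without changing
anything on the region. The maximizers are an arbitrary choice; their Lipschitz dependence on `V` is
what is kept. -/
lemma DualAssumptions.exists_regularDual [Nonempty S] [Nonempty A]
    {f : ℝ → EReal} {lam γ σ κ CM lo hi : ℝ}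
    {P : S → A → S → ℝ} (H : DualAssumptions f lam γ σ κ CM lo hi P) (hCM : 0 ≤ CM)
    {R : S → A → ℝ} (hR : ∀ s a, R s a ∈ Set.Icc (0 : ℝ) 1) {Qstar : S × A → ℝ}
    (hQ : IsRobustFixedPoint f lam γ P R Qstar) :
    ∃ ηs : S × A → (S → ℝ) → ℝ,
      RegularDual γ κ (dualConst lam γ σ κ CM (hi - lo)) lo hi P R (extJ f lam γ lo hi)
        (extGrad f lam γ lo hi) ηs Qstar := by
  classical
  have hv0 := H.vmax_pos
  have hL : 0 < lam * σ := mul_pos H.lam_pos H.sigma_pos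
  have hκ := H.kappa_pos
  have hD : 0 ≤ hi - lo := sub_nonneg.2 H.le
  have hL' : 0 ≤ 1 / (lam * σ) := by positivity
  have hLk : 0 ≤ 1 / (lam * σ) / κ := by positivity
  have hCg : 0 ≤ gradBound γ lam σ (hi - lo) := by unfold gradBound; positivity
  have hcη : ∀ η, clamp lo hi η ∈ Set.Icc lo hi := fun η => clamp_mem H.le η
  have hcv : ∀ v, clamp 0 (1 - γ)⁻¹ v ∈ Set.Icc (0 : ℝ) (1 - γ)⁻¹ := fun v => clamp_mem hv0.le v
  have hsub : ∀ η v η' v' : ℝ, |clamp lo hi η - clamp 0 (1 - γ)⁻¹ v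
      - (clamp lo hi η' - clamp 0 (1 - γ)⁻¹ v')| ≤ |η - η'| + |v - v'| := by
    intro η v η' v'
    have e : clamp lo hi η - clamp 0 (1 - γ)⁻¹ v - (clamp lo hi η' - clamp 0 (1 - γ)⁻¹ v')
      = (clamp lo hi η - clamp lo hi η') - (clamp 0 (1 - γ)⁻¹ v - clamp 0 (1 - γ)⁻¹ v') := by ring
    rw [e]
    exact (abs_sub _ _).trans
      (add_le_add (abs_clamp_sub_clamp_le _ _ _ _) (abs_clamp_sub_clamp_le _ _ _ _))
  choose! ηs hmem hmax using fun (x : S × A) (V : S → ℝ) (hV : V ∈ valueBox S γ) =>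
    H.maxIn V hV x.1 x.2
  have hj : ∀ {η}, η ∈ Set.Icc lo hi → ∀ {V}, V ∈ valueBox S γ → ∀ x : S × A,
      ∑ s', P x.1 x.2 s' * extJ f lam γ lo hi η (V s') = meanJ f lam P x V η := by
    intro η hη V hV x
    simp only [extJ, clamp_of_mem hη, clamp_of_mem (hV _), meanJ]
  have hg : ∀ {η}, η ∈ Set.Icc lo hi → ∀ {V}, V ∈ valueBox S γ → ∀ x : S × A,
      ∑ s', P x.1 x.2 s' * extGrad f lam γ lo hi η (V s') = meanGrad f lam γ lo hi P x V η := by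
    intro η hη V hV x
    simp only [extGrad, clamp_of_mem hη, clamp_of_mem (hV _), meanGrad]
  refine ⟨ηs, H.kernel, hR, H.gamma_nonneg, H.gamma_lt, hκ, ?_, ?_, H.le, ?_, ?_, ?_, ?_, ?_,
    hmem, ?_, ?_, fun x => H.fixedPoint_mem hR hQ x, ?_⟩
  · unfold dualConst; linarith
  · unfold dualConst; linarith
  · unfold dualConst; linarith
  · intro η v
    have h := H.bound _ (hcη η) _ (hcv v)
    rw [H.sampleJ_eq (hcη η) (hcv v), EReal.coe_le_coe_iff, EReal.coe_le_coe_iff] at h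
    have : |extJ f lam γ lo hi η v| ≤ CM := abs_le.2 h
    unfold dualConst; linarith
  · intro η v
    have := H.abs_reducedGrad_le (H.sub_mem (hcη η) (hcv v))
    unfold dualConst extGrad; linarith
  · intro η v η' v'
    have h1 := H.abs_reducedJ_sub_le (H.sub_mem (hcη η) (hcv v)) (H.sub_mem (hcη η') (hcv v'))
    have h2 := mul_le_mul_of_nonneg_left (hsub η v η' v') hCg
    have h3 := abs_clamp_sub_clamp_le 0 (1 - γ)⁻¹ v v'
    have h4 := abs_add_le (clamp 0 (1 - γ)⁻¹ v - clamp 0 (1 - γ)⁻¹ v')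
      (reducedJ f lam (clamp lo hi η - clamp 0 (1 - γ)⁻¹ v)
        - reducedJ f lam (clamp lo hi η' - clamp 0 (1 - γ)⁻¹ v'))
    have e : extJ f lam γ lo hi η v - extJ f lam γ lo hi η' v'
      = (clamp 0 (1 - γ)⁻¹ v - clamp 0 (1 - γ)⁻¹ v')
      + (reducedJ f lam (clamp lo hi η - clamp 0 (1 - γ)⁻¹ v)
        - reducedJ f lam (clamp lo hi η' - clamp 0 (1 - γ)⁻¹ v')) := by
      unfold extJ; ring
    rw [e]
    have h5 : (1 + gradBound γ lam σ (hi - lo)) * (|η - η'| + |v - v'|)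
        ≤ dualConst lam γ σ κ CM (hi - lo) * (|η - η'| + |v - v'|) := by
      refine mul_le_mul_of_nonneg_right ?_ (by positivity)
      unfold dualConst; linarith
    linarith [abs_nonneg (η - η')]
  · intro η v η' v'
    refine (H.reducedGrad_lipschitz (H.sub_mem (hcη η) (hcv v))
      (H.sub_mem (hcη η') (hcv v'))).trans ?_
    refine mul_le_mul ?_ (hsub η v η' v') (abs_nonneg _) ?_ <;> unfold dualConst <;> linarith
  · intro x V hV V' hV'
    refine (H.maximizer_lipschitz x hV hV' (hmem x V hV) (hmem x V' hV') (hmax x V hV)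
      (hmax x V' hV')).trans (mul_le_mul_of_nonneg_right ?_ (norm_nonneg _))
    unfold dualConst; linarith
  · intro x V hV η hη
    rw [hg hη hV]
    exact H.meanGrad_strong x hV hη (hmem x V hV) (hmax x V hV)
  · intro x Q η hη
    have hV := clippedGreedy_mem H.gamma_lt Q (S := S)
    set V := clippedGreedy γ Q
    -- The fixed point lies in the box, so projecting the value function does not displace it.
    have h1 : greedy Qstar = clippedGreedy γ Qstar := by
      funext s
      rw [clippedGreedy_eq_clamp, clamp_of_mem]
      obtain ⟨a⟩ := ‹Nonempty A›
      have : Nonempty A := ⟨a⟩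
      exact ⟨(H.fixedPoint_mem hR hQ (s, a)).1.trans (le_greedy _ _ _),
        ciSup_le fun a => (H.fixedPoint_mem hR hQ (s, a)).2⟩
    have h2 := congrFun ((H.isRobustFixedPoint_iff R Qstar).1 hQ) x
    rw [hj hη hV]
    have h3 := H.meanJ_gap x hV hη (hmem x V hV) (hmax x V hV)
    rw [← H.optJ_eq x hV (hmem x V hV) (hmax x V hV)] at h3
    have h4 := (H.abs_optJ_sub_le x V (greedy Qstar)).trans
      ((congrArg (fun W => ‖V - W‖) h1).le.trans (norm_clippedGreedy_sub_le γ Q Qstar))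
    -- The Bellman residual splits into the quadratic suboptimality of `η` and the nonexpansive
    -- change of the optimal value.
    have e : R x.1 x.2 + γ * meanJ f lam P x V η - Qstar x
        = γ * ((meanJ f lam P x V η - optJ f lam P x V)
          + (optJ f lam P x V - optJ f lam P x (greedy Qstar))) := by
      rw [← h2]; ring
    rw [e, abs_mul, abs_of_nonneg H.gamma_nonneg]
    refine mul_le_mul_of_nonneg_left ((abs_add_le _ _).trans (add_le_add (h3.trans ?_) h4))
      H.gamma_nonneg
    refine mul_le_mul_of_nonneg_right ?_ (sq_nonneg _)
    unfold dualConst; linarith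

end Bellman

/-! ### Indicators of states -/

section Hit

variable {X : Type*}

open Classical in
/-- The indicator of `y = x`. -/
def hit (x y : X) : ℝ := if y = x then 1 else 0

@[simp] lemma hit_self (x : X) : hit x x = 1 := by simp [hit]

lemma hit_of_ne {x y : X} (h : y ≠ x) : hit x y = 0 := by simp [hit, h]

lemma hit_nonneg (x y : X) : 0 ≤ hit x y := by unfold hit; split_ifs <;> norm_num

lemma hit_le_one (x y : X) : hit x y ≤ 1 := by unfold hit; split_ifs <;> norm_num

lemma abs_hit_le (x y : X) : |hit x y| ≤ 1 := by
  rw [abs_of_nonneg (hit_nonneg x y)]; exact hit_le_one x y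

lemma sum_hit_mul [Fintype X] (φ : X → ℝ) (y : X) : ∑ x, hit x y * φ x = φ y := by
  classical
  rw [Finset.sum_eq_single y]
  · simp
  · intro x _ hx; rw [hit_of_ne (Ne.symm hx), zero_mul]
  · intro h; exact absurd (Finset.mem_univ y) h

end Hit

/-! ### The Poisson equation of the state-action chain -/

section Poisson

variable {S A : Type*} [Fintype S] [Fintype A]

lemma chainMatrix_sum_fst {P : S → A → S → ℝ} {π : S → A → ℝ} (hπ : ∀ s, π s ∈ stdSimplex ℝ A)
    (x : S × A) (ψ : S → ℝ) :
    ∑ y, chainMatrix P π x y * ψ y.1 = ∑ s', P x.1 x.2 s' * ψ s' := by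
  rw [Fintype.sum_prod_type]
  refine Finset.sum_congr rfl fun s' _ => ?_
  simp only [chainMatrix, Matrix.of_apply, ← Finset.sum_mul, ← Finset.mul_sum, (hπ s').2, mul_one]

lemma chainMatrix_sum {P : S → A → S → ℝ} {π : S → A → ℝ} (hP : ∀ s a, P s a ∈ stdSimplex ℝ S)
    (hπ : ∀ s, π s ∈ stdSimplex ℝ A) (x : S × A) : ∑ y, chainMatrix P π x y = 1 := by
  have := chainMatrix_sum_fst (P := P) hπ x (fun _ => 1)
  simpa [(hP x.1 x.2).2] using this

lemma chainMatrix_nonneg {P : S → A → S → ℝ} {π : S → A → ℝ} (hP : ∀ s a, P s a ∈ stdSimplex ℝ S)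
    (hπ : ∀ s, π s ∈ stdSimplex ℝ A) (x y : S × A) : 0 ≤ chainMatrix P π x y :=
  mul_nonneg ((hP _ _).1 _) ((hπ _).1 _)

/-- A bounded solution of the Poisson equation for the occupation of each state. -/
lemma exists_poisson {P : S → A → S → ℝ} {π : S → A → ℝ} {d : S × A → ℝ} {M ρ : ℝ}
    (hP : ∀ s a, P s a ∈ stdSimplex ℝ S) (hπ : ∀ s, π s ∈ stdSimplex ℝ A)
    (hρ0 : 0 < ρ) (hρ1 : ρ < 1) (hM : GeometricMixing P π d M ρ) :
    ∃ h : S × A → S × A → ℝ, (∀ x y, |h x y| ≤ 2 * M / (1 - ρ)) ∧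
      ∀ x y, h x y - ∑ z, chainMatrix P π y z * h x z = hit x y - d x := by
  classical
  obtain ⟨-, -, hmix⟩ := hM
  let q : ℕ → S × A → S × A → ℝ := fun k y x => (chainMatrix P π ^ k) y x
  have hq0 : ∀ y x, q 0 y x = hit x y := by
    intro y x
    by_cases h : y = x
    · simp [q, h]
    · simp [q, hit_of_ne h, h]
  have hq1 : ∀ k y x, q (k + 1) y x = ∑ z, chainMatrix P π y z * q k z x := by
    intro k y x
    simp only [q, pow_succ', Matrix.mul_apply]
  have hqd : ∀ k y x, |q k y x - d x| ≤ 2 * M * ρ ^ k := by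
    intro k y x
    have h1 : (1 / 2 : ℝ) * ∑ z : S × A, |q k y z - d z| ≤ M * ρ ^ k := by
      convert hmix k y
    have h2 := Finset.single_le_sum (f := fun z => |q k y z - d z|)
      (fun _ _ => abs_nonneg _) (Finset.mem_univ x)
    have h3 : |q k y x - d x| ≤ ∑ z : S × A, |q k y z - d z| := h2
    linarith
  have hg : Summable fun k : ℕ => 2 * M * ρ ^ k :=
    (summable_geometric_of_lt_one hρ0.le hρ1).mul_left _
  have hs : ∀ y x, Summable fun k => q k y x - d x := fun y x =>
    Summable.of_norm_bounded hg fun k => hqd k y x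
  -- The solution sums the deviations of the `k`-step probabilities from stationarity. Applying the
  -- kernel shifts the series by one, leaving the term `k = 0`. The factor `2` in its bound undoes
  -- the `1 / 2` in total variation.
  refine ⟨fun x y => ∑' k, (q k y x - d x), fun x y => ?_, fun x y => ?_⟩
  · have h1 := tsum_of_norm_bounded (f := fun k => q k y x - d x) hg.hasSum (fun k => hqd k y x)
    rw [tsum_mul_left, tsum_geometric_of_lt_one hρ0.le hρ1] at h1
    rw [div_eq_mul_inv]
    exact h1
  · have h1 : ∑ z, chainMatrix P π y z * ∑' k, (q k z x - d x) = ∑' k, (q (k + 1) y x - d x) := by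
      simp only [← tsum_mul_left]
      rw [← Summable.tsum_finsetSum fun z _ => (hs z x).mul_left _]
      refine tsum_congr fun k => ?_
      simp only [mul_sub, Finset.sum_sub_distrib, ← Finset.sum_mul, chainMatrix_sum hP hπ y, one_mul,
        hq1]
    simp only [h1]
    rw [(hs y x).tsum_eq_zero_add, hq0]
    ring

end Poisson

/-! ### Bounded functions measurable with respect to a sub-sigma-algebra -/

section Bounded

variable {Ω : Type*} {m m' : MeasurableSpace Ω} {Z W : Ω → ℝ}

/-- Bounded `m`-measurable real functions. -/
def IsBdd (m : MeasurableSpace Ω) (Z : Ω → ℝ) : Prop :=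
  Measurable[m] Z ∧ ∃ c, ∀ ω, |Z ω| ≤ c

lemma IsBdd.mono (hZ : IsBdd m Z) (h : m ≤ m') : IsBdd m' Z := ⟨hZ.1.mono h le_rfl, hZ.2⟩

lemma IsBdd.const (c : ℝ) : IsBdd m (fun _ => c) := ⟨measurable_const, |c|, fun _ => le_rfl⟩

lemma IsBdd.add (hZ : IsBdd m Z) (hW : IsBdd m W) : IsBdd m (fun ω => Z ω + W ω) := by
  obtain ⟨h1, c1, b1⟩ := hZ
  obtain ⟨h2, c2, b2⟩ := hW
  exact ⟨h1.add h2, c1 + c2, fun ω => (abs_add_le _ _).trans (add_le_add (b1 ω) (b2 ω))⟩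

lemma IsBdd.mul (hZ : IsBdd m Z) (hW : IsBdd m W) : IsBdd m (fun ω => Z ω * W ω) := by
  obtain ⟨h1, c1, b1⟩ := hZ
  obtain ⟨h2, c2, b2⟩ := hW
  exact ⟨h1.mul h2, c1 * c2, fun ω => by
    rw [abs_mul]
    exact mul_le_mul (b1 ω) (b2 ω) (abs_nonneg _) ((abs_nonneg _).trans (b1 ω))⟩

lemma IsBdd.const_mul (c : ℝ) (hZ : IsBdd m Z) : IsBdd m (fun ω => c * Z ω) :=
  (IsBdd.const c).mul hZ

lemma IsBdd.neg (hZ : IsBdd m Z) : IsBdd m (fun ω => -Z ω) := by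
  simpa using hZ.const_mul (-1)

lemma IsBdd.sub (hZ : IsBdd m Z) (hW : IsBdd m W) : IsBdd m (fun ω => Z ω - W ω) := by
  simpa [sub_eq_add_neg] using hZ.add hW.neg

lemma IsBdd.pow_two (hZ : IsBdd m Z) : IsBdd m (fun ω => Z ω ^ 2) := by
  simpa [sq] using hZ.mul hZ

lemma IsBdd.abs (hZ : IsBdd m Z) : IsBdd m (fun ω => |Z ω|) :=
  ⟨hZ.1.abs, hZ.2.imp fun c hc ω => by rw [abs_abs]; exact hc ω⟩

lemma IsBdd.sum {ι : Type*} (s : Finset ι) {Z : ι → Ω → ℝ} (hZ : ∀ i, IsBdd m (Z i)) :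
    IsBdd m (fun ω => ∑ i ∈ s, Z i ω) := by
  classical
  induction s using Finset.induction_on with
  | empty => simpa using IsBdd.const (m := m) 0
  | insert i s hi ih => simpa [Finset.sum_insert hi] using (hZ i).add ih

lemma IsBdd.integrable [mΩ : MeasurableSpace Ω] {μ : Measure Ω} [IsFiniteMeasure μ]
    (hZ : IsBdd mΩ Z) : Integrable Z μ :=
  let ⟨c, hc⟩ := hZ.2
  Integrable.of_bound hZ.1.aestronglyMeasurable c (Filter.Eventually.of_forall hc)

lemma abs_integral_le_of_abs_le [mΩ : MeasurableSpace Ω] {μ : Measure Ω} [IsProbabilityMeasure μ]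
    {c : ℝ} (h : ∀ ω, |Z ω| ≤ c) : |∫ ω, Z ω ∂μ| ≤ c := by
  have := norm_integral_le_of_norm_le_const (μ := μ) (f := Z) (Filter.Eventually.of_forall h)
  simpa using this

end Bounded

/-! ### The Markov property tested against bounded functions of the past -/

section ControlledChain

variable {Ω X : Type*} [Fintype X]

/-- A Markov chain `Y` with transition kernel `p`, adapted to the filtration `F`, with rewards
`r ∈ [0, 1]` of conditional mean `rbar`. -/
structure ControlledChain [mΩ : MeasurableSpace Ω] (μ : Measure Ω) (p : X → X → ℝ) (rbar : X → ℝ)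
    (F : ℕ → MeasurableSpace Ω) (Y : ℕ → Ω → X) (r : ℕ → Ω → ℝ) : Prop where
  le : ∀ t, F t ≤ mΩ
  mono : ∀ t, F t ≤ F (t + 1)
  measurable_state : ∀ t x, MeasurableSet[F t] {ω | Y t ω = x}
  measurable_reward : ∀ t, Measurable[F (t + 1)] (r t)
  reward_mem : ∀ t ω, r t ω ∈ Set.Icc (0 : ℝ) 1
  reward_mean : ∀ t Z, IsBdd (F t) Z → ∫ ω, r t ω * Z ω ∂μ = ∫ ω, rbar (Y t ω) * Z ω ∂μ
  transition : ∀ t y Z, IsBdd (F t) Z →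
    ∫ ω, hit y (Y (t + 1) ω) * Z ω ∂μ = ∫ ω, p (Y t ω) y * Z ω ∂μ

variable [mΩ : MeasurableSpace Ω] {μ : Measure Ω} [IsProbabilityMeasure μ] {p : X → X → ℝ}
  {rbar : X → ℝ} {F : ℕ → MeasurableSpace Ω} {Y : ℕ → Ω → X} {r : ℕ → Ω → ℝ}

namespace ControlledChain

lemma isBdd_state (C : ControlledChain μ p rbar F Y r) (t : ℕ) (φ : X → ℝ) :
    IsBdd (F t) (fun ω => φ (Y t ω)) := by
  have h1 : ∀ x, IsBdd (F t) (fun ω => hit x (Y t ω)) := by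
    intro x
    refine ⟨?_, 1, fun ω => abs_hit_le _ _⟩
    unfold hit
    exact Measurable.ite (C.measurable_state t x) measurable_const measurable_const
  have h2 := IsBdd.sum Finset.univ fun x => (h1 x).mul (IsBdd.const (m := F t) (φ x))
  simpa only [sum_hit_mul] using h2

/-- Measurability of a function of the state with measurable dependence on a parameter. -/
lemma isBdd_state_param (C : ControlledChain μ p rbar F Y r) (t : ℕ) {Z : X → Ω → ℝ}
    (hZ : ∀ x, IsBdd (F t) (Z x)) : IsBdd (F t) (fun ω => Z (Y t ω) ω) := by
  have h2 := IsBdd.sum Finset.univ fun x => (C.isBdd_state t (hit x)).mul (hZ x)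
  have e : ∀ ω, ∑ x, hit x (Y t ω) * Z x ω = Z (Y t ω) ω := fun ω =>
    sum_hit_mul (fun x => Z x ω) (Y t ω)
  simpa only [e] using h2

lemma isBdd_reward (C : ControlledChain μ p rbar F Y r) (t : ℕ) : IsBdd (F (t + 1)) (r t) :=
  ⟨C.measurable_reward t, 1, fun ω => by
    rw [abs_of_nonneg (C.reward_mem t ω).1]; exact (C.reward_mem t ω).2⟩

/-- The Markov property, for functions of the next state with a past-measurable parameter. -/
lemma integral_next (C : ControlledChain μ p rbar F Y r) (t : ℕ) {Z : X → Ω → ℝ}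
    (hZ : ∀ x, IsBdd (F t) (Z x)) :
    ∫ ω, Z (Y (t + 1) ω) ω ∂μ = ∫ ω, ∑ y, p (Y t ω) y * Z y ω ∂μ := by
  have e : ∀ ω, Z (Y (t + 1) ω) ω = ∑ y, hit y (Y (t + 1) ω) * Z y ω := fun ω =>
    (sum_hit_mul (fun x => Z x ω) _).symm
  simp only [e]
  rw [integral_finsetSum, integral_finsetSum]
  · exact Finset.sum_congr rfl fun y _ => C.transition t y (Z y) (hZ y)
  · intro y _
    exact (((C.isBdd_state t fun x => p x y).mul (hZ y)).mono (C.le t)).integrable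
  · intro y _
    exact (((C.isBdd_state (t + 1) (hit y)).mul ((hZ y).mono (C.mono t))).mono
      (C.le (t + 1))).integrable

end ControlledChain

end ControlledChain

/-! ### The observed trajectory as a controlled chain -/

section Trajectory

variable {S A Ω : Type*} [Fintype S] [MeasurableSpace S] [MeasurableSingletonClass S]
  [Fintype A] [MeasurableSpace A] [MeasurableSingletonClass A]
  [mΩ : MeasurableSpace Ω] {μ : Measure Ω} [IsProbabilityMeasure μ]
  {P : S → A → S → ℝ} {R : S → A → ℝ} {π : S → A → ℝ} {μ0 : S → ℝ}
  {st : ℕ → Ω → S} {act : ℕ → Ω → A} {rw' : ℕ → Ω → ℝ}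

lemma IsTrajectory.history_le (T : IsTrajectory μ P R π μ0 st act rw') (t : ℕ) :
    history st act rw' t ≤ mΩ :=
  sup_le (iSup₂_le fun i _ => sup_le (T.measurable_state i).comap_le (T.measurable_action i).comap_le)
    (iSup₂_le fun i _ => (T.measurable_reward i).comap_le)

lemma history_mono (st : ℕ → Ω → S) (act : ℕ → Ω → A) (rw' : ℕ → Ω → ℝ) (t : ℕ) :
    history st act rw' t ≤ history st act rw' (t + 1) := by
  refine sup_le_sup ?_ ?_
  · exact iSup_mono fun i => iSup_le fun h => le_iSup_of_le (h.trans t.le_succ) le_rfl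
  · exact iSup_mono fun i => iSup_le fun h => le_iSup_of_le (h.trans t.lt_succ_self) le_rfl

/-- Turns conditional expectations into integral identities against bounded functions of the past,
the only form in which the Markov property and the reward means are used afterwards. -/
lemma integral_mul_of_condExp {m : MeasurableSpace Ω} (hm : m ≤ mΩ) {g G Z : Ω → ℝ}
    (hg : Integrable g μ) (h : μ[g | m] =ᵐ[μ] G) (hZ : IsBdd m Z) :
    ∫ ω, g ω * Z ω ∂μ = ∫ ω, G ω * Z ω ∂μ := by
  obtain ⟨hZm, c, hc⟩ := hZ
  have h1 := condExp_stronglyMeasurable_mul_of_bound hm hZm.stronglyMeasurable hg c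
    (Filter.Eventually.of_forall hc)
  rw [show (fun ω => g ω * Z ω) = Z * g by funext ω; simp [mul_comm], ← integral_condExp hm]
  refine integral_congr_ae ?_
  filter_upwards [h1, h] with ω h1 h2
  rw [h1, Pi.mul_apply, h2, mul_comm]

/-- The trajectory of state-action pairs, with the rewards clipped to `[0, 1]`. -/
lemma IsTrajectory.controlledChain (T : IsTrajectory μ P R π μ0 st act rw') :
    ControlledChain μ (chainMatrix P π) (fun x => R x.1 x.2) (history st act rw')
      (fun t ω => (st t ω, act t ω)) (fun t ω => clamp 0 1 (rw' t ω)) where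
  le := T.history_le
  mono := history_mono st act rw'
  measurable_state t x := by
    have h1 : MeasurableSpace.comap (st t) inferInstance ⊔ MeasurableSpace.comap (act t) inferInstance
        ≤ history st act rw' t :=
      le_sup_of_le_left (le_iSup₂_of_le t le_rfl le_rfl)
    have h2 : MeasurableSet[history st act rw' t] (st t ⁻¹' {x.1}) :=
      (le_sup_left.trans h1) _ ⟨_, measurableSet_singleton _, rfl⟩
    have h3 : MeasurableSet[history st act rw' t] (act t ⁻¹' {x.2}) :=
      (le_sup_right.trans h1) _ ⟨_, measurableSet_singleton _, rfl⟩
    convert h2.inter h3 using 1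
    ext ω
    exact Prod.ext_iff
  measurable_reward t := by
    have h1 : MeasurableSpace.comap (rw' t) inferInstance ≤ history st act rw' (t + 1) :=
      le_sup_of_le_right (le_iSup₂_of_le (f := fun i (_ : i < t + 1) =>
        MeasurableSpace.comap (rw' i) inferInstance) t t.lt_succ_self le_rfl)
    have h2 : Measurable[history st act rw' (t + 1)] (rw' t) := measurable_iff_comap_le.2 h1
    exact (measurable_clamp 0 1).comp h2
  reward_mem t ω := clamp_mem zero_le_one _
  reward_mean t Z hZ := by
    have hae : ∀ᵐ ω ∂μ, clamp 0 1 (rw' t ω) = rw' t ω := by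
      filter_upwards [T.reward_mem t] with ω hω using clamp_of_mem hω
    have hint : Integrable (rw' t) μ := by
      refine Integrable.of_bound (T.measurable_reward t).aestronglyMeasurable 1 ?_
      filter_upwards [T.reward_mem t] with ω hω
      rw [Real.norm_of_nonneg hω.1]; exact hω.2
    rw [← integral_mul_of_condExp (T.history_le t) hint (T.reward_mean t) hZ]
    refine integral_congr_ae ?_
    filter_upwards [hae] with ω hω
    rw [hω]
  transition t y Z hZ := by
    have h1 := T.transition t y.1 y.2
    have hset : MeasurableSet {ω | st (t + 1) ω = y.1 ∧ act (t + 1) ω = y.2} :=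
      (T.measurable_state (t + 1) (measurableSet_singleton y.1)).inter
        (T.measurable_action (t + 1) (measurableSet_singleton y.2))
    have h2 := integral_mul_of_condExp (T.history_le t)
      ((integrable_const (1 : ℝ)).indicator hset) h1 hZ
    have e : ∀ ω, Set.indicator {ω | st (t + 1) ω = y.1 ∧ act (t + 1) ω = y.2}
        (fun _ => (1 : ℝ)) ω = hit y (st (t + 1) ω, act (t + 1) ω) := by
      intro ω
      by_cases h : ω ∈ {ω | st (t + 1) ω = y.1 ∧ act (t + 1) ω = y.2}
      · rw [Set.indicator_of_mem h, show (st (t + 1) ω, act (t + 1) ω) = y from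
          Prod.ext (show _ ∧ _ from h).1 (show _ ∧ _ from h).2,
          hit_self]
      · rw [Set.indicator_of_notMem h, hit_of_ne fun h' => h ⟨congrArg Prod.fst h', congrArg Prod.snd h'⟩]
    simp only [e] at h2
    exact h2

end Trajectory

/-! ### The profile `θ_t = (t + p) ^ (-2 / 3)` -/

section StepSizes

/-- The decay profile of the dual step size. -/
def theta (p : ℝ) (t : ℕ) : ℝ := ((t : ℝ) + p) ^ (-(2 / 3) : ℝ)

variable {p : ℝ}

lemma one_le_add_cast (hp : 1 ≤ p) (t : ℕ) : 1 ≤ (t : ℝ) + p := by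
  linarith [show (0 : ℝ) ≤ t from t.cast_nonneg]

lemma theta_pos (hp : 1 ≤ p) (t : ℕ) : 0 < theta p t :=
  Real.rpow_pos_of_pos (by linarith [one_le_add_cast hp t]) _

lemma theta_le_one (hp : 1 ≤ p) (t : ℕ) : theta p t ≤ 1 :=
  Real.rpow_le_one_of_one_le_of_nonpos (one_le_add_cast hp t) (by norm_num)

/-- This relation couples the two time scales: squared steps of `Q` are of order `θ ^ 3`, and so
remain of order `θ ^ 2` after the division by `θ` in Young's inequality. -/
lemma theta_pow_three (hp : 1 ≤ p) (t : ℕ) : theta p t ^ 3 = (1 / ((t : ℝ) + p)) ^ 2 := by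
  have hs : 0 ≤ (t : ℝ) + p := by linarith [one_le_add_cast hp t]
  rw [theta, ← Real.rpow_natCast, ← Real.rpow_mul hs, one_div, inv_pow, ← Real.rpow_natCast,
    ← Real.rpow_neg hs]
  norm_num

lemma one_div_le_theta (hp : 1 ≤ p) (t : ℕ) : 1 / ((t : ℝ) + p) ≤ theta p t := by
  rw [one_div, ← Real.rpow_neg_one]
  exact Real.rpow_le_rpow_of_exponent_le (one_le_add_cast hp t) (by norm_num)

lemma theta_succ_le (hp : 1 ≤ p) (t : ℕ) : theta p (t + 1) ≤ theta p t := by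
  unfold theta
  refine Real.rpow_le_rpow_of_nonpos (by linarith [one_le_add_cast hp t]) ?_ (by norm_num)
  push_cast; linarith

lemma theta_sub_succ_le (hp : 1 ≤ p) (t : ℕ) : theta p t - theta p (t + 1) ≤ theta p t ^ 2 := by
  have h := rpow_neg_sub_le (q := 2 / 3) (one_le_add_cast hp t) (by norm_num) (by norm_num)
  have h1 := one_div_le_theta hp t
  have h2 := theta_pos hp t
  have e : theta p (t + 1) = ((t : ℝ) + p + 1) ^ (-(2 / 3) : ℝ) := by
    unfold theta; push_cast; congr 1; ring
  rw [e]
  refine h.trans ?_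
  have e2 : 2 / 3 * ((t : ℝ) + p) ^ (-(2 / 3) : ℝ) / (t + p)
      = 2 / 3 * theta p t * (1 / ((t : ℝ) + p)) := by unfold theta; ring
  rw [e2]
  nlinarith

end StepSizes

/-! ### Abstract runs of the algorithm: a priori bounds and measurability -/

section Run

variable {S A Ω : Type*} [Fintype S] [Nonempty S] [Fintype A] [Nonempty A]

/-- A run of the two-timescale algorithm along a controlled chain, all of whose parameters are
bounded in terms of `B`.  Here `h` solves the Poisson equation of the chain. -/
structure Run [mΩ : MeasurableSpace Ω] (B γ κ lo hi dmin p q : ℝ) (P : S → A → S → ℝ)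
    (R : S → A → ℝ) (π : S → A → ℝ) (d : S × A → ℝ) (h : S × A → S × A → ℝ) (j g : ℝ → ℝ → ℝ)
    (ηs : S × A → (S → ℝ) → ℝ) (Qstar : S × A → ℝ) (μ : Measure Ω) (F : ℕ → MeasurableSpace Ω)
    (Y : ℕ → Ω → S × A) (r : ℕ → Ω → ℝ) (Q η : ℕ → Ω → S × A → ℝ) : Prop where
  dual : RegularDual γ κ B lo hi P R j g ηs Qstar
  policy : ∀ s, π s ∈ stdSimplex ℝ A
  chain : ControlledChain μ (chainMatrix P π) (fun x => R x.1 x.2) F Y r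
  h_bound : ∀ x y, |h x y| ≤ B
  poisson : ∀ x y, h x y - ∑ z, chainMatrix P π y z * h x z = hit x y - d x
  dmin_pos : 0 < dmin
  dmin_le : ∀ x, dmin ≤ d x
  d_le_one : ∀ x, d x ≤ 1
  one_le_p : 1 ≤ p
  p_le : p ≤ B
  one_le_q : 1 ≤ q
  q_le : q ≤ B
  d_le_q : ∀ x, d x * ((1 - γ) * dmin)⁻¹ ≤ q
  card_le : (Fintype.card (S × A) : ℝ) ≤ B
  inv_kappa_le : (κ * dmin)⁻¹ ≤ B
  inv_gamma_le : ((1 - γ) * dmin)⁻¹ ≤ B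
  q_zero : ∀ ω x, Q 0 ω x = (1 - γ)⁻¹
  dual_zero : ∃ η0 : S × A → ℝ, (∀ x, η0 x ∈ Set.Icc lo hi) ∧ ∀ ω, η 0 ω = η0
  q_succ : ∀ t ω x, Q (t + 1) ω x = Q t ω x + hit x (Y t ω) * (((1 - γ) * dmin)⁻¹ / (t + q) *
    (r t ω + γ * j (η t ω x) (clippedGreedy γ (Q t ω) (Y (t + 1) ω).1) - Q t ω x))
  dual_succ : ∀ t ω x, η (t + 1) ω x = clamp lo hi (η t ω x + hit x (Y t ω) *
    (theta p t * (κ * dmin)⁻¹ * g (η t ω x) (clippedGreedy γ (Q t ω) (Y (t + 1) ω).1)))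

/-- A uniform bound for the `Q`-iterates. -/
def qBound (B : ℝ) : ℝ := (1 + 2 * B) ^ ⌈B⌉₊ * (2 * B)

lemma two_mul_le_qBound {B : ℝ} (hB : 1 ≤ B) : 2 * B ≤ qBound B := by
  unfold qBound
  exact le_mul_of_one_le_left (by linarith) (one_le_pow₀ (by linarith))

namespace Run

variable [mΩ : MeasurableSpace Ω] {B γ κ lo hi dmin p q : ℝ} {P : S → A → S → ℝ}
    {R : S → A → ℝ} {π : S → A → ℝ} {d : S × A → ℝ} {h : S × A → S × A → ℝ} {j g : ℝ → ℝ → ℝ}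
    {ηs : S × A → (S → ℝ) → ℝ} {Qstar : S × A → ℝ} {μ : Measure Ω} [IsProbabilityMeasure μ]
    {F : ℕ → MeasurableSpace Ω}
    {Y : ℕ → Ω → S × A} {r : ℕ → Ω → ℝ} {Q η : ℕ → Ω → S × A → ℝ}

section Bounds

variable (H : Run B γ κ lo hi dmin p q P R π d h j g ηs Qstar μ F Y r Q η)
include H

lemma dual_mem (t : ℕ) (ω : Ω) (x : S × A) : η t ω x ∈ Set.Icc lo hi := by
  cases t with
  | zero =>
    obtain ⟨η0, h0, h1⟩ := H.dual_zero
    rw [h1]; exact h0 x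
  | succ t => rw [H.dual_succ]; exact clamp_mem H.dual.le _

lemma value_mem (t : ℕ) (ω : Ω) : clippedGreedy γ (Q t ω) ∈ valueBox S γ :=
  clippedGreedy_mem H.dual.gamma_lt _

lemma beta_nonneg (t : ℕ) : 0 ≤ ((1 - γ) * dmin)⁻¹ / ((t : ℝ) + q) := by
  have h1 := sub_pos.2 H.dual.gamma_lt
  have h2 := H.dmin_pos
  have h3 := one_le_add_cast H.one_le_q t
  positivity

lemma abs_target_le (t : ℕ) (ω : Ω) (a v : ℝ) : |r t ω + γ * j a v| ≤ 2 * B := by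
  have h1 := H.chain.reward_mem t ω
  have h2 := H.dual.j_bound a v
  have h3 : |γ * j a v| ≤ B := by
    rw [abs_mul, abs_of_nonneg H.dual.gamma_nonneg]
    nlinarith [abs_nonneg (j a v), H.dual.gamma_lt]
  have h4 := abs_add_le (r t ω) (γ * j a v)
  rw [abs_of_nonneg h1.1] at h4
  linarith [h1.2, H.dual.one_le]

/-- The offset `q` ensures `β d x ≤ 1` but not `β ≤ 1`, so an update need not be a convex
combination. Since `β ≤ B / (t + q)`, this can only happen during the first `⌈B⌉₊` steps, each of
which enlarges the bound by a factor of at most `1 + 2 B`. -/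
lemma abs_q_le (t : ℕ) (ω : Ω) (x : S × A) : |Q t ω x| ≤ qBound B := by
  have hB := H.dual.one_le
  have key : ∀ t x, |Q t ω x| ≤ (1 + 2 * B) ^ min t ⌈B⌉₊ * (2 * B) := by
    intro t
    induction t with
    | zero =>
      intro x
      rw [H.q_zero, abs_of_nonneg (inv_nonneg.2 (sub_nonneg.2 H.dual.gamma_lt.le))]
      simp only [zero_le, inf_of_le_left, pow_zero, one_mul]
      linarith [H.dual.vmax_le]
    | succ t ih =>
      intro x
      set a : ℝ := (1 + 2 * B) ^ min t ⌈B⌉₊ * (2 * B)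
      have ha : 2 * B ≤ a := le_mul_of_one_le_left (by linarith) (one_le_pow₀ (by linarith))
      have hmono : a ≤ (1 + 2 * B) ^ min (t + 1) ⌈B⌉₊ * (2 * B) := by
        refine mul_le_mul_of_nonneg_right (pow_le_pow_right₀ (by linarith) ?_) (by linarith)
        exact min_le_min_right _ t.le_succ
      by_cases hx : Y t ω = x
      · rw [H.q_succ, hx, hit_self, one_mul]
        set β := ((1 - γ) * dmin)⁻¹ / ((t : ℝ) + q)
        have hβ0 : 0 ≤ β := H.beta_nonneg t
        have hs := one_le_add_cast H.one_le_q t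
        have hβB : β ≤ B / ((t : ℝ) + q) :=
          div_le_div_of_nonneg_right H.inv_gamma_le (by linarith)
        have h1 := H.abs_target_le t ω (η t ω x) (clippedGreedy γ (Q t ω) (Y (t + 1) ω).1)
        set y := r t ω + γ * j (η t ω x) (clippedGreedy γ (Q t ω) (Y (t + 1) ω).1)
        have h2 : |Q t ω x + β * (y - Q t ω x)| ≤ |1 - β| * a + β * (2 * B) := by
          have e : Q t ω x + β * (y - Q t ω x) = (1 - β) * Q t ω x + β * y := by ring
          rw [e]
          refine (abs_add_le _ _).trans ?_
          rw [abs_mul, abs_mul, abs_of_nonneg hβ0]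
          gcongr
          exact ih x
        refine h2.trans ?_
        -- Early steps pay one more factor; from `⌈B⌉₊` on, the update is a convex combination and
        -- the bound is preserved.
        rcases lt_or_ge t ⌈B⌉₊ with ht | ht
        · have hβ1 : β ≤ B := hβB.trans (div_le_self (by linarith) hs)
          have h3 : |1 - β| ≤ 1 + β := by rw [abs_le]; constructor <;> linarith
          have e : (1 + 2 * B) ^ min (t + 1) ⌈B⌉₊ * (2 * B) = (1 + 2 * B) * a := by
            rw [min_eq_left (Nat.succ_le_of_lt ht)]
            simp only [a, min_eq_left ht.le, pow_succ]
            ring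
          rw [e]
          nlinarith
        · have hβ1 : β ≤ 1 := by
            refine hβB.trans ((div_le_one (by linarith)).2 ?_)
            have := (Nat.le_ceil B).trans (Nat.cast_le.2 ht)
            linarith [H.one_le_q]
          rw [abs_of_nonneg (by linarith)]
          nlinarith
      · rw [H.q_succ, hit_of_ne hx, zero_mul, add_zero]
        exact (ih x).trans hmono
  refine (key t x).trans ?_
  unfold qBound
  exact mul_le_mul_of_nonneg_right (pow_le_pow_right₀ (by linarith) (min_le_right _ _))
    (by linarith)

lemma two_le_qBound : 2 ≤ qBound B := by
  linarith [two_mul_le_qBound H.dual.one_le, H.dual.one_le]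

lemma le_qBound : B ≤ qBound B := by
  linarith [two_mul_le_qBound H.dual.one_le, H.dual.one_le]

lemma alpha_nonneg (t : ℕ) : 0 ≤ theta p t * (κ * dmin)⁻¹ := by
  have h2 := H.dmin_pos
  have h3 := theta_pos H.one_le_p t
  have h4 := H.dual.kappa_pos
  positivity

lemma alpha_le (t : ℕ) : theta p t * (κ * dmin)⁻¹ ≤ qBound B * theta p t := by
  rw [mul_comm]
  exact mul_le_mul_of_nonneg_right (H.inv_kappa_le.trans H.le_qBound) (theta_pos H.one_le_p t).le

lemma beta_le_div (t : ℕ) :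
    ((1 - γ) * dmin)⁻¹ / ((t : ℝ) + q) ≤ qBound B ^ 2 * (1 / ((t : ℝ) + p)) := by
  have hB := H.dual.one_le
  have hs := one_le_add_cast H.one_le_q t
  have hs' := one_le_add_cast H.one_le_p t
  have hE := H.le_qBound
  have h1 : 1 / ((t : ℝ) + q) ≤ qBound B * (1 / ((t : ℝ) + p)) := by
    rw [mul_one_div, div_le_div_iff₀ (by linarith) (by linarith), one_mul]
    have ht : (0 : ℝ) ≤ t := t.cast_nonneg
    nlinarith [H.one_le_q, H.one_le_p, H.p_le]
  rw [div_eq_mul_one_div, sq, mul_assoc]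
  refine mul_le_mul (H.inv_gamma_le.trans hE) h1 (by positivity) (by linarith)

lemma beta_le (t : ℕ) :
    ((1 - γ) * dmin)⁻¹ / ((t : ℝ) + q) ≤ qBound B ^ 2 * theta p t :=
  (H.beta_le_div t).trans
    (mul_le_mul_of_nonneg_left (one_div_le_theta H.one_le_p t) (sq_nonneg _))

lemma beta_sq_le (t : ℕ) :
    (((1 - γ) * dmin)⁻¹ / ((t : ℝ) + q)) ^ 2 ≤ qBound B ^ 4 * theta p t ^ 3 := by
  rw [theta_pow_three H.one_le_p t, show qBound B ^ 4 = (qBound B ^ 2) ^ 2 by ring, ← mul_pow]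
  exact pow_le_pow_left₀ (H.beta_nonneg t) (H.beta_le_div t) 2

lemma norm_q_step_le (t : ℕ) (ω : Ω) :
    ‖Q (t + 1) ω - Q t ω‖ ≤ 2 * qBound B * (((1 - γ) * dmin)⁻¹ / ((t : ℝ) + q)) := by
  have hβ0 := H.beta_nonneg t
  have hE := H.two_le_qBound
  refine (pi_norm_le_iff_of_nonneg (by positivity)).2 fun x => ?_
  rw [Pi.sub_apply, H.q_succ, add_sub_cancel_left, norm_mul, norm_mul, Real.norm_eq_abs,
    Real.norm_of_nonneg hβ0, Real.norm_eq_abs]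
  have h1 := H.abs_target_le t ω (η t ω x) (clippedGreedy γ (Q t ω) (Y (t + 1) ω).1)
  have h2 := abs_sub (r t ω + γ * j (η t ω x) (clippedGreedy γ (Q t ω) (Y (t + 1) ω).1)) (Q t ω x)
  have h3 := H.abs_q_le t ω x
  have h4 := two_mul_le_qBound H.dual.one_le
  have h5 := abs_hit_le x (Y t ω)
  calc _ ≤ 1 * (((1 - γ) * dmin)⁻¹ / ((t : ℝ) + q) * (2 * qBound B)) := by
        gcongr
        linarith
    _ = _ := by ring

lemma norm_value_step_le (t : ℕ) (ω : Ω) :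
    ‖clippedGreedy γ (Q (t + 1) ω) - clippedGreedy γ (Q t ω)‖
      ≤ 2 * qBound B * (((1 - γ) * dmin)⁻¹ / ((t : ℝ) + q)) :=
  (norm_clippedGreedy_sub_le _ _ _).trans (H.norm_q_step_le t ω)

lemma norm_value_step_le_theta (t : ℕ) (ω : Ω) :
    ‖clippedGreedy γ (Q (t + 1) ω) - clippedGreedy γ (Q t ω)‖ ≤ 2 * qBound B ^ 3 * theta p t := by
  refine (H.norm_value_step_le t ω).trans ?_
  have h1 := mul_le_mul_of_nonneg_left (H.beta_le t)
    (show 0 ≤ 2 * qBound B by linarith [H.two_le_qBound])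
  refine h1.trans_eq (by ring)

lemma abs_dual_step_le (t : ℕ) (ω : Ω) (x : S × A) :
    |η (t + 1) ω x - η t ω x| ≤ qBound B ^ 2 * theta p t := by
  have h0 := clamp_of_mem (H.dual_mem t ω x)
  have hα := H.alpha_nonneg t
  have hE := H.two_le_qBound
  have h3 := abs_clamp_sub_clamp_le lo hi (η t ω x + hit x (Y t ω) *
    (theta p t * (κ * dmin)⁻¹ * g (η t ω x) (clippedGreedy γ (Q t ω) (Y (t + 1) ω).1))) (η t ω x)
  rw [h0, ← H.dual_succ] at h3
  refine h3.trans ?_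
  rw [add_sub_cancel_left, abs_mul, abs_mul, abs_of_nonneg hα]
  have h1 := abs_hit_le x (Y t ω)
  have h2 := (H.dual.g_bound (η t ω x) (clippedGreedy γ (Q t ω) (Y (t + 1) ω).1)).trans H.le_qBound
  calc _ ≤ 1 * (qBound B * theta p t * qBound B) := by
        exact mul_le_mul h1 (mul_le_mul (H.alpha_le t) h2 (abs_nonneg _)
          (mul_nonneg (by linarith) (theta_pos H.one_le_p t).le))
          (mul_nonneg hα (abs_nonneg _)) zero_le_one
    _ = _ := by ring

end Bounds

section Measurability

variable (H : Run B γ κ lo hi dmin p q P R π d h j g ηs Qstar μ F Y r Q η)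
include H

omit [Fintype S] [Nonempty S] [Fintype A] [Nonempty A] mΩ [IsProbabilityMeasure μ] H in
lemma continuous_of_lipschitz_pair {j : ℝ → ℝ → ℝ} {B : ℝ} (hB : 0 ≤ B)
    (hj : ∀ η v η' v', |j η v - j η' v'| ≤ B * (|η - η'| + |v - v'|)) :
    Continuous fun z : ℝ × ℝ => j z.1 z.2 := by
  have : LipschitzWith (2 * B).toNNReal fun z : ℝ × ℝ => j z.1 z.2 := by
    refine LipschitzWith.of_dist_le_mul fun z w => ?_
    rw [Real.coe_toNNReal _ (by linarith), Real.dist_eq]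
    refine (hj _ _ _ _).trans ?_
    have h1 : |z.1 - w.1| ≤ dist z w := by rw [← Real.dist_eq]; exact le_max_left _ _
    have h2 : |z.2 - w.2| ≤ dist z w := by rw [← Real.dist_eq]; exact le_max_right _ _
    nlinarith
  exact this.continuous

/-- The maximizers were chosen without regard to measurability; the Lipschitz estimate restores it,
as needed to integrate the tracking error. -/
lemma continuous_maximizer (x : S × A) :
    Continuous fun Q : S × A → ℝ => ηs x (clippedGreedy γ Q) := by
  have hB : 0 ≤ B := by linarith [H.dual.one_le]
  have : LipschitzWith B.toNNReal fun Q : S × A → ℝ => ηs x (clippedGreedy γ Q) := by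
    refine LipschitzWith.of_dist_le_mul fun Q Q' => ?_
    rw [Real.coe_toNNReal _ hB, Real.dist_eq, dist_eq_norm]
    exact (H.dual.max_lip x _ (clippedGreedy_mem H.dual.gamma_lt _) _
      (clippedGreedy_mem H.dual.gamma_lt _)).trans
      (mul_le_mul_of_nonneg_left (norm_clippedGreedy_sub_le _ _ _) hB)
  exact this.continuous

omit [Nonempty S] mΩ [IsProbabilityMeasure μ] H in
lemma continuous_clippedGreedy (γ : ℝ) (s : S) :
    Continuous fun Q : S × A → ℝ => clippedGreedy γ Q s := by
  have : LipschitzWith 1 fun Q : S × A → ℝ => clippedGreedy γ Q s := by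
    refine LipschitzWith.of_dist_le_mul fun Q Q' => ?_
    rw [NNReal.coe_one, one_mul, Real.dist_eq, dist_eq_norm]
    exact (norm_le_pi_norm (clippedGreedy γ Q - clippedGreedy γ Q') s).trans
      (norm_clippedGreedy_sub_le _ _ _)
  exact this.continuous

lemma measurable_value (t : ℕ) (hQ : ∀ x, Measurable[F t] (fun ω => Q t ω x)) (s : S) :
    Measurable[F t] fun ω => clippedGreedy γ (Q t ω) s :=
  (continuous_clippedGreedy γ s).measurable.comp (@measurable_pi_iff _ _ _ (F t) _ _ |>.2 hQ)

lemma isBdd_comp {φ : ℝ → ℝ → ℝ} (hb : ∀ a v, |φ a v| ≤ B)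
    (hl : ∀ η v η' v', |φ η v - φ η' v'| ≤ B * (|η - η'| + |v - v'|)) (t : ℕ)
    (hQ : ∀ x, Measurable[F t] (fun ω => Q t ω x)) (x : S × A)
    (hη : Measurable[F t] (fun ω => η t ω x)) (s : S) :
    IsBdd (F t) fun ω => φ (η t ω x) (clippedGreedy γ (Q t ω) s) :=
  ⟨(continuous_of_lipschitz_pair (by linarith [H.dual.one_le]) hl).measurable.comp
    (hη.prodMk (H.measurable_value t hQ s)), B, fun _ => hb _ _⟩

lemma isBdd_next {φ : ℝ → ℝ → ℝ} (hb : ∀ a v, |φ a v| ≤ B)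
    (hl : ∀ η v η' v', |φ η v - φ η' v'| ≤ B * (|η - η'| + |v - v'|)) (t : ℕ)
    (hQ : ∀ x, Measurable[F t] (fun ω => Q t ω x)) (x : S × A)
    (hη : Measurable[F t] (fun ω => η t ω x)) :
    IsBdd (F (t + 1)) fun ω => φ (η t ω x) (clippedGreedy γ (Q t ω) (Y (t + 1) ω).1) :=
  H.chain.isBdd_state_param (t + 1)
    (Z := fun y ω => φ (η t ω x) (clippedGreedy γ (Q t ω) y.1))
    fun y => (H.isBdd_comp hb hl t hQ x hη y.1).mono (H.chain.mono t)

lemma measurable_iterates (t : ℕ) :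
    (∀ x, Measurable[F t] (fun ω => Q t ω x)) ∧ ∀ x, Measurable[F t] (fun ω => η t ω x) := by
  induction t with
  | zero =>
    obtain ⟨η0, -, h1⟩ := H.dual_zero
    refine ⟨fun x => ?_, fun x => ?_⟩
    · simp only [H.q_zero]; exact measurable_const
    · simp only [h1]; exact measurable_const
  | succ t ih =>
    obtain ⟨hQ, hη⟩ := ih
    have hm := H.chain.mono t
    have hhit : ∀ x, Measurable[F (t + 1)] fun ω => hit x (Y t ω) := fun x =>
      ((H.chain.isBdd_state t (hit x)).mono hm).1
    refine ⟨fun x => ?_, fun x => ?_⟩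
    · have hj := (H.isBdd_next H.dual.j_bound H.dual.j_lip t hQ x (hη x)).1
      have hQ' := (hQ x).mono hm le_rfl
      simp only [H.q_succ]
      exact hQ'.add ((hhit x).mul (measurable_const.mul
        (((H.chain.measurable_reward t).add (measurable_const.mul hj)).sub hQ')))
    · have hg := (H.isBdd_next H.dual.g_bound H.dual.g_lip t hQ x (hη x)).1
      have hη' := (hη x).mono hm le_rfl
      simp only [H.dual_succ]
      exact (measurable_clamp lo hi).comp (hη'.add ((hhit x).mul (measurable_const.mul hg)))

lemma isBdd_q (t : ℕ) (x : S × A) : IsBdd (F t) (fun ω => Q t ω x) :=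
  ⟨(H.measurable_iterates t).1 x, qBound B, fun ω => H.abs_q_le t ω x⟩

lemma isBdd_j (t : ℕ) (x : S × A) (s : S) :
    IsBdd (F t) fun ω => j (η t ω x) (clippedGreedy γ (Q t ω) s) :=
  H.isBdd_comp H.dual.j_bound H.dual.j_lip t (H.measurable_iterates t).1 x
    ((H.measurable_iterates t).2 x) s

lemma isBdd_g (t : ℕ) (x : S × A) (s : S) :
    IsBdd (F t) fun ω => g (η t ω x) (clippedGreedy γ (Q t ω) s) :=
  H.isBdd_comp H.dual.g_bound H.dual.g_lip t (H.measurable_iterates t).1 x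
    ((H.measurable_iterates t).2 x) s

lemma abs_gap_le (t : ℕ) (ω : Ω) (x : S × A) :
    |η t ω x - ηs x (clippedGreedy γ (Q t ω))| ≤ qBound B := by
  have h1 := H.dual_mem t ω x
  have h2 := H.dual.max_mem x _ (H.value_mem t ω)
  have h3 := H.dual.diam_le
  have h4 := H.le_qBound
  rw [abs_le]
  constructor <;> linarith [h1.1, h1.2, h2.1, h2.2]

lemma isBdd_gap (t : ℕ) (x : S × A) :
    IsBdd (F t) fun ω => η t ω x - ηs x (clippedGreedy γ (Q t ω)) :=
  ⟨((H.measurable_iterates t).2 x).sub ((H.continuous_maximizer x).measurable.comp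
    (@measurable_pi_iff _ _ _ (F t) _ _ |>.2 (H.measurable_iterates t).1)), qBound B, fun ω => H.abs_gap_le t ω x⟩

end Measurability

end Run

end Run

/-! ### Averaging over visits, and tracking of the moving dual maximizer -/

section Run

variable {S A Ω : Type*} [Fintype S] [Nonempty S] [Fintype A] [Nonempty A]

namespace Run

variable [mΩ : MeasurableSpace Ω] {B γ κ lo hi dmin p q : ℝ} {P : S → A → S → ℝ}
    {R : S → A → ℝ} {π : S → A → ℝ} {d : S × A → ℝ} {h : S × A → S × A → ℝ} {j g : ℝ → ℝ → ℝ}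
    {ηs : S × A → (S → ℝ) → ℝ} {Qstar : S × A → ℝ} {μ : Measure Ω} [IsProbabilityMeasure μ]
    {F : ℕ → MeasurableSpace Ω}
    {Y : ℕ → Ω → S × A} {r : ℕ → Ω → ℝ} {Q η : ℕ → Ω → S × A → ℝ}

section Markov

variable (H : Run B γ κ lo hi dmin p q P R π d h j g ηs Qstar μ F Y r Q η)
include H

/-- Averaging against the occupation of `x` is, up to a telescoping term, averaging against the
stationary distribution. -/
lemma integral_hit_mul (t : ℕ) (x : S × A) {Z Z' : Ω → ℝ} (hZ : IsBdd (F t) Z)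
    (hZ' : IsBdd (F (t + 1)) Z') {c : ℝ} (hc : ∀ ω, |Z' ω - Z ω| ≤ c) :
    |∫ ω, hit x (Y t ω) * Z ω ∂μ - (d x * ∫ ω, Z ω ∂μ + ∫ ω, h x (Y t ω) * Z ω ∂μ
      - ∫ ω, h x (Y (t + 1) ω) * Z' ω ∂μ)| ≤ B * c := by
  have i1 : Integrable Z μ := (hZ.mono (H.chain.le t)).integrable
  have i2 : Integrable (fun ω => h x (Y t ω) * Z ω) μ :=
    (((H.chain.isBdd_state t (h x)).mul hZ).mono (H.chain.le t)).integrable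
  have b3 := (H.chain.isBdd_state (t + 1) (h x)).mul (hZ.mono (H.chain.mono t))
  have i3 : Integrable (fun ω => h x (Y (t + 1) ω) * Z ω) μ :=
    (b3.mono (H.chain.le (t + 1))).integrable
  have b4 := (H.chain.isBdd_state (t + 1) (h x)).mul hZ'
  have i4 : Integrable (fun ω => h x (Y (t + 1) ω) * Z' ω) μ :=
    (b4.mono (H.chain.le (t + 1))).integrable
  have i5 : Integrable (fun ω => (∑ z, chainMatrix P π (Y t ω) z * h x z) * Z ω) μ :=
    (((H.chain.isBdd_state t (fun y => ∑ z, chainMatrix P π y z * h x z)).mul hZ).mono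
      (H.chain.le t)).integrable
  have h1 : ∫ ω, h x (Y (t + 1) ω) * Z ω ∂μ
      = ∫ ω, (∑ z, chainMatrix P π (Y t ω) z * h x z) * Z ω ∂μ := by
    rw [H.chain.integral_next t (Z := fun y ω => h x y * Z ω) fun y => hZ.const_mul (h x y)]
    simp only [Finset.sum_mul, mul_assoc]
  -- The Poisson equation, with the kernel average of `h` then traded for `h` at the next state. The
  -- identity is exact as long as `Z` is kept; replacing it by `Z'`, so that the last two terms
  -- telescope in `t`, is the only source of error.
  have h2 : ∫ ω, hit x (Y t ω) * Z ω ∂μ = d x * ∫ ω, Z ω ∂μ + ∫ ω, h x (Y t ω) * Z ω ∂μ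
      - ∫ ω, (∑ z, chainMatrix P π (Y t ω) z * h x z) * Z ω ∂μ := by
    have e : ∫ ω, hit x (Y t ω) * Z ω ∂μ = ∫ ω, ((d x * Z ω + h x (Y t ω) * Z ω)
        - (∑ z, chainMatrix P π (Y t ω) z * h x z) * Z ω) ∂μ := by
      refine integral_congr_ae (Filter.Eventually.of_forall fun ω => ?_)
      have := H.poisson x (Y t ω)
      beta_reduce
      rw [show hit x (Y t ω) = d x + h x (Y t ω) - ∑ z, chainMatrix P π (Y t ω) z * h x z by
        linarith]
      ring
    have i6 : Integrable (fun ω => d x * Z ω + h x (Y t ω) * Z ω) μ := (i1.const_mul _).add i2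
    rw [e, integral_sub i6 i5, integral_add (i1.const_mul _) i2,
      integral_const_mul]
  have e : ∫ ω, hit x (Y t ω) * Z ω ∂μ - (d x * ∫ ω, Z ω ∂μ + ∫ ω, h x (Y t ω) * Z ω ∂μ
      - ∫ ω, h x (Y (t + 1) ω) * Z' ω ∂μ)
      = ∫ ω, (h x (Y (t + 1) ω) * Z' ω - h x (Y (t + 1) ω) * Z ω) ∂μ := by
    rw [h2, ← h1, integral_sub i4 i3]; ring
  rw [e]
  refine abs_integral_le_of_abs_le fun ω => ?_
  rw [← mul_sub, abs_mul]
  exact mul_le_mul (H.h_bound _ _) (hc ω) (abs_nonneg _) (by linarith [H.dual.one_le])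

/-- On the event `Y t = x` the next state has law `P x.1 x.2`, so the sampled quantity may be
averaged over it while the factors depending on the past stay fixed. -/
lemma integral_hit_next (t : ℕ) (x : S × A) {φ : S → Ω → ℝ} (hφ : ∀ s, IsBdd (F t) (φ s)) :
    ∫ ω, hit x (Y t ω) * φ (Y (t + 1) ω).1 ω ∂μ
      = ∫ ω, hit x (Y t ω) * ∑ s', P x.1 x.2 s' * φ s' ω ∂μ := by
  rw [H.chain.integral_next t (Z := fun y ω => hit x (Y t ω) * φ y.1 ω) fun y =>
    (H.chain.isBdd_state t (hit x)).mul (hφ y.1)]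
  refine integral_congr_ae (Filter.Eventually.of_forall fun ω => ?_)
  simp only [mul_left_comm _ (hit x (Y t ω)), ← Finset.mul_sum]
  by_cases hx : Y t ω = x
  · rw [hx, chainMatrix_sum_fst H.policy x (fun s => φ s ω)]
  · rw [hit_of_ne hx, zero_mul, zero_mul]

end Markov

section Tracking

/-- The distance of the dual variable from the current maximizer. -/
def gap (γ : ℝ) (ηs : S × A → (S → ℝ) → ℝ) (Q η : ℕ → Ω → S × A → ℝ) (x : S × A) (t : ℕ) (ω : Ω) :
    ℝ := η t ω x - ηs x (clippedGreedy γ (Q t ω))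

/-- The mean gradient along the run. -/
def grad (γ : ℝ) (P : S → A → S → ℝ) (g : ℝ → ℝ → ℝ) (Q η : ℕ → Ω → S × A → ℝ) (x : S × A)
    (t : ℕ) (ω : Ω) : ℝ := ∑ s', P x.1 x.2 s' * g (η t ω x) (clippedGreedy γ (Q t ω) s')

variable (H : Run B γ κ lo hi dmin p q P R π d h j g ηs Qstar μ F Y r Q η)
include H

lemma isBdd_grad (t : ℕ) (x : S × A) : IsBdd (F t) (grad γ P g Q η x t) :=
  IsBdd.sum _ fun s' => (H.isBdd_g t x s').const_mul _

lemma abs_average_le (x : S × A) {c : ℝ} {φ : S → ℝ} (hφ : ∀ s, |φ s| ≤ c) :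
    |∑ s', P x.1 x.2 s' * φ s'| ≤ c := by
  have := abs_average_sub_le (H.dual.kernel x.1 x.2) (u := φ) (w := fun _ => 0) (c := c)
    (fun s => by simpa using hφ s)
  simpa using this

lemma abs_grad_le (t : ℕ) (ω : Ω) (x : S × A) : |grad γ P g Q η x t ω| ≤ qBound B :=
  H.abs_average_le x fun _ => (H.dual.g_bound _ _).trans H.le_qBound

lemma abs_average_step_le {φ : ℝ → ℝ → ℝ}
    (hl : ∀ η v η' v', |φ η v - φ η' v'| ≤ B * (|η - η'| + |v - v'|)) (t : ℕ) (ω : Ω)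
    (x : S × A) :
    |∑ s', P x.1 x.2 s' * φ (η (t + 1) ω x) (clippedGreedy γ (Q (t + 1) ω) s')
      - ∑ s', P x.1 x.2 s' * φ (η t ω x) (clippedGreedy γ (Q t ω) s')|
      ≤ 3 * qBound B ^ 4 * theta p t := by
  have hE := H.two_le_qBound
  have hθ := theta_pos H.one_le_p t
  refine abs_average_sub_le (H.dual.kernel _ _) fun s => (hl _ _ _ _).trans ?_
  have h1 := H.abs_dual_step_le t ω x
  have h2 : |clippedGreedy γ (Q (t + 1) ω) s - clippedGreedy γ (Q t ω) s|
      ≤ 2 * qBound B ^ 3 * theta p t :=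
    (norm_le_pi_norm (clippedGreedy γ (Q (t + 1) ω) - clippedGreedy γ (Q t ω)) s).trans
      (H.norm_value_step_le_theta t ω)
  calc _ ≤ qBound B * (qBound B ^ 2 * theta p t + 2 * qBound B ^ 3 * theta p t) :=
        mul_le_mul H.le_qBound (add_le_add h1 h2) (by positivity) (by linarith)
    _ ≤ qBound B * (qBound B ^ 3 * theta p t + 2 * qBound B ^ 3 * theta p t) := by
        gcongr <;> linarith
    _ = _ := by ring

lemma abs_grad_step_le (t : ℕ) (ω : Ω) (x : S × A) :
    |grad γ P g Q η x (t + 1) ω - grad γ P g Q η x t ω| ≤ 3 * qBound B ^ 4 * theta p t :=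
  H.abs_average_step_le H.dual.g_lip t ω x

lemma abs_gap_step_le (t : ℕ) (ω : Ω) (x : S × A) :
    |gap γ ηs Q η x (t + 1) ω - gap γ ηs Q η x t ω| ≤ 3 * qBound B ^ 4 * theta p t := by
  have hE := H.two_le_qBound
  have hθ := theta_pos H.one_le_p t
  have h1 := H.abs_dual_step_le t ω x
  have h2 := H.dual.max_lip x _ (H.value_mem (t + 1) ω) _ (H.value_mem t ω)
  have h3 : B * ‖clippedGreedy γ (Q (t + 1) ω) - clippedGreedy γ (Q t ω)‖
      ≤ qBound B * (2 * qBound B ^ 3 * theta p t) :=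
    mul_le_mul H.le_qBound (H.norm_value_step_le_theta t ω) (norm_nonneg _) (by linarith)
  have h4 := abs_sub (η (t + 1) ω x - η t ω x)
    (ηs x (clippedGreedy γ (Q (t + 1) ω)) - ηs x (clippedGreedy γ (Q t ω)))
  have e : gap γ ηs Q η x (t + 1) ω - gap γ ηs Q η x t ω = (η (t + 1) ω x - η t ω x)
    - (ηs x (clippedGreedy γ (Q (t + 1) ω)) - ηs x (clippedGreedy γ (Q t ω))) := by
    unfold gap; ring
  rw [e]
  have h5 : qBound B ^ 2 * theta p t ≤ qBound B ^ 4 * theta p t := by gcongr <;> linarith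
  have h6 : qBound B * (2 * qBound B ^ 3 * theta p t) = 2 * qBound B ^ 4 * theta p t := by ring
  linarith

lemma abs_grad_mul_gap_step_le (t : ℕ) (ω : Ω) (x : S × A) :
    |grad γ P g Q η x (t + 1) ω * gap γ ηs Q η x (t + 1) ω
      - grad γ P g Q η x t ω * gap γ ηs Q η x t ω| ≤ 6 * qBound B ^ 5 * theta p t := by
  have hE := H.two_le_qBound
  have hθ := theta_pos H.one_le_p t
  have h1 := H.abs_grad_step_le t ω x
  have h2 := H.abs_gap_step_le t ω x
  have h3 := H.abs_grad_le (t + 1) ω x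
  have h4 : |gap γ ηs Q η x t ω| ≤ qBound B := H.abs_gap_le t ω x
  set G' := grad γ P g Q η x (t + 1) ω
  set G := grad γ P g Q η x t ω
  set y' := gap γ ηs Q η x (t + 1) ω
  set y := gap γ ηs Q η x t ω
  have e : G' * y' - G * y = G' * (y' - y) + (G' - G) * y := by ring
  rw [e]
  refine (abs_add_le _ _).trans ?_
  rw [abs_mul, abs_mul]
  have h5 := mul_le_mul h3 h2 (abs_nonneg _) (by linarith)
  have h6 := mul_le_mul h1 h4 (abs_nonneg _) (by positivity)
  have e1 : qBound B * (3 * qBound B ^ 4 * theta p t) = 3 * qBound B ^ 5 * theta p t := by ring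
  have e2 : 3 * qBound B ^ 4 * theta p t * qBound B = 3 * qBound B ^ 5 * theta p t := by ring
  linarith

/-- One step of the squared tracking error, before averaging. -/
lemma gap_succ_sq_le (t : ℕ) (ω : Ω) (x : S × A) :
    gap γ ηs Q η x (t + 1) ω ^ 2 ≤ (1 + theta p t) * (gap γ ηs Q η x t ω ^ 2
      + 2 * (theta p t * (κ * dmin)⁻¹) * (hit x (Y t ω) *
        (g (η t ω x) (clippedGreedy γ (Q t ω) (Y (t + 1) ω).1) * gap γ ηs Q η x t ω)))
      + 10 * qBound B ^ 8 * theta p t ^ 2 := by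
  have hE := H.two_le_qBound
  have hθ := theta_pos H.one_le_p t
  have hθ1 := theta_le_one H.one_le_p t
  set θ := theta p t
  set E := qBound B
  have hα := H.alpha_nonneg t
  have hαE := H.alpha_le t
  set α := theta p t * (κ * dmin)⁻¹
  set gt := g (η t ω x) (clippedGreedy γ (Q t ω) (Y (t + 1) ω).1)
  have hg : |gt| ≤ E := (H.dual.g_bound _ _).trans H.le_qBound
  set m := ηs x (clippedGreedy γ (Q t ω))
  set m' := ηs x (clippedGreedy γ (Q (t + 1) ω))
  set k := hit x (Y t ω)
  have hk0 : 0 ≤ k := hit_nonneg _ _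
  have hk1 : k ≤ 1 := hit_le_one _ _
  have hm := H.dual.max_mem x _ (H.value_mem t ω)
  -- The old maximizer lies in the region, so the projection does not increase the distance to it.
  have h1 : |η (t + 1) ω x - m| ≤ |gap γ ηs Q η x t ω + k * (α * gt)| := by
    have := abs_clamp_sub_clamp_le lo hi (η t ω x + k * (α * gt)) m
    rw [clamp_of_mem hm, ← H.dual_succ] at this
    rw [show gap γ ηs Q η x t ω + k * (α * gt) = η t ω x + k * (α * gt) - m by unfold gap; ring]
    exact this
  set y := gap γ ηs Q η x t ω
  set a := η (t + 1) ω x - m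
  have h2 : a ^ 2 ≤ y ^ 2 + 2 * α * (k * (gt * y)) + E ^ 4 * θ ^ 2 := by
    have h3 : a ^ 2 ≤ (y + k * (α * gt)) ^ 2 := sq_le_sq.2 h1
    have h4 : (k * (α * gt)) ^ 2 ≤ E ^ 4 * θ ^ 2 := by
      have h5 : |k * (α * gt)| ≤ 1 * (E * θ * E) := by
        rw [abs_mul, abs_mul, abs_of_nonneg hk0, abs_of_nonneg hα]
        exact mul_le_mul hk1 (mul_le_mul hαE hg (abs_nonneg _) (by positivity))
          (mul_nonneg hα (abs_nonneg _)) zero_le_one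
      calc (k * (α * gt)) ^ 2 = |k * (α * gt)| ^ 2 := (sq_abs _).symm
        _ ≤ (1 * (E * θ * E)) ^ 2 := pow_le_pow_left₀ (abs_nonneg _) h5 2
        _ = _ := by ring
    nlinarith
  have h6 : (m' - m) ^ 2 ≤ 4 * E ^ 8 * θ ^ 3 := by
    have h7 := H.dual.max_lip x _ (H.value_mem (t + 1) ω) _ (H.value_mem t ω)
    have h8 : |m' - m| ≤ E * (2 * E * (((1 - γ) * dmin)⁻¹ / ((t : ℝ) + q))) :=
      h7.trans (mul_le_mul H.le_qBound (H.norm_value_step_le t ω) (norm_nonneg _) (by linarith))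
    calc (m' - m) ^ 2 = |m' - m| ^ 2 := (sq_abs _).symm
      _ ≤ (E * (2 * E * (((1 - γ) * dmin)⁻¹ / ((t : ℝ) + q)))) ^ 2 :=
          pow_le_pow_left₀ (abs_nonneg _) h8 2
      _ = 4 * E ^ 4 * (((1 - γ) * dmin)⁻¹ / ((t : ℝ) + q)) ^ 2 := by ring
      _ ≤ 4 * E ^ 4 * (E ^ 4 * θ ^ 3) := by gcongr; exact H.beta_sq_le t
      _ = _ := by ring
  have h9 : gap γ ηs Q η x (t + 1) ω = a - (m' - m) := by
    simp only [gap, a, m, m']; ring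
  rw [h9]
  -- The weight `θ` balances both sides: the factor `1 + θ` costs half of the contraction gained
  -- later, and the squared drift of the maximizer, of order `θ ^ 3`, is divided by `θ` only.
  have young : (a - (m' - m)) ^ 2 ≤ (1 + θ) * a ^ 2 + (1 + 1 / θ) * (m' - m) ^ 2 := by
    have : 0 ≤ (θ * a + (m' - m)) ^ 2 / θ := by positivity
    have e : (θ * a + (m' - m)) ^ 2 / θ
        = θ * a ^ 2 + 2 * a * (m' - m) + 1 / θ * (m' - m) ^ 2 := by
      field_simp; ring
    nlinarith
  have h10 : (1 + 1 / θ) * (m' - m) ^ 2 ≤ 8 * E ^ 8 * θ ^ 2 := by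
    have h11 : 1 + 1 / θ ≤ 2 / θ := by
      rw [le_div_iff₀ hθ]
      field_simp
      linarith
    calc _ ≤ 2 / θ * (4 * E ^ 8 * θ ^ 3) := mul_le_mul h11 h6 (sq_nonneg _) (by positivity)
      _ = _ := by field_simp; ring
  have h12 : (1 + θ) * a ^ 2 ≤ (1 + θ) * (y ^ 2 + 2 * α * (k * (gt * y)) + E ^ 4 * θ ^ 2) :=
    mul_le_mul_of_nonneg_left h2 (by linarith)
  have h13 : (1 + θ) * (E ^ 4 * θ ^ 2) ≤ 2 * (E ^ 8 * θ ^ 2) := by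
    refine mul_le_mul (by linarith) ?_ (by positivity) (by norm_num)
    have : E ^ 4 ≤ E ^ 8 := pow_le_pow_right₀ (by linarith) (by norm_num)
    gcongr
  nlinarith

/-- The mean squared tracking error decays like `t ^ (-2 / 3)`. -/
lemma integral_gap_sq_le (t : ℕ) (x : S × A) :
    ∫ ω, gap γ ηs Q η x t ω ^ 2 ∂μ ≤ 128 * qBound B ^ 8 * theta p t := by
  have hE := H.two_le_qBound
  set E := qBound B with hEdef
  let Ψ : ℕ → Ω → ℝ := fun t ω => grad γ P g Q η x t ω * gap γ ηs Q η x t ω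
  let u : ℕ → ℝ := fun t => ∫ ω, gap γ ηs Q η x t ω ^ 2 ∂μ
  let c : ℕ → ℝ := fun t => ∫ ω, h x (Y t ω) * Ψ t ω ∂μ
  let α : ℕ → ℝ := fun t => theta p t * (κ * dmin)⁻¹
  have bgap : ∀ t, IsBdd (F t) (gap γ ηs Q η x t) := fun t => H.isBdd_gap t x
  have bΨ : ∀ t, IsBdd (F t) (Ψ t) := fun t => (H.isBdd_grad t x).mul (bgap t)
  have hgap : ∀ t ω, |gap γ ηs Q η x t ω| ≤ E := fun t ω => H.abs_gap_le t ω x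
  have hΨ : ∀ t ω, |Ψ t ω| ≤ E ^ 2 := fun t ω => by
    simp only [Ψ]
    rw [abs_mul, sq]
    exact mul_le_mul (H.abs_grad_le t ω x) (hgap t ω) (abs_nonneg _) (by linarith)
  have hc : ∀ t, |c t| ≤ E ^ 3 := fun t => abs_integral_le_of_abs_le fun ω => by
    rw [abs_mul, show E ^ 3 = E * E ^ 2 by ring]
    exact mul_le_mul ((H.h_bound _ _).trans H.le_qBound) (hΨ t ω) (abs_nonneg _) (by linarith)
  have hu0 : ∀ t, 0 ≤ u t := fun t => integral_nonneg fun ω => sq_nonneg _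
  have hα0 : ∀ t, 0 ≤ α t := H.alpha_nonneg
  have hαE : ∀ t, α t ≤ E * theta p t := H.alpha_le
  have i2 : ∀ t, Integrable (fun ω => gap γ ηs Q η x t ω ^ 2) μ := fun t =>
    ((bgap t).pow_two.mono (H.chain.le t)).integrable
  have hstep : ∀ t, u (t + 1) ≤ (1 - theta p t) * u t + 2 * α t * (c t - c (t + 1))
      + 38 * E ^ 8 * theta p t ^ 2 := by
    intro t
    have hθ := theta_pos H.one_le_p t
    have hθ1 := theta_le_one H.one_le_p t
    have i3 : Integrable (fun ω => hit x (Y t ω) *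
        (g (η t ω x) (clippedGreedy γ (Q t ω) (Y (t + 1) ω).1) * gap γ ηs Q η x t ω)) μ := by
      refine IsBdd.integrable (IsBdd.mono (m := F (t + 1)) ?_ (H.chain.le (t + 1)))
      exact ((H.chain.isBdd_state t (hit x)).mono (H.chain.mono t)).mul
        ((H.isBdd_next H.dual.g_bound H.dual.g_lip t (H.measurable_iterates t).1 x
          ((H.measurable_iterates t).2 x)).mul ((bgap t).mono (H.chain.mono t)))
    have h1 : u (t + 1) ≤ (1 + theta p t) * (u t + 2 * α t * ∫ ω, hit x (Y t ω) *
        (g (η t ω x) (clippedGreedy γ (Q t ω) (Y (t + 1) ω).1) * gap γ ηs Q η x t ω) ∂μ)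
        + 10 * E ^ 8 * theta p t ^ 2 := by
      have := integral_mono (i2 (t + 1)) ((((i2 t).add (i3.const_mul (2 * α t))).const_mul
        (1 + theta p t)).add (integrable_const (10 * E ^ 8 * theta p t ^ 2)))
        (fun ω => H.gap_succ_sq_le t ω x)
      refine this.trans_eq ?_
      rw [integral_add' (((i2 t).add (i3.const_mul (2 * α t))).const_mul _) (integrable_const _),
        integral_const_mul, integral_add' (i2 t) (i3.const_mul _), integral_const_mul]
      simp [u]
    have h2 : ∫ ω, hit x (Y t ω) *
        (g (η t ω x) (clippedGreedy γ (Q t ω) (Y (t + 1) ω).1) * gap γ ηs Q η x t ω) ∂μ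
        = ∫ ω, hit x (Y t ω) * Ψ t ω ∂μ := by
      rw [H.integral_hit_next t x (φ := fun s ω => g (η t ω x) (clippedGreedy γ (Q t ω) s)
        * gap γ ηs Q η x t ω) fun s => (H.isBdd_g t x s).mul (bgap t)]
      simp only [Ψ, grad, Finset.sum_mul, mul_assoc]
    -- Visits to `x` are replaced by `d x ≥ dmin`, which makes strong concavity effective even
    -- though `x` is not updated at every step.
    have h3 := (abs_le.1 (H.integral_hit_mul t x (bΨ t) (bΨ (t + 1))
      (c := 6 * E ^ 5 * theta p t) fun ω => H.abs_grad_mul_gap_step_le t ω x)).2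
    have h4 : ∫ ω, Ψ t ω ∂μ ≤ -κ * u t := by
      simp only [u]
      rw [← integral_const_mul]
      refine integral_mono ((bΨ t).mono (H.chain.le t)).integrable ((i2 t).const_mul _) fun ω => ?_
      exact H.dual.strong x _ (H.value_mem t ω) _ (H.dual_mem t ω x)
    have hκ := H.dual.kappa_pos
    have hd := H.dmin_pos
    have h5 : d x * ∫ ω, Ψ t ω ∂μ ≤ -(κ * dmin) * u t := by
      have h6 := mul_le_mul_of_nonneg_left h4 (hd.le.trans (H.dmin_le x))
      have h7 := mul_le_mul_of_nonneg_right (H.dmin_le x) (mul_nonneg hκ.le (hu0 t))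
      nlinarith
    have h8 : B * (6 * E ^ 5 * theta p t) ≤ 6 * E ^ 6 * theta p t := by
      have := mul_le_mul_of_nonneg_right H.le_qBound
        (show 0 ≤ 6 * E ^ 5 * theta p t by positivity)
      refine this.trans_eq ?_
      rw [← hEdef]; ring
    have h9 : ∫ ω, hit x (Y t ω) * Ψ t ω ∂μ
        ≤ -(κ * dmin) * u t + (c t - c (t + 1)) + 6 * E ^ 6 * theta p t := by
      simp only [c]; linarith
    have h10 : 2 * α t * ∫ ω, hit x (Y t ω) * Ψ t ω ∂μ ≤ -(2 * theta p t) * u t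
        + 2 * α t * (c t - c (t + 1)) + 12 * E ^ 7 * theta p t ^ 2 := by
      have h11 := mul_le_mul_of_nonneg_left h9 (show 0 ≤ 2 * α t by linarith [hα0 t])
      have h12 : α t * (κ * dmin) = theta p t := by
        simp only [α]; field_simp
      have h13 := mul_le_mul_of_nonneg_right (hαE t)
        (show 0 ≤ 12 * E ^ 6 * theta p t by positivity)
      have e1 : 2 * α t * (-(κ * dmin) * u t + (c t - c (t + 1)) + 6 * E ^ 6 * theta p t)
        = -(2 * (α t * (κ * dmin))) * u t + 2 * α t * (c t - c (t + 1))
          + α t * (12 * E ^ 6 * theta p t) := by ring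
      rw [e1, h12] at h11
      have e2 : E * theta p t * (12 * E ^ 6 * theta p t) = 12 * E ^ 7 * theta p t ^ 2 := by ring
      linarith
    have h14 : (1 + theta p t) * (u t + 2 * α t * ∫ ω, hit x (Y t ω) * Ψ t ω ∂μ)
        ≤ (1 + theta p t) * (u t + (-(2 * theta p t) * u t
        + 2 * α t * (c t - c (t + 1)) + 12 * E ^ 7 * theta p t ^ 2)) :=
      mul_le_mul_of_nonneg_left (by linarith) (by linarith)
    -- The extra `θ` from Young's factor already makes this part second order; only the main part of
    -- the difference has to telescope.
    have h15 : theta p t * (2 * α t * (c t - c (t + 1))) ≤ 4 * E ^ 4 * theta p t ^ 2 := by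
      have h16 : c t - c (t + 1) ≤ 2 * E ^ 3 := by
        linarith [(abs_le.1 (hc t)).2, (abs_le.1 (hc (t + 1))).1]
      have h17 := mul_le_mul_of_nonneg_left h16
        (show 0 ≤ theta p t * (2 * α t) from mul_nonneg hθ.le (by linarith [hα0 t]))
      have h18 := mul_le_mul_of_nonneg_left (hαE t) (show 0 ≤ 4 * E ^ 3 * theta p t by positivity)
      nlinarith
    have h19 : E ^ 7 ≤ E ^ 8 := pow_le_pow_right₀ (by linarith) (by norm_num)
    have h20 : E ^ 4 ≤ E ^ 8 := pow_le_pow_right₀ (by linarith) (by norm_num)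
    have h21 := mul_le_mul_of_nonneg_right h19 (sq_nonneg (theta p t))
    have h22 := mul_le_mul_of_nonneg_right h20 (sq_nonneg (theta p t))
    have h23 : theta p t * (12 * E ^ 7 * theta p t ^ 2) ≤ 1 * (12 * E ^ 7 * theta p t ^ 2) :=
      mul_le_mul_of_nonneg_right hθ1 (by positivity)
    -- `(1 + θ) (1 - 2 θ) = 1 - θ - 2 θ ^ 2`: the last term is dropped and the net contraction is `1
    -- - θ`.
    have h24 : 0 ≤ theta p t ^ 2 * u t := mul_nonneg (sq_nonneg _) (hu0 t)
    rw [h2] at h1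
    nlinarith
  -- The telescoping difference is absorbed into a modified potential. What remains is the variation
  -- of `α` times `c` and the contraction acting on the correction, both of order `θ ^ 2`.
  let w : ℕ → ℝ := fun t => u t + 2 * α t * c t
  have hw : ∀ t : ℕ, w (t + 1) ≤ (1 - theta p t) * w t + 42 * E ^ 8 * theta p t ^ 2 := by
    intro t
    have hθ := theta_pos H.one_le_p t
    have h1 := hstep t
    have h2 : 2 * (α (t + 1) - α t) * c (t + 1) ≤ 2 * E ^ 4 * theta p t ^ 2 := by
      have h3 : |α (t + 1) - α t| ≤ E * theta p t ^ 2 := by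
        have e : α (t + 1) - α t = -((theta p t - theta p (t + 1)) * (κ * dmin)⁻¹) := by
          simp only [α]; ring
        have h4 : 0 ≤ (κ * dmin)⁻¹ := by
          have := H.dual.kappa_pos; have := H.dmin_pos; positivity
        have h5 := theta_succ_le H.one_le_p t
        rw [e, abs_neg, abs_of_nonneg (mul_nonneg (by linarith) h4), mul_comm E]
        exact mul_le_mul (theta_sub_succ_le H.one_le_p t) (H.inv_kappa_le.trans H.le_qBound) h4
          (sq_nonneg _)
      have h6 := mul_le_mul h3 (hc (t + 1)) (abs_nonneg _) (by positivity)
      rw [← abs_mul] at h6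
      have h7 := le_abs_self ((α (t + 1) - α t) * c (t + 1))
      nlinarith
    have h8 : theta p t * (2 * α t * c t) ≤ 2 * E ^ 4 * theta p t ^ 2 := by
      have h9 := mul_le_mul_of_nonneg_left (abs_le.1 (hc t)).2
        (show 0 ≤ theta p t * (2 * α t) from mul_nonneg hθ.le (by linarith [hα0 t]))
      have h10 := mul_le_mul_of_nonneg_left (hαE t) (show 0 ≤ 2 * E ^ 3 * theta p t by positivity)
      nlinarith
    have h20 : E ^ 4 ≤ E ^ 8 := pow_le_pow_right₀ (by linarith) (by norm_num)
    have h22 := mul_le_mul_of_nonneg_right h20 (sq_nonneg (theta p t))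
    simp only [w]
    nlinarith
  have hp := H.one_le_p
  have hwc : ∀ t, 2 * α t * |c t| ≤ 2 * E ^ 4 * theta p t := by
    intro t
    have h1 := mul_le_mul (hαE t) (hc t) (abs_nonneg _)
      (mul_nonneg (by linarith) (theta_pos hp t).le)
    nlinarith
  have hmain := recursion_two_thirds (w := w) (C := 42 * E ^ 8) (K := 126 * E ^ 8) hp
    (by ring_nf; rfl) (by positivity) ?_ hw t
  · have h1 := hwc t
    have h2 := neg_abs_le (c t)
    have h3 := mul_le_mul_of_nonneg_left h2 (show 0 ≤ 2 * α t by linarith [hα0 t])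
    have h20 : E ^ 4 ≤ E ^ 8 := pow_le_pow_right₀ (by linarith) (by norm_num)
    have h22 := mul_le_mul_of_nonneg_right h20 (theta_pos hp t).le
    have h4 : w t ≤ 126 * E ^ 8 * theta p t := hmain
    have h5 : w t = u t + 2 * α t * c t := rfl
    have h6 : u t ≤ 128 * E ^ 8 * theta p t := by nlinarith
    exact h6
  · have h1 : u 0 ≤ E ^ 2 := by
      refine (le_abs_self _).trans (abs_integral_le_of_abs_le fun ω => ?_)
      rw [abs_of_nonneg (sq_nonneg _), ← sq_abs]
      exact pow_le_pow_left₀ (abs_nonneg _) (hgap 0 ω) 2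
    have h2 := hwc 0
    have h3 := mul_le_mul_of_nonneg_left (le_abs_self (c 0))
      (show 0 ≤ 2 * α 0 by linarith [hα0 0])
    have h4 : theta p 0 ≤ 1 := theta_le_one hp 0
    -- Since `p ≤ E`, the initial bound becomes a multiple of `p ^ (-2 / 3)` at the cost of one
    -- factor `E`.
    have h5 : 1 / E ≤ p ^ (-(2 / 3) : ℝ) := by
      have h6 := one_div_le_theta hp 0
      simp only [theta, Nat.cast_zero, zero_add] at h6
      refine le_trans ?_ h6
      exact one_div_le_one_div_of_le (by linarith) (H.p_le.trans H.le_qBound)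
    have h7 : 126 * E ^ 7 ≤ 126 * E ^ 8 * p ^ (-(2 / 3) : ℝ) := by
      calc 126 * E ^ 7 = 126 * E ^ 8 * (1 / E) := by field_simp
        _ ≤ _ := by gcongr
    have h8 : E ^ 2 ≤ E ^ 7 := pow_le_pow_right₀ (by linarith) (by norm_num)
    have h9 : E ^ 4 ≤ E ^ 7 := pow_le_pow_right₀ (by linarith) (by norm_num)
    have h10 : 2 * E ^ 4 * theta p 0 ≤ 2 * E ^ 4 * 1 := by gcongr
    have h11 : w 0 = u 0 + 2 * α 0 * c 0 := rfl
    have h12 : 0 ≤ E ^ 7 := by positivity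
    rw [h11]
    linarith

end Tracking

end Run

end Run

lemma IsBdd.pi_norm {Ω X : Type*} [Fintype X] {m : MeasurableSpace Ω} {Z : Ω → X → ℝ}
    (hZ : ∀ x, IsBdd m (fun ω => Z ω x)) : IsBdd m (fun ω => ‖Z ω‖) := by
  refine ⟨measurable_norm.comp (@measurable_pi_iff _ _ _ m _ _ |>.2 fun x => (hZ x).1), ?_⟩
  obtain ⟨c, hc⟩ := (IsBdd.sum Finset.univ fun x => (hZ x).abs).2
  refine ⟨c, fun ω => ?_⟩
  rw [abs_norm]
  have h1 : ∑ x, |Z ω x| ≤ c := (le_abs_self _).trans (hc ω)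
  refine le_trans ?_ h1
  exact (pi_norm_le_iff_of_nonneg (Finset.sum_nonneg fun _ _ => abs_nonneg _)).2 fun x =>
    Finset.single_le_sum (f := fun x => |Z ω x|) (fun _ _ => abs_nonneg _) (Finset.mem_univ x)

/-! ### Decomposition of the error of the `Q`-values -/

section Run

variable {S A Ω : Type*} [Fintype S] [Nonempty S] [Fintype A] [Nonempty A]

/-- The step size of the `Q`-values along a run. -/
def beta (γ dmin q : ℝ) (t : ℕ) : ℝ := ((1 - γ) * dmin)⁻¹ / ((t : ℝ) + q)

/-- The decay profile of the error of the `Q`-values. -/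
def tau (q : ℝ) (t : ℕ) : ℝ := ((t : ℝ) + q) ^ (-(1 / 2) : ℝ)

lemma tau_pos {q : ℝ} (hq : 1 ≤ q) (t : ℕ) : 0 < tau q t :=
  Real.rpow_pos_of_pos (by linarith [one_le_add_cast hq t]) _

lemma tau_sq {q : ℝ} (hq : 1 ≤ q) (t : ℕ) : tau q t ^ 2 = 1 / ((t : ℝ) + q) := by
  have hs : 0 ≤ (t : ℝ) + q := by linarith [one_le_add_cast hq t]
  rw [tau, ← Real.rpow_natCast, ← Real.rpow_mul hs,
    show (-(1 / 2) : ℝ) * ((2 : ℕ) : ℝ) = -1 by norm_num, Real.rpow_neg_one, one_div]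

lemma one_div_le_tau {q : ℝ} (hq : 1 ≤ q) (t : ℕ) : 1 / ((t : ℝ) + q) ≤ tau q t := by
  rw [one_div, ← Real.rpow_neg_one]
  exact Real.rpow_le_rpow_of_exponent_le (one_le_add_cast hq t) (by norm_num)

/-- Besides the comparison of exponents, the offset changes from `p` to `q`, using `t + q ≤ q (t +
p)`. -/
lemma theta_le_tau {p q : ℝ} (hp : 1 ≤ p) (hq : 1 ≤ q) (t : ℕ) : theta p t ≤ q * tau q t := by
  have hs := one_le_add_cast hp t
  have hs' := one_le_add_cast hq t
  have ht : (0 : ℝ) ≤ t := t.cast_nonneg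
  have h1 : theta p t ≤ tau p t := Real.rpow_le_rpow_of_exponent_le hs (by norm_num)
  have h2 : (q * ((t : ℝ) + p)) ^ (-(1 / 2) : ℝ) ≤ tau q t :=
    Real.rpow_le_rpow_of_nonpos (by linarith) (by nlinarith) (by norm_num)
  rw [Real.mul_rpow (by linarith) (by linarith)] at h2
  have h3 : 1 / q ≤ q ^ (-(1 / 2) : ℝ) := by
    rw [one_div, ← Real.rpow_neg_one]
    exact Real.rpow_le_rpow_of_exponent_le hq (by norm_num)
  have h4 : 1 / q * tau p t ≤ tau q t :=
    (mul_le_mul_of_nonneg_right h3 (tau_pos hp t).le).trans h2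
  have h5 := mul_le_mul_of_nonneg_left h4 (show 0 ≤ q by linarith)
  have e : q * (1 / q * tau p t) = tau p t := by field_simp
  linarith

namespace Run

variable [mΩ : MeasurableSpace Ω] {B γ κ lo hi dmin p q : ℝ} {P : S → A → S → ℝ}
    {R : S → A → ℝ} {π : S → A → ℝ} {d : S × A → ℝ} {h : S × A → S × A → ℝ} {j g : ℝ → ℝ → ℝ}
    {ηs : S × A → (S → ℝ) → ℝ} {Qstar : S × A → ℝ} {μ : Measure Ω} [IsProbabilityMeasure μ]
    {F : ℕ → MeasurableSpace Ω}
    {Y : ℕ → Ω → S × A} {r : ℕ → Ω → ℝ} {Q η : ℕ → Ω → S × A → ℝ}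

/-- The mean increment of the `Q`-value at `x`. -/
def drift (γ : ℝ) (P : S → A → S → ℝ) (R : S → A → ℝ) (j : ℝ → ℝ → ℝ) (Q η : ℕ → Ω → S × A → ℝ)
    (x : S × A) (t : ℕ) (ω : Ω) : ℝ :=
  R x.1 x.2 + γ * (∑ s', P x.1 x.2 s' * j (η t ω x) (clippedGreedy γ (Q t ω) s')) - Q t ω x

/-- The martingale increment of the `Q`-value at `x`, including that of the Poisson correction. -/
def noise (γ : ℝ) (P : S → A → S → ℝ) (R : S → A → ℝ) (π : S → A → ℝ) (h : S × A → S × A → ℝ)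
    (j : ℝ → ℝ → ℝ) (Y : ℕ → Ω → S × A) (r : ℕ → Ω → ℝ) (Q η : ℕ → Ω → S × A → ℝ)
    (x : S × A) (t : ℕ) (ω : Ω) : ℝ :=
  hit x (Y t ω) * (r t ω + γ * j (η t ω x) (clippedGreedy γ (Q t ω) (Y (t + 1) ω).1) - Q t ω x)
    - hit x (Y t ω) * drift γ P R j Q η x t ω
    + (h x (Y (t + 1) ω) - ∑ z, chainMatrix P π (Y t ω) z * h x z) * drift γ P R j Q η x t ω

/-- The martingale part of the error. -/
def martPart (γ dmin q : ℝ) (P : S → A → S → ℝ) (R : S → A → ℝ) (π : S → A → ℝ) (d : S × A → ℝ)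
    (h : S × A → S × A → ℝ) (j : ℝ → ℝ → ℝ) (Y : ℕ → Ω → S × A) (r : ℕ → Ω → ℝ)
    (Q η : ℕ → Ω → S × A → ℝ) (x : S × A) : ℕ → Ω → ℝ
  | 0, _ => 0
  | t + 1, ω => (1 - beta γ dmin q t * d x) * martPart γ dmin q P R π d h j Y r Q η x t ω
      + beta γ dmin q t * noise γ P R π h j Y r Q η x t ω

/-- The telescoping part of the error. -/
def telePart (γ dmin q : ℝ) (P : S → A → S → ℝ) (R : S → A → ℝ) (d : S × A → ℝ)
    (h : S × A → S × A → ℝ) (j : ℝ → ℝ → ℝ) (Y : ℕ → Ω → S × A)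
    (Q η : ℕ → Ω → S × A → ℝ) (x : S × A) : ℕ → Ω → ℝ
  | 0, _ => 0
  | t + 1, ω => (1 - beta γ dmin q t * d x) * telePart γ dmin q P R d h j Y Q η x t ω
      + beta γ dmin q t * ((h x (Y t ω) - h x (Y (t + 1) ω)) * drift γ P R j Q η x t ω)

section Noise

variable (H : Run B γ κ lo hi dmin p q P R π d h j g ηs Qstar μ F Y r Q η)
include H

lemma isBdd_drift (t : ℕ) (x : S × A) : IsBdd (F t) (drift γ P R j Q η x t) :=
  ((IsBdd.const _).add ((IsBdd.sum _ fun s' => (H.isBdd_j t x s').const_mul _).const_mul γ)).sub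
    (H.isBdd_q t x)

lemma abs_drift_le (t : ℕ) (ω : Ω) (x : S × A) :
    |drift γ P R j Q η x t ω| ≤ 2 * qBound B := by
  have h1 := H.abs_average_le x fun s => H.dual.j_bound (η t ω x) (clippedGreedy γ (Q t ω) s)
  have h2 := H.dual.reward x.1 x.2
  have h3 := H.abs_q_le t ω x
  have h4 := two_mul_le_qBound H.dual.one_le
  have h5 := H.dual.one_le
  set a := ∑ s', P x.1 x.2 s' * j (η t ω x) (clippedGreedy γ (Q t ω) s')
  have h6 : |γ * a| ≤ B := by
    rw [abs_mul, abs_of_nonneg H.dual.gamma_nonneg]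
    nlinarith [abs_nonneg a, H.dual.gamma_lt]
  have h7 := abs_le.1 h6
  have h8 := abs_le.1 h3
  unfold drift
  rw [abs_le]
  constructor <;> linarith [h2.1, h2.2, h7.1, h7.2, h8.1, h8.2]

lemma abs_drift_step_le (t : ℕ) (ω : Ω) (x : S × A) :
    |drift γ P R j Q η x (t + 1) ω - drift γ P R j Q η x t ω| ≤ 5 * qBound B ^ 4 * theta p t := by
  have hE := H.two_le_qBound
  have hθ := theta_pos H.one_le_p t
  have h1 := H.abs_average_step_le H.dual.j_lip t ω x
  have h2 : |Q (t + 1) ω x - Q t ω x| ≤ 2 * qBound B ^ 3 * theta p t := by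
    refine ((norm_le_pi_norm (Q (t + 1) ω - Q t ω) x).trans (H.norm_q_step_le t ω)).trans ?_
    have h1 := mul_le_mul_of_nonneg_left (H.beta_le t)
      (show 0 ≤ 2 * qBound B by linarith)
    exact h1.trans_eq (by ring)
  have e : drift γ P R j Q η x (t + 1) ω - drift γ P R j Q η x t ω
      = γ * (∑ s', P x.1 x.2 s' * j (η (t + 1) ω x) (clippedGreedy γ (Q (t + 1) ω) s')
        - ∑ s', P x.1 x.2 s' * j (η t ω x) (clippedGreedy γ (Q t ω) s'))
        - (Q (t + 1) ω x - Q t ω x) := by unfold drift; ring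
  rw [e]
  refine (abs_sub _ _).trans ?_
  rw [abs_mul, abs_of_nonneg H.dual.gamma_nonneg]
  have h3 := mul_le_mul H.dual.gamma_lt.le h1 (abs_nonneg _) zero_le_one
  have h4 : qBound B ^ 3 * theta p t ≤ qBound B ^ 4 * theta p t :=
    mul_le_mul_of_nonneg_right (pow_le_pow_right₀ (by linarith) (by norm_num)) hθ.le
  linarith

lemma abs_chain_average_le (x y : S × A) : |∑ z, chainMatrix P π y z * h x z| ≤ B := by
  refine (Finset.abs_sum_le_sum_abs _ _).trans ?_
  have h0 := chainMatrix_nonneg H.dual.kernel H.policy y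
  calc _ ≤ ∑ z, chainMatrix P π y z * B := Finset.sum_le_sum fun z _ => by
        rw [abs_mul, abs_of_nonneg (h0 z)]
        exact mul_le_mul_of_nonneg_left (H.h_bound x z) (h0 z)
    _ = B := by rw [← Finset.sum_mul, chainMatrix_sum H.dual.kernel H.policy, one_mul]

lemma isBdd_noise (t : ℕ) (x : S × A) :
    IsBdd (F (t + 1)) (noise γ P R π h j Y r Q η x t) := by
  have hm := H.chain.mono t
  have b1 := (H.chain.isBdd_state t (hit x)).mono hm
  have b2 := (H.isBdd_drift t x).mono hm
  have b3 := H.isBdd_next H.dual.j_bound H.dual.j_lip t (H.measurable_iterates t).1 x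
    ((H.measurable_iterates t).2 x)
  exact ((b1.mul (((H.chain.isBdd_reward t).add (b3.const_mul γ)).sub ((H.isBdd_q t x).mono hm))).sub
    (b1.mul b2)).add (((H.chain.isBdd_state (t + 1) (h x)).sub
      ((H.chain.isBdd_state t fun y => ∑ z, chainMatrix P π y z * h x z).mono hm)).mul b2)

lemma abs_noise_le (t : ℕ) (ω : Ω) (x : S × A) :
    |noise γ P R π h j Y r Q η x t ω| ≤ 4 * qBound B ^ 2 := by
  have hE := H.two_le_qBound
  have h1 := H.abs_drift_le t ω x
  have h2 := H.abs_target_le t ω (η t ω x) (clippedGreedy γ (Q t ω) (Y (t + 1) ω).1)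
  have h3 := H.abs_q_le t ω x
  have h4 := two_mul_le_qBound H.dual.one_le
  have h5 := abs_hit_le x (Y t ω)
  have h6 := H.h_bound x (Y (t + 1) ω)
  have h7 := H.abs_chain_average_le x (Y t ω)
  unfold noise
  refine (abs_add_le _ _).trans ((add_le_add_left (abs_sub _ _) _).trans ?_)
  rw [abs_mul, abs_mul, abs_mul]
  have h8 := mul_le_mul h5 ((abs_sub _ _).trans (add_le_add (h2.trans h4) h3)) (abs_nonneg _)
    zero_le_one
  have h9 := mul_le_mul h5 h1 (abs_nonneg _) zero_le_one
  have h10 := mul_le_mul ((abs_sub _ _).trans ((add_le_add h6 h7).trans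
    ((two_mul B).symm.le.trans h4))) h1 (abs_nonneg _) (by linarith)
  nlinarith

/-- Three centred contributions: the reward given the past, the sampled dual value given the visited
pair, and `h` at the next state minus its kernel average. -/
lemma integral_noise_mul (t : ℕ) (x : S × A) {Z : Ω → ℝ} (hZ : IsBdd (F t) Z) :
    ∫ ω, noise γ P R π h j Y r Q η x t ω * Z ω ∂μ = 0 := by
  have hm := H.chain.mono t
  have b1 := H.chain.isBdd_state t (hit x)
  have b2 := H.isBdd_drift t x
  have b3 := H.isBdd_next H.dual.j_bound H.dual.j_lip t (H.measurable_iterates t).1 x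
    ((H.measurable_iterates t).2 x)
  have b4 := H.isBdd_q t x
  have b5 := H.chain.isBdd_state t fun y => ∑ z, chainMatrix P π y z * h x z
  have b6 := H.chain.isBdd_state t fun y => R y.1 y.2
  have bDZ := b2.mul hZ
  have bHZ := b1.mul hZ
  have toInt : ∀ {W : Ω → ℝ}, IsBdd (F (t + 1)) W → Integrable W μ := fun b =>
    (b.mono (H.chain.le (t + 1))).integrable
  have c1 := (H.chain.isBdd_reward t).mul (bHZ.mono hm)
  have c2 := (b1.mono hm).mul ((b3.const_mul γ).mul (hZ.mono hm))
  have c3 := (b1.mul (b4.mul hZ)).mono hm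
  have c4 := (b1.mul bDZ).mono hm
  have c5 := (H.chain.isBdd_state (t + 1) (h x)).mul (bDZ.mono hm)
  have c6 := (b5.mul bDZ).mono hm
  have e : ∀ ω, noise γ P R π h j Y r Q η x t ω * Z ω
      = r t ω * (hit x (Y t ω) * Z ω)
        + hit x (Y t ω) * (γ * j (η t ω x) (clippedGreedy γ (Q t ω) (Y (t + 1) ω).1) * Z ω)
        - hit x (Y t ω) * (Q t ω x * Z ω)
        - hit x (Y t ω) * (drift γ P R j Q η x t ω * Z ω)
        + h x (Y (t + 1) ω) * (drift γ P R j Q η x t ω * Z ω)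
        - (∑ z, chainMatrix P π (Y t ω) z * h x z) * (drift γ P R j Q η x t ω * Z ω) := by
    intro ω; unfold noise; ring
  simp only [e]
  rw [integral_sub (toInt ((((c1.add c2).sub c3).sub c4).add c5)) (toInt c6),
    integral_add (toInt (((c1.add c2).sub c3).sub c4)) (toInt c5),
    integral_sub (toInt ((c1.add c2).sub c3)) (toInt c4),
    integral_sub (toInt (c1.add c2)) (toInt c3), integral_add (toInt c1) (toInt c2)]
  have h1 := H.chain.reward_mean t _ bHZ
  have h2 := H.integral_hit_next t x
    (φ := fun s ω => γ * j (η t ω x) (clippedGreedy γ (Q t ω) s) * Z ω)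
    fun s => ((H.isBdd_j t x s).const_mul γ).mul hZ
  have h3 := H.chain.integral_next t (Z := fun y ω => h x y * (drift γ P R j Q η x t ω * Z ω))
    fun y => bDZ.const_mul (h x y)
  have c7 := (b6.mul bHZ).mono hm
  have c8 := (b1.mul (IsBdd.sum Finset.univ fun s' =>
    (((H.isBdd_j t x s').const_mul γ).mul hZ).const_mul (P x.1 x.2 s'))).mono hm
  have h4 : ∫ ω, h x (Y (t + 1) ω) * (drift γ P R j Q η x t ω * Z ω) ∂μ
      = ∫ ω, (∑ z, chainMatrix P π (Y t ω) z * h x z) * (drift γ P R j Q η x t ω * Z ω) ∂μ := by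
    rw [h3]; simp only [Finset.sum_mul, mul_assoc]
  have h5 : ∫ ω, R (Y t ω).1 (Y t ω).2 * (hit x (Y t ω) * Z ω) ∂μ
      + ∫ ω, hit x (Y t ω) * (∑ s', P x.1 x.2 s' *
      (γ * j (η t ω x) (clippedGreedy γ (Q t ω) s') * Z ω)) ∂μ
      - ∫ ω, hit x (Y t ω) * (Q t ω x * Z ω) ∂μ
      = ∫ ω, hit x (Y t ω) * (drift γ P R j Q η x t ω * Z ω) ∂μ := by
    rw [← integral_add (toInt c7) (toInt c8), ← integral_sub (toInt (c7.add c8)) (toInt c3)]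
    refine integral_congr_ae (Filter.Eventually.of_forall fun ω => ?_)
    beta_reduce
    by_cases hx : Y t ω = x
    · rw [hx, hit_self, drift]
      have : ∑ s', P x.1 x.2 s' * (γ * j (η t ω x) (clippedGreedy γ (Q t ω) s') * Z ω)
          = γ * (∑ s', P x.1 x.2 s' * j (η t ω x) (clippedGreedy γ (Q t ω) s')) * Z ω := by
        rw [Finset.mul_sum, Finset.sum_mul]
        exact Finset.sum_congr rfl fun s' _ => by ring
      rw [this]; ring
    · rw [hit_of_ne hx]; ring
  rw [h1, h2, h4]
  linarith

end Noise

section Decomposition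

variable (H : Run B γ κ lo hi dmin p q P R π d h j g ηs Qstar μ F Y r Q η)
include H

lemma beta_le_qBound_div (t : ℕ) : beta γ dmin q t ≤ qBound B * (1 / ((t : ℝ) + q)) := by
  have hs := one_le_add_cast H.one_le_q t
  rw [beta, mul_one_div]
  exact div_le_div_of_nonneg_right (H.inv_gamma_le.trans H.le_qBound) (by linarith)

/-- The step size is normalized by `(1 - γ) dmin` for this purpose: since `d x ≥ dmin`, the
effective contraction has rate at least `1 / (t + q)`, the one required by `recursion_half`. -/
lemma one_div_le_beta_mul (t : ℕ) (x : S × A) :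
    1 / ((t : ℝ) + q) ≤ beta γ dmin q t * d x * (1 - γ) := by
  have hs := one_le_add_cast H.one_le_q t
  have hγ : 0 < 1 - γ := sub_pos.2 H.dual.gamma_lt
  have hd := H.dmin_pos
  have e : beta γ dmin q t * d x * (1 - γ) = d x / dmin * (1 / ((t : ℝ) + q)) := by
    unfold beta; field_simp
  rw [e]
  exact le_mul_of_one_le_left (by positivity) ((one_le_div hd).2 (H.dmin_le x))

lemma beta_mul_mem (t : ℕ) (x : S × A) :
    1 / ((t : ℝ) + q) ≤ beta γ dmin q t * d x ∧ beta γ dmin q t * d x ≤ 1 := by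
  have hs := one_le_add_cast H.one_le_q t
  have hβ : 0 ≤ beta γ dmin q t := H.beta_nonneg t
  have hd : 0 ≤ d x := H.dmin_pos.le.trans (H.dmin_le x)
  refine ⟨(H.one_div_le_beta_mul t x).trans (mul_le_of_le_one_right (mul_nonneg hβ hd)
    (by linarith [H.dual.gamma_nonneg])), ?_⟩
  rw [beta, div_mul_eq_mul_div, div_le_one (by linarith), mul_comm]
  linarith [H.d_le_q x, show (0 : ℝ) ≤ t from t.cast_nonneg]

lemma isBdd_martPart (t : ℕ) (x : S × A) :
    IsBdd (F t) (martPart γ dmin q P R π d h j Y r Q η x t) := by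
  induction t with
  | zero => exact IsBdd.const 0
  | succ t ih => exact ((ih.mono (H.chain.mono t)).const_mul _).add ((H.isBdd_noise t x).const_mul _)

lemma isBdd_telePart (t : ℕ) (x : S × A) :
    IsBdd (F t) (telePart γ dmin q P R d h j Y Q η x t) := by
  induction t with
  | zero => exact IsBdd.const 0
  | succ t ih =>
    have hm := H.chain.mono t
    exact ((ih.mono hm).const_mul _).add (((((H.chain.isBdd_state t (h x)).mono hm).sub
      (H.chain.isBdd_state (t + 1) (h x))).mul ((H.isBdd_drift t x).mono hm)).const_mul _)

/-- The noise is orthogonal to the past, so the cross term vanishes and the second moment contracts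
by the square of the linear factor, which puts it within reach of `recursion_one`. -/
lemma integral_martPart_sq_le (t : ℕ) (x : S × A) :
    ∫ ω, martPart γ dmin q P R π d h j Y r Q η x t ω ^ 2 ∂μ
      ≤ 32 * qBound B ^ 6 / ((t : ℝ) + q) := by
  have hE := H.two_le_qBound
  set E := qBound B
  have hq := H.one_le_q
  let W := martPart γ dmin q P R π d h j Y r Q η x
  let N := noise γ P R π h j Y r Q η x
  refine recursion_one (v := fun t => ∫ ω, W t ω ^ 2 ∂μ) (C := 16 * E ^ 6) (K := 32 * E ^ 6) hq
    (by linarith) (by positivity) ?_ (fun t => ?_) t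
  · have : ∫ ω, W 0 ω ^ 2 ∂μ = 0 := by simp [W, martPart]
    rw [this]; positivity
  · have hs := one_le_add_cast hq t
    have bW := H.isBdd_martPart t x
    have iW : Integrable (fun ω => W t ω ^ 2) μ := (bW.pow_two.mono (H.chain.le t)).integrable
    have bN := H.isBdd_noise t x
    have iNW : Integrable (fun ω => N t ω * W t ω) μ :=
      ((bN.mul (bW.mono (H.chain.mono t))).mono (H.chain.le (t + 1))).integrable
    have iN : Integrable (fun ω => N t ω ^ 2) μ :=
      (bN.pow_two.mono (H.chain.le (t + 1))).integrable
    obtain ⟨hb1, hb2⟩ := H.beta_mul_mem t x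
    have hβ : 0 ≤ beta γ dmin q t := H.beta_nonneg t
    set β := beta γ dmin q t
    have e : ∀ ω, W (t + 1) ω ^ 2 = (1 - β * d x) ^ 2 * W t ω ^ 2
        + 2 * (1 - β * d x) * β * (N t ω * W t ω) + β ^ 2 * N t ω ^ 2 := by
      intro ω; simp only [W, martPart, N, β]; ring
    have h1 : ∫ ω, W (t + 1) ω ^ 2 ∂μ = (1 - β * d x) ^ 2 * ∫ ω, W t ω ^ 2 ∂μ
        + β ^ 2 * ∫ ω, N t ω ^ 2 ∂μ := by
      have iS : Integrable (fun ω => (1 - β * d x) ^ 2 * W t ω ^ 2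
          + 2 * (1 - β * d x) * β * (N t ω * W t ω)) μ := (iW.const_mul _).add (iNW.const_mul _)
      simp only [e]
      rw [integral_add iS (iN.const_mul _),
        integral_add (iW.const_mul _) (iNW.const_mul _), integral_const_mul, integral_const_mul,
        integral_const_mul, H.integral_noise_mul t x bW, mul_zero, add_zero]
    have h2 : ∫ ω, N t ω ^ 2 ∂μ ≤ 16 * E ^ 4 := by
      refine (le_abs_self _).trans (abs_integral_le_of_abs_le fun ω => ?_)
      rw [abs_of_nonneg (sq_nonneg _), ← sq_abs]
      calc |N t ω| ^ 2 ≤ (4 * E ^ 2) ^ 2 := pow_le_pow_left₀ (abs_nonneg _) (H.abs_noise_le t ω x) 2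
        _ = _ := by ring
    have h3 : β ^ 2 ≤ (E * (1 / ((t : ℝ) + q))) ^ 2 :=
      pow_le_pow_left₀ hβ (H.beta_le_qBound_div t) 2
    have h4 : (1 - β * d x) ^ 2 ≤ (1 - 1 / ((t : ℝ) + q)) ^ 2 :=
      pow_le_pow_left₀ (by linarith) (by linarith) 2
    rw [h1]
    have h5 : 0 ≤ ∫ ω, W t ω ^ 2 ∂μ := integral_nonneg fun _ => sq_nonneg _
    have h6 := mul_le_mul_of_nonneg_right h4 h5
    have h7 := mul_le_mul h3 h2 (integral_nonneg fun _ => sq_nonneg _) (sq_nonneg _)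
    have e2 : (E * (1 / ((t : ℝ) + q))) ^ 2 * (16 * E ^ 4) = 16 * E ^ 6 / ((t : ℝ) + q) ^ 2 := by
      field_simp
    linarith

lemma integral_abs_martPart_le (t : ℕ) (x : S × A) :
    ∫ ω, |martPart γ dmin q P R π d h j Y r Q η x t ω| ∂μ ≤ 17 * qBound B ^ 3 * tau q t := by
  have hE := H.two_le_qBound
  have h1 := H.integral_martPart_sq_le t x
  have hτ := tau_pos H.one_le_q t
  have hτ2 := tau_sq H.one_le_q t
  rw [div_eq_mul_one_div, ← hτ2] at h1
  set E := qBound B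
  set τ := tau q t
  have bW := H.isBdd_martPart t x
  have i1 := (bW.abs.mono (H.chain.le t)).integrable (μ := μ)
  have i2 := (bW.pow_two.mono (H.chain.le t)).integrable (μ := μ)
  have hc : 0 < E ^ 3 * τ := by positivity
  -- Young's inequality `|W| ≤ W ^ 2 / (2 a) + a / 2`, with `a = E ^ 3 τ` of the order of the
  -- standard deviation, converts the second moment into a first moment.
  have h2 : ∀ ω, |martPart γ dmin q P R π d h j Y r Q η x t ω|
      ≤ (2 * (E ^ 3 * τ))⁻¹ * martPart γ dmin q P R π d h j Y r Q η x t ω ^ 2 + E ^ 3 * τ / 2 := by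
    intro ω
    set W := martPart γ dmin q P R π d h j Y r Q η x t ω
    have h3 : 0 ≤ (2 * (E ^ 3 * τ))⁻¹ * (|W| - E ^ 3 * τ) ^ 2 := by positivity
    have e : (2 * (E ^ 3 * τ))⁻¹ * (|W| - E ^ 3 * τ) ^ 2
        = (2 * (E ^ 3 * τ))⁻¹ * |W| ^ 2 - |W| + E ^ 3 * τ / 2 := by field_simp; ring
    rw [← sq_abs]
    linarith
  have h3 := integral_mono i1 ((i2.const_mul (2 * (E ^ 3 * τ))⁻¹).add
    (integrable_const (E ^ 3 * τ / 2))) h2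
  rw [integral_add' (i2.const_mul _) (integrable_const _), integral_const_mul] at h3
  simp only [integral_const, probReal_univ, one_smul] at h3
  have h4 := mul_le_mul_of_nonneg_left h1 (show 0 ≤ (2 * (E ^ 3 * τ))⁻¹ by positivity)
  have e : (2 * (E ^ 3 * τ))⁻¹ * (32 * E ^ 6 * τ ^ 2) = 16 * (E ^ 3 * τ) := by field_simp; norm_num
  linarith

/-- Summation by parts on each path: the terms `h x (Y t) - h x (Y (t + 1))` are not small, but
their coefficients, step size times drift, vary slowly in `t`. -/
lemma abs_telePart_le (t : ℕ) (ω : Ω) (x : S × A) :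
    |telePart γ dmin q P R d h j Y Q η x t ω| ≤ 20 * qBound B ^ 7 * tau q t := by
  have hE := H.two_le_qBound
  have hq := H.one_le_q
  have hhE : ∀ y, |h x y| ≤ qBound B := fun y => (H.h_bound x y).trans H.le_qBound
  have hqE : q ≤ qBound B := H.q_le.trans H.le_qBound
  set E := qBound B
  let D : ℕ → ℝ := fun t => drift γ P R j Q η x t ω
  let W : ℕ → ℝ := fun t => telePart γ dmin q P R d h j Y Q η x t ω
  let b : ℕ → ℝ := beta γ dmin q
  have hb0 : ∀ t, 0 ≤ b t := H.beta_nonneg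
  have hbE : ∀ t, b t ≤ E * (1 / ((t : ℝ) + q)) := H.beta_le_qBound_div
  have hD : ∀ t, |D t| ≤ 2 * E := fun t => H.abs_drift_le t ω x
  -- Adding the boundary term of the summation by parts leaves a recursion in which only increments
  -- of `b` and `D` and second-order products of step sizes appear.
  let Z : ℕ → ℝ := fun t => W t + b t * (h x (Y t ω) * D t)
  have hcorr : ∀ t, |b t * (h x (Y t ω) * D t)| ≤ 2 * E ^ 3 * (1 / ((t : ℝ) + q)) := by
    intro t
    have hs := one_le_add_cast hq t
    rw [abs_mul, abs_mul, abs_of_nonneg (hb0 t)]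
    calc _ ≤ E * (1 / ((t : ℝ) + q)) * (E * (2 * E)) :=
          mul_le_mul (hbE t) (mul_le_mul (hhE _) (hD t) (abs_nonneg _) (by linarith))
            (by positivity) (by positivity)
      _ = _ := by ring
  have hZ : ∀ t : ℕ, |Z (t + 1)| ≤ (1 - 1 / ((t : ℝ) + q)) * |Z t|
      + 9 * E ^ 7 / ((t : ℝ) + q) * ((t : ℝ) + q) ^ (-(1 / 2) : ℝ) := by
    intro t
    have hs := one_le_add_cast hq t
    have hτ := tau_pos hq t
    obtain ⟨hb1, hb2⟩ := H.beta_mul_mem t x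
    have hbd : 0 ≤ b t * d x := le_trans (by positivity) hb1
    have e : Z (t + 1) = (1 - b t * d x) * Z t + b t * d x * (b t * (h x (Y t ω) * D t))
        + h x (Y (t + 1) ω) * (b (t + 1) * (D (t + 1) - D t) - (b t - b (t + 1)) * D t) := by
      simp only [Z, W, telePart, D, b]; ring
    have h1 : |(1 - b t * d x) * Z t| ≤ (1 - 1 / ((t : ℝ) + q)) * |Z t| := by
      rw [abs_mul, abs_of_nonneg (by linarith : 0 ≤ 1 - b t * d x)]
      exact mul_le_mul_of_nonneg_right (by linarith) (abs_nonneg _)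
    set σ' : ℝ := 1 / ((t : ℝ) + q) with hσ
    have hσ0 : 0 ≤ σ' := by positivity
    have hστ : σ' ≤ tau q t := one_div_le_tau hq t
    have h2 : |b t * d x * (b t * (h x (Y t ω) * D t))| ≤ 2 * E ^ 4 * (σ' * tau q t) := by
      rw [abs_mul, abs_of_nonneg hbd]
      have h3 : b t * d x ≤ E * σ' :=
        (mul_le_of_le_one_right (hb0 t) (H.d_le_one x)).trans (hbE t)
      calc _ ≤ E * σ' * (2 * E ^ 3 * σ') :=
            mul_le_mul h3 (hcorr t) (abs_nonneg _) (by positivity)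
        _ = 2 * E ^ 4 * (σ' * σ') := by ring
        _ ≤ _ := by gcongr
    have hb' : b (t + 1) ≤ b t := by
      simp only [b, beta]
      refine div_le_div_of_nonneg_left ?_ (by linarith) (by push_cast; linarith)
      have := sub_pos.2 H.dual.gamma_lt; have := H.dmin_pos
      positivity
    have h4 : |b (t + 1) * (D (t + 1) - D t)| ≤ 5 * E ^ 6 * (σ' * tau q t) := by
      rw [abs_mul, abs_of_nonneg (hb0 _)]
      have h5 : theta p t ≤ E * tau q t := (theta_le_tau H.one_le_p hq t).trans
        (mul_le_mul_of_nonneg_right hqE hτ.le)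
      calc _ ≤ E * σ' * (5 * E ^ 4 * (E * tau q t)) := by
            refine mul_le_mul (hb'.trans (hbE t)) ((H.abs_drift_step_le t ω x).trans ?_)
              (abs_nonneg _) (by positivity)
            exact mul_le_mul_of_nonneg_left h5 (by positivity)
        _ = _ := by ring
    have h6 : |(b t - b (t + 1)) * D t| ≤ 2 * E ^ 2 * (σ' * tau q t) := by
      have h7 : b t - b (t + 1) ≤ E * (σ' * σ') := by
        have e1 : b t - b (t + 1) = ((1 - γ) * dmin)⁻¹ * (σ' * (1 / ((t : ℝ) + 1 + q))) := by
          simp only [b, beta, hσ]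
          push_cast
          have : (t : ℝ) + 1 + q ≠ 0 := by linarith
          have : (t : ℝ) + q ≠ 0 := by linarith
          generalize ((1 - γ) * dmin)⁻¹ = c
          field_simp
          ring
        rw [e1]
        refine mul_le_mul (H.inv_gamma_le.trans H.le_qBound)
          (mul_le_mul_of_nonneg_left ?_ hσ0) (by positivity) (by linarith)
        exact one_div_le_one_div_of_le (by linarith) (by linarith)
      rw [abs_mul, abs_of_nonneg (by linarith)]
      calc _ ≤ E * (σ' * σ') * (2 * E) := mul_le_mul h7 (hD t) (abs_nonneg _) (by positivity)
        _ = 2 * E ^ 2 * (σ' * σ') := by ring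
        _ ≤ _ := by gcongr
    have h8 : |h x (Y (t + 1) ω) * (b (t + 1) * (D (t + 1) - D t) - (b t - b (t + 1)) * D t)|
        ≤ E * (5 * E ^ 6 * (σ' * tau q t) + 2 * E ^ 2 * (σ' * tau q t)) := by
      rw [abs_mul]
      exact mul_le_mul (hhE _) ((abs_sub _ _).trans (add_le_add h4 h6)) (abs_nonneg _)
        (by linarith)
    have h9 : |Z (t + 1)| ≤ (1 - σ') * |Z t| + 2 * E ^ 4 * (σ' * tau q t)
        + E * (5 * E ^ 6 * (σ' * tau q t) + 2 * E ^ 2 * (σ' * tau q t)) := by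
      rw [e]
      exact (abs_add_le _ _).trans (add_le_add ((abs_add_le _ _).trans (add_le_add h1 h2)) h8)
    have h10 : E ^ 4 ≤ E ^ 7 := pow_le_pow_right₀ (by linarith) (by norm_num)
    have h11 : E ^ 3 ≤ E ^ 7 := pow_le_pow_right₀ (by linarith) (by norm_num)
    have hστ0 : 0 ≤ σ' * tau q t := by positivity
    have h12 := mul_le_mul_of_nonneg_right h10 hστ0
    have h13 := mul_le_mul_of_nonneg_right h11 hστ0
    have e2 : 9 * E ^ 7 / ((t : ℝ) + q) * ((t : ℝ) + q) ^ (-(1 / 2) : ℝ)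
        = 9 * E ^ 7 * (σ' * tau q t) := by
      rw [hσ, tau]; ring
    rw [e2]
    nlinarith
  have hτ := tau_pos hq t
  have hZt : |Z t| ≤ 18 * E ^ 7 * tau q t := by
    refine recursion_half (u := fun t => |Z t|) (C := 9 * E ^ 7) (K := 18 * E ^ 7) hq (by linarith)
      (by positivity) ?_ hZ t
    have h1 := hcorr 0
    have h2 := one_div_le_tau hq 0
    have h3 : Z 0 = b 0 * (h x (Y 0 ω) * D 0) := by simp [Z, W, telePart]
    have h4 : E ^ 3 ≤ E ^ 7 := pow_le_pow_right₀ (by linarith) (by norm_num)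
    have e : tau q 0 = q ^ (-(1 / 2) : ℝ) := by simp [tau]
    rw [h3, ← e]
    refine h1.trans (mul_le_mul (by linarith [show 0 ≤ E ^ 7 by positivity]) h2 ?_ (by positivity))
    have := one_le_add_cast hq 0
    positivity
  have h1 := hcorr t
  have h2 := one_div_le_tau hq t
  have h4 : E ^ 3 ≤ E ^ 7 := pow_le_pow_right₀ (by linarith) (by norm_num)
  have h5 : 2 * E ^ 3 * (1 / ((t : ℝ) + q)) ≤ 2 * E ^ 7 * tau q t := by
    have := one_le_add_cast hq t
    refine mul_le_mul (by linarith) h2 (by positivity) (by positivity)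
  have e : telePart γ dmin q P R d h j Y Q η x t ω = Z t - b t * (h x (Y t ω) * D t) := by
    simp only [Z, W]; ring
  rw [e]
  refine (abs_sub _ _).trans ?_
  linarith

/-- What remains of the error after removing the martingale and the telescoping parts. -/
lemma error_succ (t : ℕ) (ω : Ω) (x : S × A) :
    Q (t + 1) ω x - Qstar x - martPart γ dmin q P R π d h j Y r Q η x (t + 1) ω
        - telePart γ dmin q P R d h j Y Q η x (t + 1) ω
      = (1 - beta γ dmin q t * d x) * (Q t ω x - Qstar x
          - martPart γ dmin q P R π d h j Y r Q η x t ω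
          - telePart γ dmin q P R d h j Y Q η x t ω)
        + beta γ dmin q t * d x * (drift γ P R j Q η x t ω + Q t ω x - Qstar x) := by
  have h1 := H.q_succ t ω x
  have h2 := H.poisson x (Y t ω)
  rw [show ((1 - γ) * dmin)⁻¹ / ((t : ℝ) + q) = beta γ dmin q t from rfl] at h1
  -- Once the kernel average of `h` is eliminated by the Poisson equation, the two removed parts
  -- cancel exactly against the visit indicator, leaving the deterministic weight `d x`.
  rw [h1, martPart, telePart, noise,
    show ∑ z, chainMatrix P π (Y t ω) z * h x z = h x (Y t ω) - hit x (Y t ω) + d x by linarith]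
  ring

/-- The mean error of the `Q`-iterates decays like `t ^ (-1 / 2)`. -/
lemma integral_error_le (t : ℕ) :
    Integrable (fun ω => ‖Q t ω - Qstar‖) μ ∧
      ∫ ω, ‖Q t ω - Qstar‖ ∂μ ≤ 400 * qBound B ^ 12 * tau q t := by
  have hE := H.two_le_qBound
  have hq := H.one_le_q
  have hBE := H.le_qBound
  have hqE : q ≤ qBound B := H.q_le.trans H.le_qBound
  have hcard : (Fintype.card (S × A) : ℝ) ≤ qBound B := H.card_le.trans H.le_qBound
  have hgapint := H.integral_gap_sq_le
  have hmart := H.integral_abs_martPart_le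
  have htele := H.abs_telePart_le
  have hβE := H.beta_le_qBound_div
  set E := qBound B
  let W₁ : ℕ → Ω → S × A → ℝ := fun t ω x => martPart γ dmin q P R π d h j Y r Q η x t ω
  let W₂ : ℕ → Ω → S × A → ℝ := fun t ω x => telePart γ dmin q P R d h j Y Q η x t ω
  let Δ : ℕ → Ω → S × A → ℝ := fun t ω x => Q t ω x - Qstar x - W₁ t ω x - W₂ t ω x
  let res : ℕ → Ω → ℝ := fun t ω => ∑ x, (|W₁ t ω x| + |W₂ t ω x|)
  let gapSum : ℕ → Ω → ℝ := fun t ω => ∑ x, gap γ ηs Q η x t ω ^ 2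
  have bΔ : ∀ t, IsBdd (F t) fun ω => ‖Δ t ω‖ := fun t => IsBdd.pi_norm fun x =>
    (((H.isBdd_q t x).sub (IsBdd.const _)).sub (H.isBdd_martPart t x)).sub (H.isBdd_telePart t x)
  have bres : ∀ t, IsBdd (F t) (res t) := fun t => IsBdd.sum _ fun x =>
    (H.isBdd_martPart t x).abs.add (H.isBdd_telePart t x).abs
  have bgap : ∀ t, IsBdd (F t) (gapSum t) := fun t => IsBdd.sum _ fun x =>
    (H.isBdd_gap t x).pow_two
  have iΔ : ∀ t, Integrable (fun ω => ‖Δ t ω‖) μ := fun t => ((bΔ t).mono (H.chain.le t)).integrable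
  have ires : ∀ t, Integrable (res t) μ := fun t => ((bres t).mono (H.chain.le t)).integrable
  have igap : ∀ t, Integrable (gapSum t) μ := fun t => ((bgap t).mono (H.chain.le t)).integrable
  have hQΔ : ∀ t ω, ‖Q t ω - Qstar‖ ≤ ‖Δ t ω‖ + res t ω := by
    intro t ω
    have hres0 : 0 ≤ res t ω := Finset.sum_nonneg fun x _ => by positivity
    refine (pi_norm_le_iff_of_nonneg (by positivity)).2 fun x => ?_
    have e : (Q t ω - Qstar) x = Δ t ω x + (W₁ t ω x + W₂ t ω x) := by
      simp only [Δ, Pi.sub_apply]; ring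
    rw [e]
    refine (norm_add_le _ _).trans (add_le_add (norm_le_pi_norm _ x) ?_)
    refine (norm_add_le _ _).trans ?_
    exact Finset.single_le_sum (f := fun x => |W₁ t ω x| + |W₂ t ω x|)
      (fun x _ => by positivity) (Finset.mem_univ x)
  have hsum : ∀ (c : ℝ), 0 ≤ c → ∑ _x : S × A, c ≤ E * c := by
    intro c hc
    rw [Finset.sum_const, nsmul_eq_mul, Finset.card_univ]
    exact mul_le_mul_of_nonneg_right hcard hc
  have hresint : ∀ t, ∫ ω, res t ω ∂μ ≤ 37 * E ^ 8 * tau q t := by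
    intro t
    have hτ := tau_pos hq t
    have i1 : ∀ x, Integrable (fun ω => |W₁ t ω x|) μ := fun x =>
      ((H.isBdd_martPart t x).abs.mono (H.chain.le t)).integrable
    have i2 : ∀ x, Integrable (fun ω => |W₂ t ω x|) μ := fun x =>
      ((H.isBdd_telePart t x).abs.mono (H.chain.le t)).integrable
    simp only [res]
    have i3 : ∀ x, Integrable (fun ω => |W₁ t ω x| + |W₂ t ω x|) μ := fun x => (i1 x).add (i2 x)
    rw [integral_finsetSum _ fun x _ => i3 x]
    refine (Finset.sum_le_sum (g := fun _ => 37 * E ^ 7 * tau q t) fun x _ => ?_).trans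
      ((hsum _ (by positivity)).trans_eq (by ring))
    rw [integral_add (i1 x) (i2 x)]
    have h1 := hmart t x
    have h2 : ∫ ω, |W₂ t ω x| ∂μ ≤ 20 * E ^ 7 * tau q t :=
      (le_abs_self _).trans (abs_integral_le_of_abs_le fun ω => by
        rw [abs_abs]; exact htele t ω x)
    have h3 : E ^ 3 * tau q t ≤ E ^ 7 * tau q t :=
      mul_le_mul_of_nonneg_right (pow_le_pow_right₀ (by linarith) (by norm_num)) hτ.le
    simp only [W₁]
    linarith
  have hgapS : ∀ t, ∫ ω, gapSum t ω ∂μ ≤ 128 * E ^ 10 * tau q t := by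
    intro t
    have hτ := tau_pos hq t
    have hθ : theta p t ≤ E * tau q t := (theta_le_tau H.one_le_p hq t).trans
      (mul_le_mul_of_nonneg_right hqE hτ.le)
    simp only [gapSum]
    have i1 : ∀ x, Integrable (fun ω => gap γ ηs Q η x t ω ^ 2) μ := fun x =>
      ((H.isBdd_gap t x).pow_two.mono (H.chain.le t)).integrable
    rw [integral_finsetSum _ fun x _ => i1 x]
    refine (Finset.sum_le_sum (g := fun _ => 128 * E ^ 9 * tau q t) fun x _ => ?_).trans
      ((hsum _ (by positivity)).trans_eq (by ring))
    refine (hgapint t x).trans ((mul_le_mul_of_nonneg_left hθ (by positivity)).trans_eq (by ring))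
  have hΔstep : ∀ t ω, ‖Δ (t + 1) ω‖ ≤ (1 - 1 / ((t : ℝ) + q)) * ‖Δ t ω‖
      + E * (1 / ((t : ℝ) + q)) * (E * gapSum t ω + res t ω) := by
    intro t ω
    have hs := one_le_add_cast hq t
    have hs1 : 1 / ((t : ℝ) + q) ≤ 1 := (div_le_one (by linarith)).2 hs
    have hres0 : 0 ≤ res t ω := Finset.sum_nonneg fun x _ => by positivity
    have hgap0 : 0 ≤ gapSum t ω := Finset.sum_nonneg fun x _ => sq_nonneg _
    refine (pi_norm_le_iff_of_nonneg ?_).2 fun x => ?_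
    · have := mul_nonneg (sub_nonneg.2 hs1) (norm_nonneg (Δ t ω))
      positivity
    obtain ⟨hb1, hb2⟩ := H.beta_mul_mem t x
    have hb3 := H.one_div_le_beta_mul t x
    have hb4 : beta γ dmin q t * d x ≤ E * (1 / ((t : ℝ) + q)) :=
      (mul_le_of_le_one_right (H.beta_nonneg t) (H.d_le_one x)).trans (hβE t)
    set a := beta γ dmin q t * d x
    have ha0 : 0 ≤ a := le_trans (by positivity) hb1
    have h1 : Δ (t + 1) ω x = (1 - a) * Δ t ω x
        + a * (drift γ P R j Q η x t ω + Q t ω x - Qstar x) := H.error_succ t ω x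
    -- The adjusted drift is the Bellman residual: `γ`-contractive in `Q`, plus the squared tracking
    -- error. The error of `Q` is then expressed through `Δ` and the removed parts.
    have h2 : |drift γ P R j Q η x t ω + Q t ω x - Qstar x|
        ≤ γ * (E * gapSum t ω + (‖Δ t ω‖ + res t ω)) := by
      have h3 := H.dual.bellman x (Q t ω) (η t ω x) (H.dual_mem t ω x)
      rw [show drift γ P R j Q η x t ω + Q t ω x - Qstar x
        = R x.1 x.2 + γ * ∑ s', P x.1 x.2 s' * j (η t ω x) (clippedGreedy γ (Q t ω) s') - Qstar x by
          unfold drift; ring]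
      refine h3.trans (mul_le_mul_of_nonneg_left (add_le_add ?_ (hQΔ t ω)) H.dual.gamma_nonneg)
      refine mul_le_mul hBE ?_ (sq_nonneg _) (by linarith)
      exact Finset.single_le_sum (f := fun x => gap γ ηs Q η x t ω ^ 2)
        (fun x _ => sq_nonneg _) (Finset.mem_univ x)
    rw [h1, Real.norm_eq_abs]
    refine (abs_add_le _ _).trans ?_
    rw [abs_mul, abs_mul, abs_of_nonneg ha0, abs_of_nonneg (by linarith : 0 ≤ 1 - a)]
    have h4 : |Δ t ω x| ≤ ‖Δ t ω‖ := norm_le_pi_norm (Δ t ω) x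
    have h5 := mul_le_mul_of_nonneg_left h4 (by linarith : 0 ≤ 1 - a)
    have h6 := mul_le_mul_of_nonneg_left h2 ha0
    have h7 : 0 ≤ E * gapSum t ω + res t ω := by positivity
    have h8 : a * (γ * (E * gapSum t ω + res t ω))
        ≤ E * (1 / ((t : ℝ) + q)) * (E * gapSum t ω + res t ω) := by
      rw [← mul_assoc]
      refine mul_le_mul_of_nonneg_right ?_ h7
      exact (mul_le_of_le_one_right ha0 H.dual.gamma_lt.le).trans hb4
    -- The factor `1 - a + a γ = 1 - a (1 - γ)` is at most `1 - 1 / (t + q)`.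
    have h9 := mul_le_mul_of_nonneg_right hb3 (norm_nonneg (Δ t ω))
    nlinarith
  have hu : ∀ t : ℕ, ∫ ω, ‖Δ (t + 1) ω‖ ∂μ ≤ (1 - 1 / ((t : ℝ) + q)) * ∫ ω, ‖Δ t ω‖ ∂μ
      + 165 * E ^ 12 / ((t : ℝ) + q) * ((t : ℝ) + q) ^ (-(1 / 2) : ℝ) := by
    intro t
    have hs := one_le_add_cast hq t
    have hτ := tau_pos hq t
    have h1 := integral_mono (iΔ (t + 1)) (((iΔ t).const_mul (1 - 1 / ((t : ℝ) + q))).add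
      ((((igap t).const_mul E).add (ires t)).const_mul (E * (1 / ((t : ℝ) + q))))) (hΔstep t)
    rw [integral_add' ((iΔ t).const_mul _) ((((igap t).const_mul E).add (ires t)).const_mul _),
      integral_const_mul, integral_const_mul, integral_add' ((igap t).const_mul E) (ires t),
      integral_const_mul] at h1
    refine h1.trans (add_le_add le_rfl ?_)
    have h2 : E * ∫ ω, gapSum t ω ∂μ + ∫ ω, res t ω ∂μ ≤ 165 * E ^ 11 * tau q t := by
      have h3 := mul_le_mul_of_nonneg_left (hgapS t) (show 0 ≤ E by linarith)
      have h4 := hresint t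
      have h5 : E ^ 8 * tau q t ≤ E ^ 11 * tau q t :=
        mul_le_mul_of_nonneg_right (pow_le_pow_right₀ (by linarith) (by norm_num)) hτ.le
      have e : E * (128 * E ^ 10 * tau q t) = 128 * (E ^ 11 * tau q t) := by ring
      linarith
    refine (mul_le_mul_of_nonneg_left h2 (by positivity)).trans_eq ?_
    rw [tau]; ring
  have hτ := tau_pos hq t
  have hfinal : ∫ ω, ‖Δ t ω‖ ∂μ ≤ 330 * E ^ 12 * tau q t := by
    refine recursion_half (u := fun t => ∫ ω, ‖Δ t ω‖ ∂μ) (C := 165 * E ^ 12) (K := 330 * E ^ 12) hq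
      (by linarith) (by positivity) ?_ hu t
    have h1 : ∫ ω, ‖Δ 0 ω‖ ∂μ ≤ E := by
      refine (le_abs_self _).trans (abs_integral_le_of_abs_le fun ω => ?_)
      rw [abs_norm]
      refine (pi_norm_le_iff_of_nonneg (by linarith)).2 fun x => ?_
      have h2 := H.dual.qstar_mem x
      have h3 := H.dual.vmax_le
      simp only [Δ, W₁, W₂, martPart, telePart, H.q_zero, sub_zero, Real.norm_eq_abs]
      rw [abs_le]
      constructor <;> linarith [h2.1, h2.2]
    have h2 : 1 / E ≤ q ^ (-(1 / 2) : ℝ) := by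
      have h3 := one_div_le_tau hq 0
      simp only [tau, Nat.cast_zero, zero_add] at h3
      exact (one_div_le_one_div_of_le (by linarith) hqE).trans h3
    have h4 : E ^ 1 ≤ E ^ 11 := pow_le_pow_right₀ (by linarith) (by norm_num)
    calc _ ≤ E := h1
      _ ≤ 330 * E ^ 11 := by linarith [show 0 ≤ E ^ 11 by positivity]
      _ = 330 * E ^ 12 * (1 / E) := by field_simp
      _ ≤ _ := by gcongr
  have bQ : IsBdd (F t) fun ω => ‖Q t ω - Qstar‖ := IsBdd.pi_norm fun x =>
    (H.isBdd_q t x).sub (IsBdd.const _)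
  have iQ : Integrable (fun ω => ‖Q t ω - Qstar‖) μ := (bQ.mono (H.chain.le t)).integrable
  refine ⟨iQ, ?_⟩
  have h1 := integral_mono iQ ((iΔ t).add (ires t)) (hQΔ t)
  rw [integral_add' (iΔ t) (ires t)] at h1
  have h2 := hresint t
  have h5 : E ^ 8 * tau q t ≤ E ^ 12 * tau q t :=
    mul_le_mul_of_nonneg_right (pow_le_pow_right₀ (by linarith) (by norm_num)) hτ.le
  have h6 : 0 ≤ E ^ 12 * tau q t := by positivity
  linarith

end Decomposition

end Run

end Run

/-! ### Identification of the algorithm with an abstract run -/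

section Assembly

variable {S A : Type*} [Fintype S] [Fintype A]

lemma step_of_ne {f : ℝ → EReal} {lam γ lo hi α β rw' : ℝ} {x y : S × A} {s' : S}
    {z : (S × A → ℝ) × (S × A → ℝ)} (h : y ≠ x) :
    (step f lam γ lo hi α β x rw' s' z).1 y = z.1 y ∧
      (step f lam γ lo hi α β x rw' s' z).2 y = z.2 y := by
  classical
  simp [step, Function.update, h]

lemma step_self {f : ℝ → EReal} {lam γ lo hi α β rw' : ℝ} {x : S × A} {s' : S}
    {z : (S × A → ℝ) × (S × A → ℝ)} :
    (step f lam γ lo hi α β x rw' s' z).1 x = (1 - β) * z.1 x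
        + β * (rw' + γ * (sampleJ f lam (z.2 x) (clippedGreedy γ z.1 s')).toReal) ∧
      (step f lam γ lo hi α β x rw' s' z).2 x = clamp lo hi (z.2 x + α * derivWithin
        (fun η => (sampleJ f lam η (clippedGreedy γ z.1 s')).toReal) (Set.Icc lo hi) (z.2 x)) := by
  simp [step, clamp]

lemma iterates_dual_mem {f : ℝ → EReal} {lam γ lo hi : ℝ} {α β : ℕ → ℝ} {η0 : S × A → ℝ}
    {st : ℕ → S} {act : ℕ → A} {rw' : ℕ → ℝ} (hle : lo ≤ hi) (h0 : ∀ x, η0 x ∈ Set.Icc lo hi)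
    (t : ℕ) (x : S × A) :
    (iterates f lam γ lo hi α β η0 st act rw' t).2 x ∈ Set.Icc lo hi := by
  induction t with
  | zero => exact h0 x
  | succ t ih =>
    rw [iterates]
    by_cases hx : x = (st t, act t)
    · rw [hx, step_self.2]; exact clamp_mem hle _
    · rw [(step_of_ne hx).2]; exact ih

namespace DualAssumptions

variable {f : ℝ → EReal} {lam γ σ κ CM lo hi : ℝ} {P : S → A → S → ℝ} [Nonempty S] [Nonempty A]

lemma iterates_succ (H : DualAssumptions f lam γ σ κ CM lo hi P) {α β : ℕ → ℝ} {η0 : S × A → ℝ}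
    {st : ℕ → S} {act : ℕ → A} {rw' : ℕ → ℝ} (h0 : ∀ x, η0 x ∈ Set.Icc lo hi) (t : ℕ) (x : S × A)
    {z : ℕ → (S × A → ℝ) × (S × A → ℝ)} (hz : z = iterates f lam γ lo hi α β η0 st act rw') :
    (z (t + 1)).1 x = (z t).1 x + hit x (st t, act t) * (β t * (rw' t
        + γ * extJ f lam γ lo hi ((z t).2 x) (clippedGreedy γ (z t).1 (st (t + 1)))
        - (z t).1 x)) ∧
      (z (t + 1)).2 x = clamp lo hi ((z t).2 x + hit x (st t, act t) * (α t *
        extGrad f lam γ lo hi ((z t).2 x) (clippedGreedy γ (z t).1 (st (t + 1))))) := by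
  have hη : (z t).2 x ∈ Set.Icc lo hi := hz ▸ iterates_dual_mem H.le h0 t x
  have hv := clippedGreedy_mem H.gamma_lt (z t).1 (st (t + 1))
  have e : z (t + 1) = step f lam γ lo hi (α t) (β t) (st t, act t) (rw' t) (st (t + 1)) (z t) := by
    rw [hz, iterates]
  by_cases hx : x = (st t, act t)
  · rw [e, ← hx, hit_self, step_self.1, step_self.2, H.sampleJ_eq hη hv, EReal.toReal_coe,
      H.derivWithin_sampleJ hη hv, extJ, extGrad, clamp_of_mem hη, clamp_of_mem hv]
    constructor
    · ring
    · rw [one_mul]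
  · rw [e, (step_of_ne hx).1, (step_of_ne hx).2, hit_of_ne (Ne.symm hx), zero_mul, zero_mul,
      add_zero, add_zero, clamp_of_mem hη]
    exact ⟨rfl, rfl⟩

end DualAssumptions

/-- A bound for all the parameters of the algorithm. -/
def runConst (γ lam σ κ M ρ D CM dmin dmax : ℝ) : ℝ :=
  dualConst lam γ σ κ CM D + 2 * M / (1 - ρ) + (⌈(dmax / dmin) ^ (3 / 2 : ℝ)⌉₊ : ℝ)
    + (⌈dmax / ((1 - γ) * dmin)⌉₊ : ℝ) + dmin⁻¹ + (κ * dmin)⁻¹ + ((1 - γ) * dmin)⁻¹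

lemma alphaStep_eq {κ dmin dmax : ℝ} (t : ℕ) :
    alphaStep κ dmin dmax t
      = theta (⌈(dmax / dmin) ^ (3 / 2 : ℝ)⌉₊ : ℝ) t * (κ * dmin)⁻¹ := by
  rw [alphaStep, theta, Real.rpow_neg (by positivity), one_div, mul_inv, mul_comm]

lemma betaStep_eq {γ dmin dmax : ℝ} (t : ℕ) :
    betaStep γ dmin dmax t
      = ((1 - γ) * dmin)⁻¹ / ((t : ℝ) + (⌈dmax / ((1 - γ) * dmin)⌉₊ : ℝ)) := by
  rw [betaStep, ← div_div, one_div]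

/-- Nonnegativity is all that is needed of `Phi1`: the leading term of the bound may then be added
at no cost. -/
lemma Phi1_nonneg {γ lam σ κ M ρ D CM dmin : ℝ} (n : ℕ) (hγ : γ < 1) (hlam : 0 < lam) (hσ : 0 < σ)
    (hκ : 0 < κ) (hM : 0 < M) (hρ : ρ < 1) (hD : 0 ≤ D) (hd : 0 < dmin) :
    0 ≤ Phi1 γ lam σ κ M ρ D CM dmin n := by
  have h1 := sub_pos.2 hγ
  have h2 := sub_pos.2 hρ
  unfold Phi1 gradBound
  positivity

variable {Ω : Type*} [Nonempty S] [MeasurableSpace S] [MeasurableSingletonClass S]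
  [Nonempty A] [MeasurableSpace A] [MeasurableSingletonClass A]
  [mΩ : MeasurableSpace Ω] {μ : Measure Ω} [IsProbabilityMeasure μ]

/-- The algorithm, with the rewards clipped to `[0, 1]`, is a run in the sense of `Run`. -/
lemma DualAssumptions.exists_run {f : ℝ → EReal} {γ lam σ κ M ρ CM lo hi dmin dmax : ℝ}
    {P : S → A → S → ℝ} {R : S → A → ℝ} {π : S → A → ℝ} {μ0 : S → ℝ} {d η0 Qstar : S × A → ℝ}
    {st : ℕ → Ω → S} {act : ℕ → Ω → A} {rw' : ℕ → Ω → ℝ}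
    (H : DualAssumptions f lam γ σ κ CM lo hi P) (hM : 0 < M) (hρ0 : 0 < ρ) (hρ1 : ρ < 1)
    (hCM : 0 ≤ CM) (hd : 0 < dmin) (hR : ∀ s a, R s a ∈ Set.Icc (0 : ℝ) 1)
    (hπ : ∀ s, π s ∈ stdSimplex ℝ A) (hmix : GeometricMixing P π d M ρ)
    (hmin : IsLeast (Set.range d) dmin) (hmax : IsGreatest (Set.range d) dmax)
    (T : IsTrajectory μ P R π μ0 st act rw') (h0 : ∀ x, η0 x ∈ Set.Icc lo hi)
    (hQ : IsRobustFixedPoint f lam γ P R Qstar) {z : Ω → ℕ → (S × A → ℝ) × (S × A → ℝ)}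
    (hz : ∀ ω, z ω = iterates f lam γ lo hi (alphaStep κ dmin dmax) (betaStep γ dmin dmax) η0
      (fun i => st i ω) (fun i => act i ω) (fun i => clamp 0 1 (rw' i ω))) :
    ∃ h ηs, Run (runConst γ lam σ κ M ρ (hi - lo) CM dmin dmax) γ κ lo hi dmin
      (⌈(dmax / dmin) ^ (3 / 2 : ℝ)⌉₊ : ℝ) (⌈dmax / ((1 - γ) * dmin)⌉₊ : ℝ) P R π d h
      (extJ f lam γ lo hi) (extGrad f lam γ lo hi) ηs Qstar μ (history st act rw')
      (fun t ω => (st t ω, act t ω)) (fun t ω => clamp 0 1 (rw' t ω))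
      (fun t ω => (z ω t).1) (fun t ω => (z ω t).2) := by
  obtain ⟨ηs, hreg⟩ := H.exists_regularDual hCM hR hQ
  obtain ⟨h, hbound, hpoisson⟩ := exists_poisson H.kernel hπ hρ0 hρ1 hmix
  have h1γ : 0 < 1 - γ := sub_pos.2 H.gamma_lt
  have h1ρ : 0 < 1 - ρ := sub_pos.2 hρ1
  have hκ := H.kappa_pos
  have hdmin : ∀ x, dmin ≤ d x := fun x => hmin.2 ⟨x, rfl⟩
  have hdmax : ∀ x, d x ≤ dmax := fun x => hmax.2 ⟨x, rfl⟩
  have hdd : dmin ≤ dmax := hmin.2 hmax.1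
  have hdp : 0 < dmax := hd.trans_le hdd
  have hsum : ∑ x, d x = 1 := hmix.1.2
  have hc : 1 ≤ dualConst lam γ σ κ CM (hi - lo) := hreg.one_le
  have n1 : 0 ≤ 2 * M / (1 - ρ) := by positivity
  have n2 : 0 ≤ dmin⁻¹ := by positivity
  have n3 : 0 ≤ (κ * dmin)⁻¹ := by positivity
  have n4 : 0 ≤ ((1 - γ) * dmin)⁻¹ := by positivity
  have n5 : (0 : ℝ) ≤ ⌈(dmax / dmin) ^ (3 / 2 : ℝ)⌉₊ := Nat.cast_nonneg _
  have n6 : (0 : ℝ) ≤ ⌈dmax / ((1 - γ) * dmin)⌉₊ := Nat.cast_nonneg _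
  refine ⟨h, ηs, ?_⟩
  exact {
    dual := hreg.mono (by unfold runConst; linarith)
    policy := hπ
    chain := T.controlledChain
    h_bound := fun x y => (hbound x y).trans (by unfold runConst; linarith)
    poisson := hpoisson
    dmin_pos := hd
    dmin_le := hdmin
    d_le_one := fun x => by
      rw [← hsum]
      exact Finset.single_le_sum (fun y _ => hd.le.trans (hdmin y)) (Finset.mem_univ x)
    one_le_p := by
      rw [Nat.one_le_cast, Nat.one_le_ceil_iff]
      positivity
    p_le := by unfold runConst; linarith
    one_le_q := by
      rw [Nat.one_le_cast, Nat.one_le_ceil_iff]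
      positivity
    q_le := by unfold runConst; linarith
    d_le_q := fun x => by
      refine le_trans ?_ (Nat.le_ceil _)
      rw [div_eq_mul_inv]
      exact mul_le_mul_of_nonneg_right (hdmax x) n4
    -- The stationary probabilities sum to `1` and each is at least `dmin`, so the number of pairs
    -- is controlled by `dmin` alone. This is what makes the final constant uniform over the spaces.
    card_le := by
      have h1 : (Fintype.card (S × A) : ℝ) * dmin ≤ 1 := by
        rw [← hsum, ← nsmul_eq_mul, ← Finset.card_univ]
        exact Finset.card_nsmul_le_sum _ _ _ fun x _ => hdmin x
      have h2 : (Fintype.card (S × A) : ℝ) ≤ dmin⁻¹ := by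
        rw [← one_div, le_div_iff₀ hd]; exact h1
      unfold runConst; linarith
    inv_kappa_le := by unfold runConst; linarith
    inv_gamma_le := by unfold runConst; linarith
    q_zero := fun ω x => by rw [hz]; rfl
    dual_zero := ⟨η0, h0, fun ω => by rw [hz]; rfl⟩
    q_succ := fun t ω x => by
      rw [← betaStep_eq]; exact (H.iterates_succ h0 t x (hz ω)).1
    dual_succ := fun t ω x => by
      rw [← alphaStep_eq]; exact (H.iterates_succ h0 t x (hz ω)).2 }

end Assembly

end RobustQ

end

theorem theorem5 :
    ∃ C : ℝ, 0 < C ∧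
    ∀ (γ lam σ κ M ρ D CM dmin dmax : ℝ),
      0 ≤ γ → γ < 1 → 0 < lam → 0 < σ → 0 < κ → 0 < M → 0 < ρ → ρ < 1 →
      (1 - γ)⁻¹ ≤ CM → 0 < dmin →
    ∃ K : ℝ, 0 ≤ K ∧
    ∀ (S A Ω : Type*) [Fintype S] [Nonempty S] [MeasurableSpace S] [MeasurableSingletonClass S]
      [Fintype A] [Nonempty A] [MeasurableSpace A] [MeasurableSingletonClass A]
      [MeasurableSpace Ω] (μ : MeasureTheory.Measure Ω) [MeasureTheory.IsProbabilityMeasure μ]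
      (f : ℝ → EReal) (lo hi : ℝ) (P : S → A → S → ℝ) (R : S → A → ℝ)
      (π : S → A → ℝ) (μ0 : S → ℝ) (d : S × A → ℝ) (η0 : S × A → ℝ)
      (st : ℕ → Ω → S) (act : ℕ → Ω → A) (rw : ℕ → Ω → ℝ),
      -- the Markov decision process, the divergence and the dual region `Θ = [lo, hi]`
      RobustQ.IsDivergenceFn f →
      (∀ s a, P s a ∈ stdSimplex ℝ S) →
      (∀ s a, R s a ∈ Set.Icc (0 : ℝ) 1) →
      lo ≤ hi → hi - lo = D →
      RobustQ.DualMaxIn f lam γ P (Set.Icc lo hi) →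
      RobustQ.DualSmoothOn f lam γ σ P (Set.Icc lo hi) →
      (∀ η ∈ Set.Icc lo hi, ∀ v ∈ Set.Icc (0 : ℝ) (1 - γ)⁻¹,
        ((-CM : ℝ) : EReal) ≤ RobustQ.sampleJ f lam η v ∧
          RobustQ.sampleJ f lam η v ≤ (CM : EReal)) →
      RobustQ.DualStronglyConcaveOn f lam γ κ P (Set.Icc lo hi) →
      -- the behavior chain and the observed trajectory
      (∀ s, π s ∈ stdSimplex ℝ A) →
      μ0 ∈ stdSimplex ℝ S →
      RobustQ.GeometricMixing P π d M ρ →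
      IsLeast (Set.range d) dmin → IsGreatest (Set.range d) dmax →
      RobustQ.IsTrajectory μ P R π μ0 st act rw →
      (∀ x, η0 x ∈ Set.Icc lo hi) →
      -- the robust optimal Q-function and the error of the iterates
      ∃ Qstar : S × A → ℝ,
        RobustQ.IsRobustFixedPoint f lam γ P R Qstar ∧
        (∀ Q' : S × A → ℝ, RobustQ.IsRobustFixedPoint f lam γ P R Q' → Q' = Qstar) ∧
        ∀ t : ℕ,
          MeasureTheory.Integrable (fun ω =>
            ‖(RobustQ.iterates f lam γ lo hi (RobustQ.alphaStep κ dmin dmax)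
                (RobustQ.betaStep γ dmin dmax) η0 (fun i => st i ω) (fun i => act i ω)
                (fun i => rw i ω) t).1 - Qstar‖) μ ∧
          ∫ ω, ‖(RobustQ.iterates f lam γ lo hi (RobustQ.alphaStep κ dmin dmax)
                (RobustQ.betaStep γ dmin dmax) η0 (fun i => st i ω) (fun i => act i ω)
                (fun i => rw i ω) t).1 - Qstar‖ ∂μ
            ≤ C * (RobustQ.Phi1 γ lam σ κ M ρ D CM dmin (Fintype.card S * Fintype.card A)
                / (σ * lam * dmin * (1 - γ) ^ 2 * ((t : ℝ) + 1) ^ (1 / 3 : ℝ)))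
              + K / ((t : ℝ) + 1) ^ (1 / 2 : ℝ) := by
  -- `K` is the constant of `integral_error_le`, fixed before the spaces and the process are
  -- introduced.
  refine ⟨1, one_pos, fun γ lam σ κ M ρ D CM dmin dmax hγ0 hγ1 hlam hσ hκ hM hρ0 hρ1 hCM hd =>
    ⟨400 * RobustQ.qBound (RobustQ.runConst γ lam σ κ M ρ D CM dmin dmax) ^ 12,
      mul_nonneg (by norm_num) (Even.pow_nonneg (by decide) _), ?_⟩⟩
  intro S A Ω _ _ _ _ _ _ _ _ _ μ _ f lo hi P R π μ0 d η0 st act rw hf hP hR hle hD hmaxIn hsmooth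
    hbound hstrong hπ _ hmix hmin hmax hT h0
  have H : RobustQ.DualAssumptions f lam γ σ κ CM lo hi P :=
    ⟨hf, hγ0, hγ1, hlam, hσ, hκ, hP, hle, hmaxIn, hsmooth, hbound, hstrong⟩
  obtain ⟨Qstar, hQ, huniq⟩ := H.exists_fixedPoint R
  refine ⟨Qstar, hQ, huniq, fun t => ?_⟩
  have hCM0 : 0 ≤ CM := (inv_nonneg.2 (sub_nonneg.2 hγ1.le)).trans hCM
  obtain ⟨h, ηs, hrun⟩ := H.exists_run hM hρ0 hρ1 hCM0 hd hR hπ hmix hmin hmax hT h0 hQ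
    (fun ω => rfl)
  obtain ⟨hint, hle'⟩ := hrun.integral_error_le t
  -- The run uses rewards clipped to `[0, 1]` everywhere; almost surely clipping changes none of
  -- them, hence none of the iterates.
  have hrw : ∀ᵐ ω ∂μ, ∀ i, rw i ω ∈ Set.Icc (0 : ℝ) 1 := ae_all_iff.2 hT.reward_mem
  have hae : (fun ω => ‖(RobustQ.iterates f lam γ lo hi (RobustQ.alphaStep κ dmin dmax)
      (RobustQ.betaStep γ dmin dmax) η0 (fun i => st i ω) (fun i => act i ω)
      (fun i => RobustQ.clamp 0 1 (rw i ω)) t).1 - Qstar‖) =ᵐ[μ]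
      fun ω => ‖(RobustQ.iterates f lam γ lo hi (RobustQ.alphaStep κ dmin dmax)
      (RobustQ.betaStep γ dmin dmax) η0 (fun i => st i ω) (fun i => act i ω)
      (fun i => rw i ω) t).1 - Qstar‖ := by
    filter_upwards [hrw] with ω hω
    simp only [RobustQ.clamp_of_mem (hω _)]
  refine ⟨hint.congr hae, ?_⟩
  rw [← integral_congr_ae hae]
  refine hle'.trans ?_
  have hD0 : 0 ≤ D := hD ▸ sub_nonneg.2 hle
  have hγ : 0 < 1 - γ := sub_pos.2 hγ1
  have hPhi := RobustQ.Phi1_nonneg (CM := CM) (Fintype.card S * Fintype.card A) hγ1 hlam hσ hκ hM hρ1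
    hD0 hd
  have hτ : RobustQ.tau (⌈dmax / ((1 - γ) * dmin)⌉₊ : ℝ) t ≤ 1 / ((t : ℝ) + 1) ^ (1 / 2 : ℝ) := by
    rw [one_div, ← Real.rpow_neg (by positivity), RobustQ.tau]
    exact Real.rpow_le_rpow_of_nonpos (by positivity) (by linarith [hrun.one_le_q]) (by norm_num)
  rw [hD, one_mul, div_eq_mul_one_div (400 * _)]
  -- The `t ^ (-1 / 3)` term is discarded as nonnegative; the `t ^ (-1 / 2)` term alone dominates
  -- the error.
  refine le_add_of_nonneg_of_le (by positivity) (mul_le_mul_of_nonneg_left hτ ?_)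
  exact mul_nonneg (by norm_num) (Even.pow_nonneg (by decide) _)
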